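/- **Universal property of co-dextrification.** Let $\kappa$ be an infinite regular cardinal and let $\mathcal L$ be a $\kappa$-small 2-category (that is, $\mathcal L$ has fewer than $\kappa$ 2-cells, hence fewer than $\kappa$ objects and 1-cells). *The 2-categories involved.* Let $\mathcal{L}ex_\kappa$ be the 2-category of categories with $\kappa$-small limits, functors preserving $\kappa$-small limits, and natural transformations. Let $\mathcal Ps_{colax}(\mathcal L,\mathcal Lex_\kappa)$ be the 2-category of pseudofunctors $\mathcal L\to\mathcal Lex_\kappa$, colax natural transformations (components $F_p:\mathcal C_p\to\mathcal D_p$ and 2-cells $F_q\circ\mathcal C_\mu\Rightarrow\mathcal D_\mu\circ F_p$ for $\mu:p\to q$, functorial and natural in $\mu$), and modifications. Let $\mathcal Ps^{adj}(\mathcal L^{coop},\mathcal Lex_\kappa)$ be the 2-category of pseudofunctors $\mathcal D:\mathcal L^{coop}\to\mathcal Lex_\kappa$, written $\mu\mapsto\mathcal D^\mu$, such that every $\mathcal D^\mu$ has a right adjoint $\mathcal D_\mu$ in $\mathcal Lex_\kappa$, with all pseudonatural transformations and all modifications. The forgetful 2-functor $$U:\mathcal Ps^{adj}(\mathcal L^{coop},\mathcal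 Lex_\kappa)\to\mathcal Ps_{colax}(\mathcal L,\mathcal Lex_\kappa)$$ sends $\mathcal D$ to the pseudofunctor $\mathcal L\to\mathcal Lex_\kappa$ formed by the categories $\mathcal D_p$ and the right adjoints $\mathcal D_\mu$ (with structure 2-cells obtained by conjugation), sends a pseudonatural transformation $F:\mathcal D\to\mathcal E$ to the colax natural transformation with the same components $F_p$ whose 2-cells $F_q\circ\mathcal D_\mu\Rightarrow\mathcal E_\mu\circ F_p$ are the mates of the isomorphisms $\mathcal E^\mu\circ F_q\cong F_p\circ\mathcal D^\mu$, and leaves the components of modifications unchanged. *Co-dextrification.* Let $\mathcal C:\mathcal L\to\mathcal Lex_\kappa$ be a pseudofunctor. For $r\in\mathcal L$, an object $\Gamma$ of the category $\widehat{\mathcal C}_r$ consists of an object $\Gamma^\mu\in\mathcal C_p$ for every $\mu:p\to r$, and a morphism $\Gamma^\alpha:\Gamma^\nu\to\mathcal C_\varrho(\Gamma^\mu)$ for all $\mu:p\to r$, $\nu:q\to r$, $\varrho:p\to q$ and $\alpha:\mu\Rightarrow\nu\circ\varrho$, such that, modulo the constraint isomorphisms of $\mathcal C$: (i) $\Gamma^{1_\mu}=1_{\Gamma^\mu}$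 for $1_\mu:\mu\Rightarrow\mu\circ 1_p$; (ii) $\mathcal C_\sigma(\Gamma^\alpha)\circ\Gamma^\beta=\Gamma^{(\beta\varrho)\circ\alpha}$ for $\alpha:\mu\Rightarrow\nu\circ\varrho$ and $\beta:\nu\Rightarrow\varpi\circ\sigma$; (iii) $\mathcal C_\gamma(\Gamma^\mu)\circ\Gamma^\alpha=\Gamma^{(\nu\gamma)\circ\alpha}$ for $\alpha:\mu\Rightarrow\nu\circ\varrho$ and $\gamma:\varrho\Rightarrow\sigma$. A morphism $\theta:\Gamma\to\Delta$ consists of morphisms $\theta^\mu:\Gamma^\mu\to\Delta^\mu$ with $\mathcal C_\varrho(\theta^\mu)\circ\Gamma^\alpha=\Delta^\alpha\circ\theta^\nu$ for all $\alpha:\mu\Rightarrow\nu\circ\varrho$. Precomposition, $(\widehat{\mathcal C}^\varpi\Gamma)^\mu=\Gamma^{\varpi\circ\mu}$ for $\varpi:r\to s$, $\mu:p\to r$ and $\Gamma\in\widehat{\mathcal C}_s$, and $(\widehat{\mathcal C}^\beta\Gamma)^\mu=\Gamma^{\beta\mu}$ for 2-cells $\beta$, makes $\widehat{\mathcal C}$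 a pseudofunctor $\mathcal L^{coop}\to\mathcal Lex_\kappa$. **Theorem.** 1. For every pseudofunctor $\mathcal C:\mathcal L\to\mathcal Lex_\kappa$, every functor $\widehat{\mathcal C}^\varpi$ has a right adjoint $\widehat{\mathcal C}_\varpi$ in $\mathcal Lex_\kappa$, so that $\widehat{\mathcal C}\in\mathcal Ps^{adj}(\mathcal L^{coop},\mathcal Lex_\kappa)$. Consequently the functors $\widehat{\mathcal C}_r\to\mathcal C_r$, $\Gamma\mapsto\Gamma^{1_r}$, are the components of a colax natural transformation $\mathrm{reflect}:U\widehat{\mathcal C}\to\mathcal C$, whose 2-cell at $\varpi:r\to s$ is $$(\widehat{\mathcal C}_\varpi\Gamma)^{1_s}\longrightarrow\mathcal C_\varpi\big((\widehat{\mathcal C}_\varpi\Gamma)^{\varpi}\big)=\mathcal C_\varpi\big((\widehat{\mathcal C}^\varpi\widehat{\mathcal C}_\varpi\Gamma)^{1_r}\big)\longrightarrow\mathcal C_\varpi(\Gamma^{1_r}),$$ the first map being $(\widehat{\mathcal C}_\varpi\Gamma)^{1_\varpi}$ for $1_\varpi:\varpi\Rightarrow 1_s\circ\varpi$ and the second being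 induced by the counit of $\widehat{\mathcal C}^\varpi\dashv\widehat{\mathcal C}_\varpi$. 2. For every $\mathcal C\in\mathcal Ps_{colax}(\mathcal L,\mathcal Lex_\kappa)$ and every $\mathcal D\in\mathcal Ps^{adj}(\mathcal L^{coop},\mathcal Lex_\kappa)$, the functor $$\mathcal Ps^{adj}(\mathcal L^{coop},\mathcal Lex_\kappa)(\mathcal D,\widehat{\mathcal C})\longrightarrow\mathcal Ps_{colax}(\mathcal L,\mathcal Lex_\kappa)(U\mathcal D,\mathcal C),\qquad F\mapsto\mathrm{reflect}\circ UF,$$ is an equivalence of categories. 3. Hence $\mathcal C\mapsto\widehat{\mathcal C}$ is bicategorically right adjoint to $U$: it is the object part of a pseudofunctor $R:\mathcal Ps_{colax}(\mathcal L,\mathcal Lex_\kappa)\to\mathcal Ps^{adj}(\mathcal L^{coop},\mathcal Lex_\kappa)$ that is right biadjoint to $U$, with pseudonatural counit $UR\to 1$ whose component at each $\mathcal C$ is $\mathrm{reflect}:U\widehat{\mathcal C}\to\mathcal C$. -/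

import Mathlib

open CategoryTheory CategoryTheory.Bicategory CategoryTheory.Limits
open scoped Pseudofunctor.StrongTrans Oplax.OplaxTrans Oplax.OplaxTrans.OplaxFunctor

universe w v u w₁ v₁ u₁ w₂ v₂ u₂

/-- The bicategory `Lᶜᵒᵒᵖ` obtained from `L` by reversing both 1-cells and 2-cells. -/
structure Coop (L : Type u₁) where
  /-- The underlying object of `L`. -/
  of : L

namespace Coop

variable {L : Type u₁} [Bicategory.{w₁, v₁} L]

/-- A 1-cell `X ⟶ Y` of `Lᶜᵒᵒᵖ` is a 1-cell `Y ⟶ X` of `L`. -/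
structure Hom (X Y : Coop L) where
  /-- The underlying 1-cell of `L`. -/
  un : Y.of ⟶ X.of

instance : CategoryStruct (Coop L) where
  Hom X Y := Hom X Y
  id X := ⟨𝟙 X.of⟩
  comp f g := ⟨g.un ≫ f.un⟩

/-- A 2-cell `f ⟶ g` of `Lᶜᵒᵒᵖ` is a 2-cell `g ⟶ f` of `L`. -/
@[ext]
structure Hom₂ {X Y : Coop L} (f g : X ⟶ Y) where
  /-- The underlying 2-cell of `L`. -/
  un₂ : g.un ⟶ f.un

instance homCategory (X Y : Coop L) : Category (X ⟶ Y) where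
  Hom f g := Hom₂ f g
  id f := ⟨𝟙 f.un⟩
  comp a b := ⟨b.un₂ ≫ a.un₂⟩
  id_comp a := Hom₂.ext (Category.comp_id a.un₂)
  comp_id a := Hom₂.ext (Category.id_comp a.un₂)
  assoc a b c := Hom₂.ext (Category.assoc c.un₂ b.un₂ a.un₂).symm

@[ext]
lemma hom₂_ext {X Y : Coop L} {f g : X ⟶ Y} {a b : f ⟶ g} (h : a.un₂ = b.un₂) : a = b :=
  Hom₂.ext h

/-- The 1-cell of `Lᶜᵒᵒᵖ` given by a 1-cell of `L`. -/
abbrev mk₁ {p q : L} (f : p ⟶ q) : (⟨q⟩ : Coop L) ⟶ ⟨p⟩ := Hom.mk f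

/-- The 2-cell of `Lᶜᵒᵒᵖ` given by a 2-cell of `L`. -/
abbrev mk₂ {p q : L} {f g : p ⟶ q} (a : f ⟶ g) : mk₁ g ⟶ mk₁ f := Hom₂.mk a

@[simp] lemma id_un (X : Coop L) : (𝟙 X : X ⟶ X).un = 𝟙 X.of := rfl
@[simp] lemma comp_un {X Y Z : Coop L} (f : X ⟶ Y) (g : Y ⟶ Z) : (f ≫ g).un = g.un ≫ f.un := rfl
@[simp] lemma id_un₂ {X Y : Coop L} (f : X ⟶ Y) : (𝟙 f : f ⟶ f).un₂ = 𝟙 f.un := rfl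
@[simp] lemma comp_un₂ {X Y : Coop L} {f g h : X ⟶ Y} (a : f ⟶ g) (b : g ⟶ h) :
    (a ≫ b).un₂ = b.un₂ ≫ a.un₂ := rfl

/-- An invertible 2-cell of `L` is an invertible 2-cell of `Lᶜᵒᵒᵖ`, in the other direction. -/
def isoMk {X Y : Coop L} {f g : X ⟶ Y} (e : g.un ≅ f.un) : f ≅ g where
  hom := ⟨e.hom⟩
  inv := ⟨e.inv⟩
  hom_inv_id := hom₂_ext e.inv_hom_id
  inv_hom_id := hom₂_ext e.hom_inv_id

@[simp] lemma isoMk_hom_un₂ {X Y : Coop L} {f g : X ⟶ Y} (e : g.un ≅ f.un) :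
    (isoMk e).hom.un₂ = e.hom := rfl
@[simp] lemma isoMk_inv_un₂ {X Y : Coop L} {f g : X ⟶ Y} (e : g.un ≅ f.un) :
    (isoMk e).inv.un₂ = e.inv := rfl

instance : Bicategory (Coop L) where
  homCategory X Y := homCategory X Y
  whiskerLeft f _ _ a := Hom₂.mk (a.un₂ ▷ f.un)
  whiskerRight a h := Hom₂.mk (h.un ◁ a.un₂)
  associator f g h := isoMk (α_ h.un g.un f.un)
  leftUnitor f := isoMk (ρ_ f.un).symm
  rightUnitor f := isoMk (λ_ f.un).symm
  whiskerLeft_id _ _ := hom₂_ext (by simp)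
  whiskerLeft_comp _ _ _ _ _ _ := hom₂_ext (by simp)
  id_whiskerLeft _ := hom₂_ext (by simp [isoMk])
  comp_whiskerLeft _ _ _ _ _ := hom₂_ext (by simp [isoMk])
  id_whiskerRight _ _ := hom₂_ext (by simp)
  comp_whiskerRight _ _ _ := hom₂_ext (by simp)
  whiskerRight_id _ := hom₂_ext (by simp [isoMk])
  whiskerRight_comp _ _ _ := hom₂_ext (by simp [isoMk])
  whisker_assoc _ _ _ _ _ := hom₂_ext (by simp [isoMk])
  whisker_exchange _ _ := hom₂_ext (whisker_exchange _ _)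
  pentagon _ _ _ _ := hom₂_ext (by simp [isoMk])
  triangle _ _ := hom₂_ext (by simp [isoMk])

@[simp] lemma whiskerLeft_un₂ {X Y Z : Coop L} (f : X ⟶ Y) {g h : Y ⟶ Z} (a : g ⟶ h) :
    (f ◁ a).un₂ = a.un₂ ▷ f.un := rfl
@[simp] lemma whiskerRight_un₂ {X Y Z : Coop L} {f g : X ⟶ Y} (a : f ⟶ g) (h : Y ⟶ Z) :
    (a ▷ h).un₂ = h.un ◁ a.un₂ := rfl
lemma associator_eq {X Y Z W : Coop L} (f : X ⟶ Y) (g : Y ⟶ Z) (h : Z ⟶ W) :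
    α_ f g h = isoMk (α_ h.un g.un f.un) := rfl
lemma leftUnitor_eq {X Y : Coop L} (f : X ⟶ Y) : λ_ f = isoMk (ρ_ f.un).symm := rfl
lemma rightUnitor_eq {X Y : Coop L} (f : X ⟶ Y) : ρ_ f = isoMk (λ_ f.un).symm := rfl

end Coop

variable (L : Type u₁) [Bicategory.{w₁, v₁} L] (K : Type u₂) [Bicategory.{w₂, v₂} K]

/-- A pseudofunctor `D : Lᶜᵒᵒᵖ ⥤ᵖ K` sending every 1-cell to a 1-cell that has a right adjoint
in `K`. -/
structure AdjPseudofunctor where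
  /-- The underlying pseudofunctor. -/
  toPs : Coop L ⥤ᵖ K
  isLeftAdjoint {X Y : Coop L} (f : X ⟶ Y) : IsLeftAdjoint (toPs.map f)

/-- The bicategory `Ps^adj(Lᶜᵒᵒᵖ, K)` of pseudofunctors `Lᶜᵒᵒᵖ ⥤ᵖ K` all of whose 1-cells have
right adjoints, pseudonatural transformations and modifications. -/
abbrev PsAdj := InducedBicategory (Coop L ⥤ᵖ K) (AdjPseudofunctor.toPs (L := L) (K := K))

/-- The bicategory `Ps_colax(L, K)` of pseudofunctors `L ⥤ᵖ K`, colax natural transformations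
and modifications. -/
abbrev PsColax := InducedBicategory (L ⥤ᵒᵖᴸ K) (Pseudofunctor.toOplax (B := L) (C := K))

variable {L K}
namespace AdjPseudofunctor

variable (D : AdjPseudofunctor L K)

/-- The chosen right adjoint `D_f` of `D^f`. -/
noncomputable def radj {X Y : Coop L} (f : X ⟶ Y) : D.toPs.obj Y ⟶ D.toPs.obj X :=
  @rightAdjoint _ _ _ _ (D.toPs.map f) (D.isLeftAdjoint f)

/-- The chosen adjunction `D^f ⊣ D_f`. -/
noncomputable def adj {X Y : Coop L} (f : X ⟶ Y) : Adjunction (D.toPs.map f) (D.radj f) :=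
  @Adjunction.ofIsLeftAdjoint _ _ _ _ (D.toPs.map f) (D.isLeftAdjoint f)

/-- `D` as a pseudofunctor into the bicategory of adjunctions in `K`: passage to right adjoints
is the calculus of conjugate 2-cells. -/
noncomputable def toAdj : Coop L ⥤ᵖ Adj K where
  obj X := ⟨D.toPs.obj X⟩
  map f := Adj.Hom.mk (D.adj f)
  map₂ {_ _ f g} a :=
    { τl := D.toPs.map₂ a
      τr := conjugateEquiv (D.adj g) (D.adj f) (D.toPs.map₂ a) }
  map₂_id _ := Adj.hom₂_ext (by simp)
  map₂_comp _ _ := Adj.hom₂_ext (by simp)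
  mapId X := Adj.iso₂Mk (D.toPs.mapId X)
    (conjugateIsoEquiv (Adjunction.id _) (D.adj (𝟙 X)) (D.toPs.mapId X)) rfl
  mapComp f g := Adj.iso₂Mk (D.toPs.mapComp f g)
    (conjugateIsoEquiv ((D.adj f).comp (D.adj g)) (D.adj (f ≫ g)) (D.toPs.mapComp f g)) rfl
  map₂_whisker_left f _ _ a := Adj.hom₂_ext (D.toPs.map₂_whisker_left f a)
  map₂_whisker_right a f := Adj.hom₂_ext (D.toPs.map₂_whisker_right a f)
  map₂_associator f g h := Adj.hom₂_ext (D.toPs.map₂_associator f g h)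
  map₂_left_unitor f := Adj.hom₂_ext (D.toPs.map₂_left_unitor f)
  map₂_right_unitor f := Adj.hom₂_ext (D.toPs.map₂_right_unitor f)

/-- The pseudofunctor `L ⥤ᵖ K` formed by the right adjoints `D_f`. -/
noncomputable def rightPs : L ⥤ᵖ K where
  obj p := D.toPs.obj ⟨p⟩
  map f := D.radj (Coop.mk₁ f)
  map₂ a := (D.toAdj.map₂ (Coop.mk₂ a)).τr
  map₂_id f := congrArg Adj.Hom₂.τr (D.toAdj.map₂_id (Coop.mk₁ f))
  map₂_comp a b := congrArg Adj.Hom₂.τr (D.toAdj.map₂_comp (Coop.mk₂ b) (Coop.mk₂ a))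
  mapId p := Adj.rIso (D.toAdj.mapId ⟨p⟩)
  mapComp f g := Adj.rIso (D.toAdj.mapComp (Coop.mk₁ g) (Coop.mk₁ f))
  map₂_whisker_left f _ _ a := by
    have := congrArg Adj.Hom₂.τr (D.toAdj.map₂_whisker_right (Coop.mk₂ a) (Coop.mk₁ f))
    simp only [Adj.comp_τr, Adj.whiskerRight_τr, Category.assoc] at this
    exact this
  map₂_whisker_right a f := by
    have := congrArg Adj.Hom₂.τr (D.toAdj.map₂_whisker_left (Coop.mk₁ f) (Coop.mk₂ a))
    simp only [Adj.comp_τr, Adj.whiskerLeft_τr, Category.assoc] at this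
    exact this
  map₂_associator f g h := by
    have := congrArg Adj.Hom₂.τr
      (D.toAdj.map₂_associator (Coop.mk₁ h) (Coop.mk₁ g) (Coop.mk₁ f))
    simp only [Adj.comp_τr, Adj.whiskerLeft_τr, Adj.whiskerRight_τr, Category.assoc,
      Adj.associator_hom_τr] at this
    exact this
  map₂_left_unitor f := by
    have h : D.toAdj.map₂ (ρ_ (Coop.mk₁ f)).inv = (ρ_ _).inv ≫
        D.toAdj.map (Coop.mk₁ f) ◁ (D.toAdj.mapId _).inv ≫
        (D.toAdj.mapComp (Coop.mk₁ f) (𝟙 _)).inv := by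
      rw [← cancel_epi (D.toAdj.map₂ (ρ_ (Coop.mk₁ f)).hom), ← PrelaxFunctor.map₂_comp]
      simp
    have := congrArg Adj.Hom₂.τr h
    simp only [Adj.comp_τr, Adj.whiskerLeft_τr, Category.assoc,
      Adj.rightUnitor_inv_τr] at this
    exact this
  map₂_right_unitor f := by
    have h : D.toAdj.map₂ (λ_ (Coop.mk₁ f)).inv = (λ_ _).inv ≫
        (D.toAdj.mapId _).inv ▷ D.toAdj.map (Coop.mk₁ f) ≫
        (D.toAdj.mapComp (𝟙 _) (Coop.mk₁ f)).inv := by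
      rw [← cancel_epi (D.toAdj.map₂ (λ_ (Coop.mk₁ f)).hom), ← PrelaxFunctor.map₂_comp]
      simp
    have := congrArg Adj.Hom₂.τr h
    simp only [Adj.comp_τr, Adj.whiskerRight_τr, Category.assoc,
      Adj.leftUnitor_inv_τr] at this
    exact this

lemma rightPs_map₂ {p q : L} {f g : p ⟶ q} (a : f ⟶ g) : D.rightPs.map₂ a =
    conjugateEquiv (D.adj (Coop.mk₁ f)) (D.adj (Coop.mk₁ g)) (D.toPs.map₂ (Coop.mk₂ a)) := rfl

lemma rightPs_mapId_hom (p : L) : (D.rightPs.mapId p).hom =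
    conjugateEquiv (D.adj (𝟙 (⟨p⟩ : Coop L))) (Adjunction.id _) (D.toPs.mapId ⟨p⟩).inv := rfl

lemma rightPs_mapComp_hom {p q r : L} (f : p ⟶ q) (g : q ⟶ r) : (D.rightPs.mapComp f g).hom =
    conjugateEquiv (D.adj (Coop.mk₁ g ≫ Coop.mk₁ f))
      ((D.adj (Coop.mk₁ g)).comp (D.adj (Coop.mk₁ f)))
      (D.toPs.mapComp (Coop.mk₁ g) (Coop.mk₁ f)).inv := rfl

variable {D} {E : AdjPseudofunctor L K}

/-- The mate `D_f ≫ F_q ⟶ F_p ≫ E_f` of the pseudonaturality isomorphism of `F`. -/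
noncomputable def mate (F : D.toPs ⟶ E.toPs) {p q : L} (f : p ⟶ q) :
    D.rightPs.map f ≫ F.app ⟨q⟩ ⟶ F.app ⟨p⟩ ≫ E.rightPs.map f :=
  mateEquiv (D.adj (Coop.mk₁ f)) (E.adj (Coop.mk₁ f)) (F.naturality (Coop.mk₁ f)).inv

/-- A pseudonatural transformation `F : D ⟶ E` is, by taking mates, a colax natural transformation
between the pseudofunctors of right adjoints. -/
noncomputable def rightTrans (F : D.toPs ⟶ E.toPs) : D.rightPs.toOplax ⟶ E.rightPs.toOplax where
  app p := F.app ⟨p⟩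
  naturality f := mate F f
  naturality_naturality {p q f g} a := by
    have h1 := mateEquiv_conjugateEquiv_vcomp (D.adj (Coop.mk₁ f)) (E.adj (Coop.mk₁ f))
      (E.adj (Coop.mk₁ g)) (F.naturality (Coop.mk₁ f)).inv (E.toPs.map₂ (Coop.mk₂ a))
    have h2 := conjugateEquiv_mateEquiv_vcomp (D.adj (Coop.mk₁ f)) (D.adj (Coop.mk₁ g))
      (E.adj (Coop.mk₁ g)) (D.toPs.map₂ (Coop.mk₂ a)) (F.naturality (Coop.mk₁ g)).inv
    refine h2.symm.trans (Eq.trans (congrArg _ ?_) h1)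
    dsimp only [leftAdjointSquareConjugate.vcomp, leftAdjointConjugateSquare.vcomp]
    rw [Iso.inv_comp_eq, ← Category.assoc, Iso.eq_comp_inv]
    exact F.naturality_naturality (Coop.mk₂ a)
  naturality_id p := by
    have h1 := mateEquiv_conjugateEquiv_vcomp (D.adj (𝟙 (⟨p⟩ : Coop L))) (E.adj (𝟙 ⟨p⟩))
      (Adjunction.id _) (F.naturality (𝟙 ⟨p⟩)).inv (E.toPs.mapId ⟨p⟩).inv
    have h2 := conjugateEquiv_mateEquiv_vcomp (D.adj (𝟙 (⟨p⟩ : Coop L))) (Adjunction.id _)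
      (Adjunction.id _) (D.toPs.mapId ⟨p⟩).inv ((ρ_ (F.app ⟨p⟩)).hom ≫ (λ_ (F.app ⟨p⟩)).inv)
    have h3 : mateEquiv (Adjunction.id _) (Adjunction.id _)
        ((ρ_ (F.app ⟨p⟩)).hom ≫ (λ_ (F.app ⟨p⟩)).inv) =
          (λ_ (F.app ⟨p⟩)).hom ≫ (ρ_ (F.app ⟨p⟩)).inv := by
      rw [mateEquiv_apply']
      dsimp [Bicategory.Adjunction.id]
      bicategory
    rw [h3] at h2
    refine h1.symm.trans (Eq.trans (congrArg _ ?_) h2)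
    dsimp only [leftAdjointSquareConjugate.vcomp, leftAdjointConjugateSquare.vcomp]
    rw [Pseudofunctor.StrongTrans.naturality_id_inv]
    simp
  naturality_comp f g := by
    have h1 := mateEquiv_conjugateEquiv_vcomp (D.adj (Coop.mk₁ g ≫ Coop.mk₁ f))
      (E.adj (Coop.mk₁ g ≫ Coop.mk₁ f)) ((E.adj (Coop.mk₁ g)).comp (E.adj (Coop.mk₁ f)))
      (F.naturality (Coop.mk₁ g ≫ Coop.mk₁ f)).inv
      (E.toPs.mapComp (Coop.mk₁ g) (Coop.mk₁ f)).inv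
    have h2 := conjugateEquiv_mateEquiv_vcomp (D.adj (Coop.mk₁ g ≫ Coop.mk₁ f))
      ((D.adj (Coop.mk₁ g)).comp (D.adj (Coop.mk₁ f)))
      ((E.adj (Coop.mk₁ g)).comp (E.adj (Coop.mk₁ f)))
      (D.toPs.mapComp (Coop.mk₁ g) (Coop.mk₁ f)).inv
      (leftAdjointSquare.hcomp (F.naturality (Coop.mk₁ g)).inv (F.naturality (Coop.mk₁ f)).inv)
    rw [Bicategory.mateEquiv_hcomp] at h2
    refine h1.symm.trans (Eq.trans (congrArg _ ?_) h2)
    dsimp only [leftAdjointSquareConjugate.vcomp, leftAdjointConjugateSquare.vcomp,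
      leftAdjointSquare.hcomp]
    rw [Pseudofunctor.StrongTrans.naturality_comp_inv]
    simp

lemma comp_assoc₅ {A : Type u₁} [Category.{v₁} A] {x₀ x₁ x₂ x₃ x₄ x₅ : A} (a : x₀ ⟶ x₁)
    (b : x₁ ⟶ x₂) (c : x₂ ⟶ x₃) (d : x₃ ⟶ x₄) (e : x₄ ⟶ x₅) :
    a ≫ b ≫ c ≫ d ≫ e = (((a ≫ b) ≫ c) ≫ d) ≫ e := by simp

lemma mateEquiv_whiskerRight_comp {a b c d : K} {l₁ : a ⟶ b} {r₁ : b ⟶ a} {l₂ : c ⟶ d} {r₂ : d ⟶ c}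
    (adj₁ : Adjunction l₁ r₁) (adj₂ : Adjunction l₂ r₂) {g g' : a ⟶ c} {h : b ⟶ d} (m : g ⟶ g')
    (β : g' ≫ l₂ ⟶ l₁ ≫ h) :
    Bicategory.mateEquiv adj₁ adj₂ (m ▷ l₂ ≫ β) = r₁ ◁ m ≫ Bicategory.mateEquiv adj₁ adj₂ β := by
  rw [mateEquiv_apply', mateEquiv_apply']
  calc
    _ = 𝟙 _ ⊗≫ r₁ ◁ (g ◁ adj₂.unit ≫ m ▷ (l₂ ≫ r₂)) ⊗≫ r₁ ◁ β ▷ r₂ ⊗≫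
        adj₁.counit ▷ h ▷ r₂ ⊗≫ 𝟙 _ := by bicategory
    _ = _ := by
      rw [whisker_exchange]
      bicategory

lemma mateEquiv_comp_whiskerLeft {a b c d : K} {l₁ : a ⟶ b} {r₁ : b ⟶ a} {l₂ : c ⟶ d} {r₂ : d ⟶ c}
    (adj₁ : Adjunction l₁ r₁) (adj₂ : Adjunction l₂ r₂) {g : a ⟶ c} {h h' : b ⟶ d} (m : h ⟶ h')
    (β : g ≫ l₂ ⟶ l₁ ≫ h) :
    Bicategory.mateEquiv adj₁ adj₂ (β ≫ l₁ ◁ m) = Bicategory.mateEquiv adj₁ adj₂ β ≫ m ▷ r₂ := by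
  rw [mateEquiv_apply', mateEquiv_apply']
  calc
    _ = 𝟙 _ ⊗≫ r₁ ◁ g ◁ adj₂.unit ⊗≫ r₁ ◁ β ▷ r₂ ⊗≫
        ((r₁ ≫ l₁) ◁ m ≫ adj₁.counit ▷ h') ▷ r₂ ⊗≫ 𝟙 _ := by bicategory
    _ = _ := by
      rw [whisker_exchange]
      bicategory

/-- A modification between pseudonatural transformations `D ⟶ E` is a modification between the
corresponding colax natural transformations of right adjoints. -/
noncomputable def rightMod {F G : D.toPs ⟶ E.toPs} (m : F ⟶ G) : rightTrans F ⟶ rightTrans G where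
  as :=
    { app := fun p => m.as.app ⟨p⟩
      naturality := fun {p q} f => by
        refine (mateEquiv_whiskerRight_comp _ _ _ _).symm.trans
          (Eq.trans (congrArg _ ?_) (mateEquiv_comp_whiskerLeft _ _ _ _))
        have h : m.as.app ⟨q⟩ ▷ E.toPs.map (Coop.mk₁ f) ≫ (G.naturality (Coop.mk₁ f)).inv =
            (F.naturality (Coop.mk₁ f)).inv ≫ D.toPs.map (Coop.mk₁ f) ◁ m.as.app ⟨p⟩ := by
          rw [Iso.eq_inv_comp, ← Category.assoc, Iso.comp_inv_eq]
          exact (m.as.naturality (Coop.mk₁ f)).symm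
        exact h }

end AdjPseudofunctor

open AdjPseudofunctor InducedBicategory

variable (L K)

/-- The forgetful 2-functor `U : Ps^adj(Lᶜᵒᵒᵖ, K) ⥤ Ps_colax(L, K)`: it sends `D` to the
pseudofunctor of right adjoints `D_f`, and a pseudonatural transformation to its mate. -/
noncomputable def forgetAdj : PsAdj L K ⥤ᵖ PsColax L K where
  obj D := AdjPseudofunctor.rightPs D
  map F := mkHom (rightTrans F.hom)
  map₂ m := Hom₂.mk (rightMod m.hom)
  map₂_id _ := hom₂_ext (Oplax.OplaxTrans.homCategory.ext fun _ => rfl)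
  map₂_comp _ _ := hom₂_ext (Oplax.OplaxTrans.homCategory.ext fun _ => rfl)
  mapId D := isoMk (Oplax.OplaxTrans.isoMk (fun p => Iso.refl _) (fun f => by
    have h := mateEquiv_leftUnitor_hom_rightUnitor_inv (D.adj (Coop.mk₁ f))
    refine (congrArg (· ≫ _) (Bicategory.whiskerLeft_id _ _)).trans ((Category.id_comp _).trans ?_)
    refine Eq.trans h.symm (Eq.trans (Category.comp_id _).symm ?_)
    exact (congrArg (_ ≫ ·) (Bicategory.id_whiskerRight _ _)).symm))
  mapComp {D E G} F F' := isoMk (Oplax.OplaxTrans.isoMk (fun p => Iso.refl _) (fun f => by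
    have h := Bicategory.mateEquiv_vcomp (D.adj (Coop.mk₁ f)) (E.adj (Coop.mk₁ f))
      (G.adj (Coop.mk₁ f)) (F.hom.naturality (Coop.mk₁ f)).inv (F'.hom.naturality (Coop.mk₁ f)).inv
    refine (congrArg (· ≫ _) (Bicategory.whiskerLeft_id _ _)).trans ((Category.id_comp _).trans ?_)
    refine Eq.trans h.symm (Eq.trans (Eq.trans (congrArg _ ?_) (Category.comp_id _).symm)
      (congrArg (_ ≫ ·) (Bicategory.id_whiskerRight _ _)).symm)
    refine Eq.trans ?_ (Pseudofunctor.StrongTrans.categoryStruct_comp_naturality_inv _ _ _).symm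
    exact comp_assoc₅ _ _ _ _ _))
  map₂_whisker_left _ _ _ _ := hom₂_ext (Oplax.OplaxTrans.homCategory.ext fun _ =>
    ((Category.id_comp _).trans (Category.comp_id _)).symm)
  map₂_whisker_right _ _ := hom₂_ext (Oplax.OplaxTrans.homCategory.ext fun _ =>
    ((Category.id_comp _).trans (Category.comp_id _)).symm)
  map₂_associator F G H := hom₂_ext (Oplax.OplaxTrans.homCategory.ext fun p => by
    have : (α_ (F.hom.app ⟨p⟩) (G.hom.app ⟨p⟩) (H.hom.app ⟨p⟩)).hom =
      𝟙 _ ≫ 𝟙 _ ▷ H.hom.app ⟨p⟩ ≫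
        (α_ (F.hom.app ⟨p⟩) (G.hom.app ⟨p⟩) (H.hom.app ⟨p⟩)).hom ≫
          F.hom.app ⟨p⟩ ◁ 𝟙 _ ≫ 𝟙 _ := by simp
    exact this)
  map₂_left_unitor F := hom₂_ext (Oplax.OplaxTrans.homCategory.ext fun p => by
    have : (λ_ (F.hom.app ⟨p⟩)).hom = 𝟙 _ ≫ 𝟙 _ ▷ F.hom.app ⟨p⟩ ≫ (λ_ (F.hom.app ⟨p⟩)).hom := by
      simp
    exact this)
  map₂_right_unitor F := hom₂_ext (Oplax.OplaxTrans.homCategory.ext fun p => by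
    have : (ρ_ (F.hom.app ⟨p⟩)).hom = 𝟙 _ ≫ F.hom.app ⟨p⟩ ◁ 𝟙 _ ≫ (ρ_ (F.hom.app ⟨p⟩)).hom := by
      simp
    exact this)

/-- A category has `κ`-small limits: limits of all diagrams whose shape has fewer than `κ`
arrows. -/
def HasCardinalLimits (κ : Cardinal.{w}) (C : Type u) [Category.{v} C] : Prop :=
  ∀ (J : Type w) [SmallCategory J], HasCardinalLT (Arrow J) κ → HasLimitsOfShape J C

/-- A functor preserves `κ`-small limits. -/
def PreservesCardinalLimits (κ : Cardinal.{w}) {C : Type u} [Category.{v} C]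
    {D : Type u₁} [Category.{v₁} D] (F : C ⥤ D) : Prop :=
  ∀ (J : Type w) [SmallCategory J], HasCardinalLT (Arrow J) κ → PreservesLimitsOfShape J F

/-- The objects of `Lex_κ`: categories with `κ`-small limits. -/
structure LexCat (κ : Cardinal.{w}) where
  /-- The underlying type of objects. -/
  carrier : Type u
  [category : Category.{v} carrier]
  hasLimits : HasCardinalLimits κ carrier

namespace LexCat

variable {κ : Cardinal.{w}}

instance : CoeSort (LexCat.{w, v, u} κ) (Type u) := ⟨LexCat.carrier⟩

instance (C : LexCat.{w, v, u} κ) : Category.{v} C := C.category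

/-- The 1-cells of `Lex_κ`: functors that preserve `κ`-small limits. -/
structure Hom (C D : LexCat.{w, v, u} κ) where
  /-- The underlying functor. -/
  toFunctor : C ⥤ D
  preservesLimits : PreservesCardinalLimits κ toFunctor

lemma preserves_id (C : LexCat.{w, v, u} κ) : PreservesCardinalLimits κ (𝟭 C) :=
  fun _ _ _ => inferInstance

lemma preserves_comp {C D E : LexCat.{w, v, u} κ} (F : Hom C D) (G : Hom D E) :
    PreservesCardinalLimits κ (F.toFunctor ⋙ G.toFunctor) := fun J _ hJ => by
  have := F.preservesLimits J hJ
  have := G.preservesLimits J hJ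
  infer_instance

instance : CategoryStruct (LexCat.{w, v, u} κ) where
  Hom C D := Hom C D
  id C := ⟨𝟭 C, preserves_id C⟩
  comp F G := ⟨F.toFunctor ⋙ G.toFunctor, preserves_comp F G⟩

/-- The 2-cells of `Lex_κ`: natural transformations. -/
structure Hom₂ {C D : LexCat.{w, v, u} κ} (F G : C ⟶ D) where
  /-- The underlying natural transformation. -/
  toNatTrans : F.toFunctor ⟶ G.toFunctor

instance homCategory (C D : LexCat.{w, v, u} κ) : Category (C ⟶ D) where
  Hom F G := Hom₂ F G
  id F := ⟨𝟙 F.toFunctor⟩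
  comp a b := ⟨a.toNatTrans ≫ b.toNatTrans⟩
  id_comp a := congrArg Hom₂.mk (Category.id_comp a.toNatTrans)
  comp_id a := congrArg Hom₂.mk (Category.comp_id a.toNatTrans)
  assoc a b c := congrArg Hom₂.mk (Category.assoc a.toNatTrans b.toNatTrans c.toNatTrans)

section

variable {C D E E' : LexCat.{w, v, u} κ}

/-- The component of a 2-cell of `Lex_κ` at an object. -/
abbrev Hom₂.app {F G : C ⟶ D} (a : F ⟶ G) (X : C) : F.toFunctor.obj X ⟶ G.toFunctor.obj X :=
  (Hom₂.toNatTrans a).app X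

@[ext]
lemma hom₂_ext {F G : C ⟶ D} {a b : F ⟶ G} (h : ∀ X, Hom₂.app a X = Hom₂.app b X) : a = b :=
  congrArg Hom₂.mk (NatTrans.ext (funext h))

/-- A natural isomorphism gives an invertible 2-cell of `Lex_κ`. -/
def isoMk {F G : C ⟶ D} (e : F.toFunctor ≅ G.toFunctor) : F ≅ G where
  hom := Hom₂.mk e.hom
  inv := Hom₂.mk e.inv
  hom_inv_id := congrArg Hom₂.mk e.hom_inv_id
  inv_hom_id := congrArg Hom₂.mk e.inv_hom_id

end

instance : Bicategory (LexCat.{w, v, u} κ) where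
  homCategory C D := homCategory C D
  whiskerLeft F _ _ a := Hom₂.mk (Functor.whiskerLeft F.toFunctor a.toNatTrans)
  whiskerRight a G := Hom₂.mk (Functor.whiskerRight a.toNatTrans G.toFunctor)
  associator F G H := isoMk (Functor.associator F.toFunctor G.toFunctor H.toFunctor)
  leftUnitor F := isoMk F.toFunctor.leftUnitor
  rightUnitor F := isoMk F.toFunctor.rightUnitor
  whiskerLeft_id F G := congrArg Hom₂.mk (Functor.whiskerLeft_id' F.toFunctor)
  whiskerLeft_comp F _ _ _ a b :=
    congrArg Hom₂.mk (Functor.whiskerLeft_comp F.toFunctor a.toNatTrans b.toNatTrans)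
  id_whiskerLeft a := hom₂_ext fun X =>
    (show Hom₂.app a X = 𝟙 _ ≫ Hom₂.app a X ≫ 𝟙 _ by simp)
  comp_whiskerLeft F G _ _ a := hom₂_ext fun X =>
    (show Hom₂.app a (G.toFunctor.obj (F.toFunctor.obj X)) =
      𝟙 _ ≫ Hom₂.app a (G.toFunctor.obj (F.toFunctor.obj X)) ≫ 𝟙 _ by simp)
  id_whiskerRight F G := congrArg Hom₂.mk (Functor.whiskerRight_id' G.toFunctor)
  comp_whiskerRight a b G :=
    congrArg Hom₂.mk (Functor.whiskerRight_comp a.toNatTrans b.toNatTrans G.toFunctor)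
  whiskerRight_id a := hom₂_ext fun X =>
    (show Hom₂.app a X = 𝟙 _ ≫ Hom₂.app a X ≫ 𝟙 _ by simp)
  whiskerRight_comp a G H := hom₂_ext fun X =>
    (show H.toFunctor.map (G.toFunctor.map (Hom₂.app a X)) =
      𝟙 _ ≫ H.toFunctor.map (G.toFunctor.map (Hom₂.app a X)) ≫ 𝟙 _ by simp)
  whisker_assoc F _ _ a H := hom₂_ext fun X =>
    (show H.toFunctor.map (Hom₂.app a (F.toFunctor.obj X)) =
      𝟙 _ ≫ H.toFunctor.map (Hom₂.app a (F.toFunctor.obj X)) ≫ 𝟙 _ by simp)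
  whisker_exchange a b := hom₂_ext fun X =>
    ((Hom₂.toNatTrans b).naturality (Hom₂.app a X)).symm
  pentagon {_ _ _ _ T} F G H I := hom₂_ext fun X =>
    (show I.toFunctor.map (𝟙 _) ≫ 𝟙 _ ≫ 𝟙 _ =
      𝟙 (I.toFunctor.obj (H.toFunctor.obj (G.toFunctor.obj (F.toFunctor.obj X)))) ≫ 𝟙 _ by simp)
  triangle {_ _ T} F G := hom₂_ext fun X =>
    (show 𝟙 _ ≫ 𝟙 _ = G.toFunctor.map (𝟙 (F.toFunctor.obj X)) by simp)

section

variable {C D E E' : LexCat.{w, v, u} κ}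

lemma id_toFunctor : Hom.toFunctor (𝟙 C) = 𝟭 C := rfl
lemma comp_toFunctor (F : C ⟶ D) (G : D ⟶ E) :
    Hom.toFunctor (F ≫ G) = F.toFunctor ⋙ G.toFunctor := rfl
@[simp] lemma id_obj (X : C) : (Hom.toFunctor (𝟙 C)).obj X = X := rfl
@[simp] lemma id_map {X Y : C} (f : X ⟶ Y) : (Hom.toFunctor (𝟙 C)).map f = f := rfl
@[simp] lemma comp_obj (F : C ⟶ D) (G : D ⟶ E) (X : C) :
    (Hom.toFunctor (F ≫ G)).obj X = G.toFunctor.obj (F.toFunctor.obj X) := rfl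
@[simp] lemma comp_map (F : C ⟶ D) (G : D ⟶ E) {X Y : C} (f : X ⟶ Y) :
    (Hom.toFunctor (F ≫ G)).map f = G.toFunctor.map (F.toFunctor.map f) := rfl
@[simp] lemma id_app (F : C ⟶ D) (X : C) : Hom₂.app (𝟙 F) X = 𝟙 _ := rfl
@[simp] lemma comp_app {F G H : C ⟶ D} (a : F ⟶ G) (b : G ⟶ H) (X : C) :
    Hom₂.app (a ≫ b) X = Hom₂.app a X ≫ Hom₂.app b X := rfl
@[simp] lemma whiskerLeft_app (F : C ⟶ D) {G H : D ⟶ E} (a : G ⟶ H) (X : C) :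
    Hom₂.app (F ◁ a) X = Hom₂.app a (F.toFunctor.obj X) := rfl
@[simp] lemma whiskerRight_app {F G : C ⟶ D} (a : F ⟶ G) (H : D ⟶ E) (X : C) :
    Hom₂.app (a ▷ H) X = H.toFunctor.map (Hom₂.app a X) := rfl
@[simp] lemma associator_hom_app (F : C ⟶ D) (G : D ⟶ E) (H : E ⟶ E') (X : C) :
    Hom₂.app (α_ F G H).hom X = 𝟙 _ := rfl
@[simp] lemma associator_inv_app (F : C ⟶ D) (G : D ⟶ E) (H : E ⟶ E') (X : C) :
    Hom₂.app (α_ F G H).inv X = 𝟙 _ := rfl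
@[simp] lemma leftUnitor_hom_app (F : C ⟶ D) (X : C) : Hom₂.app (λ_ F).hom X = 𝟙 _ := rfl
@[simp] lemma leftUnitor_inv_app (F : C ⟶ D) (X : C) : Hom₂.app (λ_ F).inv X = 𝟙 _ := rfl
@[simp] lemma rightUnitor_hom_app (F : C ⟶ D) (X : C) : Hom₂.app (ρ_ F).hom X = 𝟙 _ := rfl
@[simp] lemma rightUnitor_inv_app (F : C ⟶ D) (X : C) : Hom₂.app (ρ_ F).inv X = 𝟙 _ := rfl

lemma app_naturality {F G : C ⟶ D} (a : F ⟶ G) {X Y : C} (f : X ⟶ Y) :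
    F.toFunctor.map f ≫ Hom₂.app a Y = Hom₂.app a X ≫ G.toFunctor.map f :=
  (Hom₂.toNatTrans a).naturality f

lemma hom_inv_app {F G : C ⟶ D} (e : F ≅ G) (X : C) :
    Hom₂.app e.hom X ≫ Hom₂.app e.inv X = 𝟙 _ :=
  congrArg (fun a => Hom₂.app a X) e.hom_inv_id

lemma inv_hom_app {F G : C ⟶ D} (e : F ≅ G) (X : C) :
    Hom₂.app e.inv X ≫ Hom₂.app e.hom X = 𝟙 _ :=
  congrArg (fun a => Hom₂.app a X) e.inv_hom_id

end

end LexCat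

section

variable {L : Type u₁} [Bicategory.{w₁, v₁} L] {κ : Cardinal.{w}} (C : L ⥤ᵖ LexCat.{w, v, u} κ)

/-- The functor `C_f` underlying `C.map f`. -/
abbrev lexMap {p q : L} (f : p ⟶ q) : C.obj p ⥤ C.obj q := (C.map f).toFunctor

/-- The objects of the co-dextrification `Ĉ_r` of `C` at `r`: families of objects `Γ^μ` of `C_p`
for `μ : p ⟶ r`, with morphisms `Γ^α : Γ^ν ⟶ C_f (Γ^μ)` for all `α : μ ⟶ f ≫ ν`, functorially. -/
@[ext]
structure CodexObj (r : L) where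
  /-- The object `Γ^μ`. -/
  obj {p : L} (μ : p ⟶ r) : C.obj p
  /-- The morphism `Γ^α`. -/
  map {p q : L} {μ : p ⟶ r} {ν : q ⟶ r} (f : p ⟶ q) (α : μ ⟶ f ≫ ν) :
    obj ν ⟶ (lexMap C f).obj (obj μ)
  map_id {p : L} (μ : p ⟶ r) : map (𝟙 p) (λ_ μ).inv = LexCat.Hom₂.app (C.mapId p).inv (obj μ)
  map_comp {p q s : L} {μ : p ⟶ r} {ν : q ⟶ r} {ξ : s ⟶ r} (f : p ⟶ q) (g : q ⟶ s)
    (α : μ ⟶ f ≫ ν) (β : ν ⟶ g ≫ ξ) :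
    map (f ≫ g) (α ≫ f ◁ β ≫ (α_ f g ξ).inv) = map g β ≫ (lexMap C g).map (map f α) ≫
      LexCat.Hom₂.app (C.mapComp f g).inv (obj μ)
  map_whisker {p q : L} {μ : p ⟶ r} {ν : q ⟶ r} {f f' : p ⟶ q} (α : μ ⟶ f ≫ ν) (γ : f ⟶ f') :
    map f' (α ≫ γ ▷ ν) = map f α ≫ LexCat.Hom₂.app (C.map₂ γ) (obj μ)

variable {C}

/-- The morphisms of the co-dextrification `Ĉ_r`. -/
@[ext]
structure CodexHom {r : L} (Γ Θ : CodexObj C r) where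
  /-- The component `Γ^μ ⟶ Θ^μ`. -/
  app {p : L} (μ : p ⟶ r) : Γ.obj μ ⟶ Θ.obj μ
  naturality {p q : L} {μ : p ⟶ r} {ν : q ⟶ r} (f : p ⟶ q) (α : μ ⟶ f ≫ ν) :
    Γ.map f α ≫ (lexMap C f).map (app μ) = app ν ≫ Θ.map f α

namespace CodexObj

variable {r : L}

instance : Category (CodexObj C r) where
  Hom Γ Θ := CodexHom Γ Θ
  id Γ := { app := fun μ => 𝟙 _, naturality := fun f α => by simp }
  comp a b :=
    { app := fun μ => a.app μ ≫ b.app μ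
      naturality := fun f α => by
        rw [Functor.map_comp, ← Category.assoc, a.naturality, Category.assoc, b.naturality,
          Category.assoc] }
  id_comp _ := CodexHom.ext (funext fun _ => funext fun _ => Category.id_comp _)
  comp_id _ := CodexHom.ext (funext fun _ => funext fun _ => Category.comp_id _)
  assoc _ _ _ := CodexHom.ext (funext fun _ => funext fun _ => Category.assoc _ _ _)

/-- The component `Γ^μ ⟶ Θ^μ` of a morphism of `Ĉ_r`. -/
abbrev homApp {Γ Θ : CodexObj C r} (a : Γ ⟶ Θ) {p : L} (μ : p ⟶ r) : Γ.obj μ ⟶ Θ.obj μ :=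
  CodexHom.app a μ

lemma hom_naturality {Γ Θ : CodexObj C r} (a : Γ ⟶ Θ) {p q : L} {μ : p ⟶ r} {ν : q ⟶ r}
    (f : p ⟶ q) (α : μ ⟶ f ≫ ν) :
    Γ.map f α ≫ (lexMap C f).map (homApp a μ) = homApp a ν ≫ Θ.map f α :=
  CodexHom.naturality a f α

@[ext]
lemma hom_ext {Γ Θ : CodexObj C r} {a b : Γ ⟶ Θ}
    (h : ∀ {p : L} (μ : p ⟶ r), homApp a μ = homApp b μ) : a = b :=
  CodexHom.ext (funext fun _ => funext fun μ => h μ)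

@[simp] lemma id_homApp (Γ : CodexObj C r) {p : L} (μ : p ⟶ r) : homApp (𝟙 Γ) μ = 𝟙 _ := rfl
@[simp] lemma comp_homApp {Γ Θ Ξ : CodexObj C r} (a : Γ ⟶ Θ) (b : Θ ⟶ Ξ) {p : L} (μ : p ⟶ r) :
    homApp (a ≫ b) μ = homApp a μ ≫ homApp b μ := rfl

/-- The contravariant action `Γ^ν ⟶ Γ^μ` of a 2-cell `γ : μ ⟶ ν`. -/
def res (Γ : CodexObj C r) {p : L} {μ ν : p ⟶ r} (γ : μ ⟶ ν) : Γ.obj ν ⟶ Γ.obj μ :=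
  Γ.map (𝟙 p) (γ ≫ (λ_ ν).inv) ≫ LexCat.Hom₂.app (C.mapId p).hom (Γ.obj μ)

@[simp] lemma res_id (Γ : CodexObj C r) {p : L} (μ : p ⟶ r) : Γ.res (𝟙 μ) = 𝟙 _ := by
  have h := LexCat.inv_hom_app (C.mapId p) (Γ.obj μ)
  rw [res, Category.id_comp, map_id]
  exact h

lemma map_res (Γ : CodexObj C r) {p q : L} {μ μ' : p ⟶ r} {ν : q ⟶ r} (f : p ⟶ q)
    (γ : μ' ⟶ μ) (α : μ ⟶ f ≫ ν) :
    Γ.map f (γ ≫ α) = Γ.map f α ≫ (lexMap C f).map (Γ.res γ) := by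
  have h1 := Γ.map_comp (𝟙 p) f (γ ≫ (λ_ μ).inv) α
  have h2 := Γ.map_whisker ((γ ≫ (λ_ μ).inv) ≫ 𝟙 p ◁ α ≫ (α_ (𝟙 p) f ν).inv) (λ_ f).hom
  have h3 : ((γ ≫ (λ_ μ).inv) ≫ 𝟙 p ◁ α ≫ (α_ (𝟙 p) f ν).inv) ≫ (λ_ f).hom ▷ ν = γ ≫ α := by
    simp
  have h4 := congrArg (fun a => LexCat.Hom₂.app a (Γ.obj μ')) (C.map₂_left_unitor f)
  rw [h3, h1] at h2
  rw [h2, res]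
  have h5 : LexCat.Hom₂.app (C.map₂ (λ_ f).hom) (Γ.obj μ') =
    LexCat.Hom₂.app (C.mapComp (𝟙 p) f).hom (Γ.obj μ') ≫
      (lexMap C f).map (LexCat.Hom₂.app (C.mapId p).hom (Γ.obj μ')) ≫ 𝟙 _ := h4
  have h6 := LexCat.inv_hom_app (C.mapComp (𝟙 p) f) (Γ.obj μ')
  rw [h5, Functor.map_comp]
  simp only [Category.assoc, Category.comp_id]
  have h7 := congrArg (· ≫ (lexMap C f).map (LexCat.Hom₂.app (C.mapId p).hom (Γ.obj μ'))) h6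
  simp only [Category.assoc] at h7
  refine congrArg (Γ.map f α ≫ ·) (congrArg ((lexMap C f).map _ ≫ ·) ?_)
  exact h7.trans (Category.id_comp _)

lemma map_whiskerLeft (Γ : CodexObj C r) {p q : L} {μ : p ⟶ r} {ν ν' : q ⟶ r} (f : p ⟶ q)
    (α : μ ⟶ f ≫ ν) (δ : ν ⟶ ν') :
    Γ.map f (α ≫ f ◁ δ) = Γ.res δ ≫ Γ.map f α := by
  have h1 := Γ.map_comp f (𝟙 q) α (δ ≫ (λ_ ν').inv)
  have h2 := Γ.map_whisker (α ≫ f ◁ (δ ≫ (λ_ ν').inv) ≫ (α_ f (𝟙 q) ν').inv) (ρ_ f).hom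
  have h3 : (α ≫ f ◁ (δ ≫ (λ_ ν').inv) ≫ (α_ f (𝟙 q) ν').inv) ≫ (ρ_ f).hom ▷ ν' =
      α ≫ f ◁ δ := by
    simp
  have h5 : LexCat.Hom₂.app (C.map₂ (ρ_ f).hom) (Γ.obj μ) =
      LexCat.Hom₂.app (C.mapComp f (𝟙 q)).hom (Γ.obj μ) ≫
        LexCat.Hom₂.app (C.mapId q).hom ((lexMap C f).obj (Γ.obj μ)) ≫ 𝟙 _ :=
    congrArg (fun a => LexCat.Hom₂.app a (Γ.obj μ)) (C.map₂_right_unitor f)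
  have h6 := LexCat.inv_hom_app (C.mapComp f (𝟙 q)) (Γ.obj μ)
  have h8 : (lexMap C (𝟙 q)).map (Γ.map f α) ≫
      LexCat.Hom₂.app (C.mapId q).hom ((lexMap C f).obj (Γ.obj μ)) =
        LexCat.Hom₂.app (C.mapId q).hom (Γ.obj ν) ≫ Γ.map f α :=
    LexCat.app_naturality (C.mapId q).hom (Γ.map f α)
  have h7 := congrArg
    (· ≫ LexCat.Hom₂.app (C.mapId q).hom ((lexMap C f).obj (Γ.obj μ))) h6
  simp only [Category.assoc] at h7
  rw [h3, h1] at h2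
  rw [h2, res, h5]
  simp only [Category.assoc, Category.comp_id]
  rw [← h8]
  refine congrArg (Γ.map (𝟙 q) _ ≫ ·) (congrArg ((lexMap C (𝟙 q)).map _ ≫ ·) ?_)
  exact h7.trans (Category.id_comp _)

lemma res_comp (Γ : CodexObj C r) {p : L} {μ ν ξ : p ⟶ r} (γ : μ ⟶ ν) (δ : ν ⟶ ξ) :
    Γ.res (γ ≫ δ) = Γ.res δ ≫ Γ.res γ := by
  have h8 : (lexMap C (𝟙 p)).map (Γ.res γ) ≫ LexCat.Hom₂.app (C.mapId p).hom (Γ.obj μ) =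
        LexCat.Hom₂.app (C.mapId p).hom (Γ.obj ν) ≫ Γ.res γ :=
    LexCat.app_naturality (C.mapId p).hom (Γ.res γ)
  have h : Γ.res (γ ≫ δ) =
      Γ.map (𝟙 p) (γ ≫ δ ≫ (λ_ ξ).inv) ≫ LexCat.Hom₂.app (C.mapId p).hom (Γ.obj μ) := by
    rw [res, Category.assoc]
  rw [h, map_res, Category.assoc, h8, ← Category.assoc]
  rfl

lemma res_naturality {Γ Θ : CodexObj C r} (a : Γ ⟶ Θ) {p : L} {μ ν : p ⟶ r} (γ : μ ⟶ ν) :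
    Γ.res γ ≫ homApp a μ = homApp a ν ≫ Θ.res γ := by
  have h : (lexMap C (𝟙 p)).map (homApp a μ) ≫ LexCat.Hom₂.app (C.mapId p).hom (Θ.obj μ) =
        LexCat.Hom₂.app (C.mapId p).hom (Γ.obj μ) ≫ homApp a μ :=
    LexCat.app_naturality (C.mapId p).hom (homApp a μ)
  rw [res, res, Category.assoc, ← h, ← Category.assoc, hom_naturality, Category.assoc]

/-- Evaluation `Γ ↦ Γ^μ`. -/
def eval {p : L} (μ : p ⟶ r) : CodexObj C r ⥤ C.obj p where
  obj Γ := Γ.obj μ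
  map a := homApp a μ

end CodexObj

end

namespace CodexObj

section

variable {L : Type u₁} [Bicategory.{w₁, v₁} L] {κ : Cardinal.{w}} {C : L ⥤ᵖ LexCat.{w, v, u} κ}
  {r : L}

/-- The morphisms `Γ^α`, naturally in `Γ`. -/
def evalMap {p q : L} {μ : p ⟶ r} {ν : q ⟶ r} (f : p ⟶ q) (α : μ ⟶ f ≫ ν) :
    (eval ν : CodexObj C r ⥤ C.obj q) ⟶ eval μ ⋙ lexMap C f where
  app Γ := Γ.map f α
  naturality _ _ a := (hom_naturality a f α).symm

variable {J : Type w} [SmallCategory J]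

/-- The components of the factorization of a cone through a cone with limiting evaluations. -/
def evalLift {F : J ⥤ CodexObj C r} (c : Cone F)
    (h : ∀ {p : L} (μ : p ⟶ r), IsLimit ((eval μ).mapCone c)) (s : Cone F) {p : L} (μ : p ⟶ r) :
    s.pt.obj μ ⟶ c.pt.obj μ :=
  (h μ).lift ((eval μ).mapCone s)

/-- The components of the legs of a cone. -/
def coneApp {F : J ⥤ CodexObj C r} (c : Cone F) (j : J) : c.pt ⟶ F.obj j := c.π.app j

lemma evalLift_coneApp {F : J ⥤ CodexObj C r} (c : Cone F)
    (h : ∀ {p : L} (μ : p ⟶ r), IsLimit ((eval μ).mapCone c)) (s : Cone F) (j : J) {p : L}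
    (μ : p ⟶ r) : evalLift c h s μ ≫ homApp (coneApp c j) μ = homApp (coneApp s j) μ :=
  (h μ).fac ((eval μ).mapCone s) j

/-- A cone in `Ĉ_r` is a limit cone if all its evaluations are limit cones. -/
def isLimitOfEval [∀ {p q : L} (f : p ⟶ q), PreservesLimitsOfShape J (lexMap C f)]
    {F : J ⥤ CodexObj C r} (c : Cone F)
    (h : ∀ {p : L} (μ : p ⟶ r), IsLimit ((eval μ).mapCone c)) : IsLimit c where
  lift s :=
    { app := fun μ => evalLift c h s μ
      naturality := fun {p q μ ν} f α => by
        apply (isLimitOfPreserves (lexMap C f) (h μ)).hom_ext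
        intro j
        have : (s.pt.map f α ≫ (lexMap C f).map (evalLift c h s μ)) ≫
            (lexMap C f).map (homApp (coneApp c j) μ) =
              (evalLift c h s ν ≫ c.pt.map f α) ≫ (lexMap C f).map (homApp (coneApp c j) μ) := by
          rw [Category.assoc, ← Functor.map_comp, evalLift_coneApp, hom_naturality,
            Category.assoc, hom_naturality, ← Category.assoc, evalLift_coneApp]
        exact this }
  fac s j := hom_ext fun μ => (h μ).fac ((eval μ).mapCone s) j
  uniq s m hm := hom_ext fun μ =>
    (h μ).uniq ((eval μ).mapCone s) (homApp m μ) fun j => congrArg (fun a => homApp a μ) (hm j)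

variable [∀ p : L, HasLimitsOfShape J (C.obj p)]
  [∀ {p q : L} (f : p ⟶ q), PreservesLimitsOfShape J (lexMap C f)]

/-- The limit of the evaluations of a diagram in `Ĉ_r`. -/
noncomputable def limitAt (F : J ⥤ CodexObj C r) {p : L} (μ : p ⟶ r) : C.obj p :=
  limit (F ⋙ eval μ)

/-- The projections of the limit of the evaluations. -/
noncomputable def limitπ (F : J ⥤ CodexObj C r) {p : L} (μ : p ⟶ r) (j : J) :
    limitAt F μ ⟶ (F.obj j).obj μ :=
  limit.π (F ⋙ eval μ) j

/-- The structure morphisms of a pointwise limit. -/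
noncomputable def limitMap (F : J ⥤ CodexObj C r) {p q : L} {μ : p ⟶ r} {ν : q ⟶ r} (f : p ⟶ q)
    (α : μ ⟶ f ≫ ν) : limitAt F ν ⟶ (lexMap C f).obj (limitAt F μ) :=
  (isLimitOfPreserves (lexMap C f) (limit.isLimit (F ⋙ eval μ))).lift
    ((Cone.postcompose (Functor.whiskerLeft F (evalMap f α))).obj (limit.cone (F ⋙ eval ν)))

lemma limitMap_π (F : J ⥤ CodexObj C r) {p q : L} {μ : p ⟶ r} {ν : q ⟶ r} (f : p ⟶ q)
    (α : μ ⟶ f ≫ ν) (j : J) :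
    limitMap F f α ≫ (lexMap C f).map (limitπ F μ j) = limitπ F ν j ≫ (F.obj j).map f α :=
  (isLimitOfPreserves (lexMap C f) (limit.isLimit (F ⋙ eval μ))).fac _ j

lemma limit_hom_ext (F : J ⥤ CodexObj C r) {p q : L} {μ : p ⟶ r} (f : p ⟶ q) {X : C.obj q}
    {a b : X ⟶ (lexMap C f).obj (limitAt F μ)}
    (h : ∀ j, a ≫ (lexMap C f).map (limitπ F μ j) = b ≫ (lexMap C f).map (limitπ F μ j)) :
    a = b :=
  (isLimitOfPreserves (lexMap C f) (limit.isLimit (F ⋙ eval μ))).hom_ext h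

/-- The pointwise limit of a diagram in `Ĉ_r`. -/
noncomputable def limitObj (F : J ⥤ CodexObj C r) : CodexObj C r where
  obj μ := limitAt F μ
  map f α := limitMap F f α
  map_id {p} μ := limit_hom_ext F _ fun j => by
    rw [limitMap_π, map_id]
    exact LexCat.app_naturality (C.mapId p).inv (limitπ F μ j)
  map_comp {p q s μ ν ξ} f g α β := limit_hom_ext F _ fun j => by
    have h : (lexMap C g).map ((lexMap C f).map (limitπ F μ j)) ≫
        LexCat.Hom₂.app (C.mapComp f g).inv ((F.obj j).obj μ) =
          LexCat.Hom₂.app (C.mapComp f g).inv (limitAt F μ) ≫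
            (lexMap C (f ≫ g)).map (limitπ F μ j) :=
      LexCat.app_naturality (C.mapComp f g).inv (limitπ F μ j)
    have h1 : limitπ F ξ j ≫ (F.obj j).map g β ≫ (lexMap C g).map ((F.obj j).map f α) =
        limitMap F g β ≫ (lexMap C g).map (limitMap F f α) ≫
          (lexMap C g).map ((lexMap C f).map (limitπ F μ j)) := by
      rw [← Functor.map_comp, limitMap_π, Functor.map_comp, ← Category.assoc, ← limitMap_π,
        Category.assoc]
    have h2 := congrArg (· ≫ LexCat.Hom₂.app (C.mapComp f g).inv ((F.obj j).obj μ)) h1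
    simp only [Category.assoc] at h2
    rw [limitMap_π, map_comp]
    refine h2.trans ?_
    simp only [Category.assoc]
    exact congrArg (limitMap F g β ≫ ·) (congrArg ((lexMap C g).map (limitMap F f α) ≫ ·) h)
  map_whisker {p q μ ν f f'} α γ := limit_hom_ext F _ fun j => by
    have h : (lexMap C f).map (limitπ F μ j) ≫
        LexCat.Hom₂.app (C.map₂ γ) ((F.obj j).obj μ) =
          LexCat.Hom₂.app (C.map₂ γ) (limitAt F μ) ≫ (lexMap C f').map (limitπ F μ j) :=
      LexCat.app_naturality (C.map₂ γ) (limitπ F μ j)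
    have h2 := congrArg (· ≫ LexCat.Hom₂.app (C.map₂ γ) ((F.obj j).obj μ)) (limitMap_π F f α j)
    simp only [Category.assoc] at h2
    rw [limitMap_π, map_whisker, Category.assoc]
    exact h2.symm.trans (congrArg (limitMap F f α ≫ ·) h)

/-- The pointwise limit cone of a diagram in `Ĉ_r`. -/
noncomputable def limitCone (F : J ⥤ CodexObj C r) : Cone F where
  pt := limitObj F
  π :=
    { app := fun j =>
        { app := fun μ => limitπ F μ j
          naturality := fun f α => limitMap_π F f α j }
      naturality := fun _ _ k => hom_ext fun μ => (limit.cone (F ⋙ eval μ)).π.naturality k }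

/-- The pointwise limit cone is a limit cone. -/
noncomputable def limitConeIsLimit (F : J ⥤ CodexObj C r) : IsLimit (limitCone F) :=
  isLimitOfEval _ fun μ => limit.isLimit (F ⋙ eval μ)

instance : HasLimitsOfShape J (CodexObj C r) where
  has_limit F := ⟨⟨⟨limitCone F, limitConeIsLimit F⟩⟩⟩

instance {p : L} (μ : p ⟶ r) : PreservesLimitsOfShape J (eval μ : CodexObj C r ⥤ C.obj p) where
  preservesLimit {F} :=
    preservesLimit_of_preserves_limit_cone (limitConeIsLimit F) (limit.isLimit (F ⋙ eval μ))

end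

section

variable {L : Type u₁} [Bicategory.{w₁, v₁} L] {κ : Cardinal.{w}} (C : L ⥤ᵖ LexCat.{w, v, u} κ)
  {r s t : L}

lemma hasCardinalLimits (r : L) : HasCardinalLimits κ (CodexObj C r) := fun J _ hJ => by
  have := fun p => (C.obj p).hasLimits J hJ
  have : ∀ {p q : L} (f : p ⟶ q), PreservesLimitsOfShape J (lexMap C f) :=
    fun f => (C.map f).preservesLimits J hJ
  infer_instance

lemma eval_preserves {p : L} (μ : p ⟶ r) :
    PreservesCardinalLimits κ (eval μ : CodexObj C r ⥤ C.obj p) := fun J _ hJ => by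
  have := fun p => (C.obj p).hasLimits J hJ
  have : ∀ {p q : L} (f : p ⟶ q), PreservesLimitsOfShape J (lexMap C f) :=
    fun f => (C.map f).preservesLimits J hJ
  infer_instance

/-- The functor `Ĉ^ϖ : Ĉ_s ⥤ Ĉ_r` of precomposition, `(Ĉ^ϖ Γ)^μ = Γ^{μ ≫ ϖ}`. -/
def restrict (ϖ : r ⟶ s) : CodexObj C s ⥤ CodexObj C r where
  obj Γ :=
    { obj := fun μ => Γ.obj (μ ≫ ϖ)
      map := fun {p q μ ν} f α => Γ.map f (α ▷ ϖ ≫ (α_ f ν ϖ).hom)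
      map_id := fun {p} μ => by
        rw [← Γ.map_id]
        congr 1
        simp
      map_comp := fun {p q s μ ν ξ} f g α β => by
        rw [← Γ.map_comp]
        congr 1
        simp
      map_whisker := fun {p q μ ν f f'} α γ => by
        rw [← Γ.map_whisker]
        congr 1
        simp }
  map a :=
    { app := fun μ => homApp a (μ ≫ ϖ)
      naturality := fun f α => hom_naturality a f _ }

@[simp] lemma restrict_obj_obj (ϖ : r ⟶ s) (Γ : CodexObj C s) {p : L} (μ : p ⟶ r) :
    ((restrict C ϖ).obj Γ).obj μ = Γ.obj (μ ≫ ϖ) := rfl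

@[simp] lemma restrict_obj_map (ϖ : r ⟶ s) (Γ : CodexObj C s) {p q : L} {μ : p ⟶ r} {ν : q ⟶ r}
    (f : p ⟶ q) (α : μ ⟶ f ≫ ν) :
    ((restrict C ϖ).obj Γ).map f α = Γ.map f (α ▷ ϖ ≫ (α_ f ν ϖ).hom) := rfl

@[simp] lemma restrict_map_homApp (ϖ : r ⟶ s) {Γ Θ : CodexObj C s} (a : Γ ⟶ Θ) {p : L}
    (μ : p ⟶ r) : homApp ((restrict C ϖ).map a) μ = homApp a (μ ≫ ϖ) := rfl

lemma restrict_obj_res (ϖ : r ⟶ s) (Γ : CodexObj C s) {p : L} {μ ν : p ⟶ r} (γ : μ ⟶ ν) :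
    ((restrict C ϖ).obj Γ).res γ = Γ.res (γ ▷ ϖ) := by
  have h : (γ ≫ (λ_ ν).inv) ▷ ϖ ≫ (α_ (𝟙 p) ν ϖ).hom = γ ▷ ϖ ≫ (λ_ (ν ≫ ϖ)).inv := by simp
  have h' : ((restrict C ϖ).obj Γ).res γ =
    Γ.map (𝟙 p) ((γ ≫ (λ_ ν).inv) ▷ ϖ ≫ (α_ (𝟙 p) ν ϖ).hom) ≫
      LexCat.Hom₂.app (C.mapId p).hom (Γ.obj (μ ≫ ϖ)) := rfl
  rw [h', h, res]

lemma restrict_preserves (ϖ : r ⟶ s) : PreservesCardinalLimits κ (restrict C ϖ) :=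
  fun J _ hJ => by
    have := fun p => (C.obj p).hasLimits J hJ
    have : ∀ {p q : L} (f : p ⟶ q), PreservesLimitsOfShape J (lexMap C f) :=
      fun f => (C.map f).preservesLimits J hJ
    exact ⟨fun {F} => ⟨fun {c} hc =>
      ⟨isLimitOfEval _ fun μ => isLimitOfPreserves (eval (μ ≫ ϖ)) hc⟩⟩⟩

/-- The morphism `Γ^ν ⟶ Γ^μ` restricted along a family of 2-cells `μ ⟶ ν`, natural in `Γ`. -/
def restrictTrans {ϖ ϖ' : r ⟶ s} (β : ϖ ⟶ ϖ') : restrict C ϖ' ⟶ restrict C ϖ where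
  app Γ :=
    { app := fun μ => Γ.res (μ ◁ β)
      naturality := fun {p q μ ν} f α => by
        change Γ.map f _ ≫ (lexMap C f).map (Γ.res (μ ◁ β)) = Γ.res (ν ◁ β) ≫ Γ.map f _
        rw [← map_res, ← map_whiskerLeft, whisker_exchange_assoc]
        congr 1
        simp }
  naturality Γ Θ a := hom_ext fun μ => (res_naturality a (μ ◁ β)).symm

/-- The isomorphism `Ĉ^{1_r} ≅ 1`. -/
def restrictId (r : L) : restrict C (𝟙 r) ≅ 𝟭 (CodexObj C r) where
  hom :=
    { app := fun Γ =>
        { app := fun μ => Γ.res (ρ_ μ).inv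
          naturality := fun {p q μ ν} f α => by
            change Γ.map f _ ≫ (lexMap C f).map (Γ.res _) = Γ.res _ ≫ Γ.map f α
            rw [← map_res, ← map_whiskerLeft]
            congr 1
            simp }
      naturality := fun Γ Θ a => hom_ext fun μ => (res_naturality a _).symm }
  inv :=
    { app := fun Γ =>
        { app := fun μ => Γ.res (ρ_ μ).hom
          naturality := fun {p q μ ν} f α => by
            change Γ.map f α ≫ (lexMap C f).map (Γ.res _) = Γ.res _ ≫ Γ.map f _
            rw [← map_res, ← map_whiskerLeft]
            congr 1
            simp }
      naturality := fun Γ Θ a => hom_ext fun μ => (res_naturality a _).symm }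
  hom_inv_id := by
    ext Γ p μ
    change Γ.res _ ≫ Γ.res _ = 𝟙 _
    rw [← res_comp, Iso.hom_inv_id, res_id]
  inv_hom_id := by
    ext Γ p μ
    change Γ.res _ ≫ Γ.res _ = 𝟙 _
    rw [← res_comp, Iso.inv_hom_id, res_id]

/-- The isomorphism `Ĉ^{ϖ ≫ ϖ'} ≅ Ĉ^{ϖ'} ⋙ Ĉ^ϖ`. -/
def restrictComp (ϖ : r ⟶ s) (ϖ' : s ⟶ t) :
    restrict C (ϖ ≫ ϖ') ≅ restrict C ϖ' ⋙ restrict C ϖ where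
  hom :=
    { app := fun Γ =>
        { app := fun μ => Γ.res (α_ μ ϖ ϖ').hom
          naturality := fun {p q μ ν} f α => by
            change Γ.map f _ ≫ (lexMap C f).map (Γ.res _) = Γ.res _ ≫ Γ.map f _
            rw [← map_res, ← map_whiskerLeft]
            congr 1
            simp }
      naturality := fun Γ Θ a => hom_ext fun μ => (res_naturality a _).symm }
  inv :=
    { app := fun Γ =>
        { app := fun μ => Γ.res (α_ μ ϖ ϖ').inv
          naturality := fun {p q μ ν} f α => by
            change Γ.map f _ ≫ (lexMap C f).map (Γ.res _) = Γ.res _ ≫ Γ.map f _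
            rw [← map_res, ← map_whiskerLeft]
            congr 1
            simp }
      naturality := fun Γ Θ a => hom_ext fun μ => (res_naturality a _).symm }
  hom_inv_id := by
    ext Γ p μ
    change Γ.res _ ≫ Γ.res _ = 𝟙 _
    rw [← res_comp, Iso.inv_hom_id, res_id]
  inv_hom_id := by
    ext Γ p μ
    change Γ.res _ ≫ Γ.res _ = 𝟙 _
    rw [← res_comp, Iso.hom_inv_id, res_id]

end

end CodexObj

section

variable {L : Type w} [Bicategory.{w, w} L] {κ : Cardinal.{w}}
  (C : L ⥤ᵖ LexCat.{w, max v w, max u v w} κ)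

/-- The category `Ĉ_r`, as an object of `Lex_κ`. -/
def codexCat (r : L) : LexCat.{w, max v w, max u v w} κ where
  carrier := CodexObj C r
  hasLimits := CodexObj.hasCardinalLimits C r

/-- The functor `Ĉ^ϖ`, as a 1-cell of `Lex_κ`. -/
def codexRestrict {r s : L} (ϖ : r ⟶ s) : codexCat.{w, v, u} C s ⟶ codexCat.{w, v, u} C r :=
  LexCat.Hom.mk (CodexObj.restrict C ϖ) (CodexObj.restrict_preserves C ϖ)

/-- Evaluation `Γ ↦ Γ^μ`, as a 1-cell of `Lex_κ`. -/
def codexEval {p r : L} (μ : p ⟶ r) : codexCat.{w, v, u} C r ⟶ C.obj p :=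
  LexCat.Hom.mk (CodexObj.eval μ) (CodexObj.eval_preserves C μ)

variable {C} in
/-- Two parallel 2-cells of `Lex_κ` into `Ĉ_r` agree if they agree componentwise. -/
lemma codex_hom₂_ext {A : LexCat.{w, max v w, max u v w} κ} {r : L} {F G : A ⟶ codexCat.{w, v, u} C r}
    {a b : F ⟶ G}
    (h : ∀ (X : A) {p : L} (μ : p ⟶ r), CodexObj.homApp (C := C) (LexCat.Hom₂.app a X) μ =
      CodexObj.homApp (C := C) (LexCat.Hom₂.app b X) μ) : a = b :=
  LexCat.hom₂_ext fun X => CodexObj.hom_ext fun μ => h X μ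

/-- The co-dextrification `Ĉ : Lᶜᵒᵒᵖ ⥤ᵖ Lex_κ` of a pseudofunctor `C : L ⥤ᵖ Lex_κ`. -/
def codex : Coop L ⥤ᵖ LexCat.{w, max v w, max u v w} κ where
  obj X := codexCat.{w, v, u} C X.of
  map f := codexRestrict.{w, v, u} C f.un
  map₂ a := LexCat.Hom₂.mk (CodexObj.restrictTrans C a.un₂)
  map₂_id f := codex_hom₂_ext.{w, v, u} fun Γ _ μ => by
    have (Γ : CodexObj C _) : CodexObj.res Γ (μ ◁ 𝟙 f.un) = 𝟙 _ := by simp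
    exact this Γ
  map₂_comp a b := codex_hom₂_ext.{w, v, u} fun Γ _ μ => by
    have (Γ : CodexObj C _) : CodexObj.res Γ (μ ◁ (b.un₂ ≫ a.un₂)) =
      CodexObj.res Γ (μ ◁ a.un₂) ≫ CodexObj.res Γ (μ ◁ b.un₂) := by
      rw [← CodexObj.res_comp, Bicategory.whiskerLeft_comp]
    exact this Γ
  mapId X := LexCat.isoMk (CodexObj.restrictId C X.of)
  mapComp f g := LexCat.isoMk (CodexObj.restrictComp C g.un f.un)
  map₂_whisker_left {_ _ _} f g h a := codex_hom₂_ext.{w, v, u} fun Γ _ μ => by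
    have (Γ : CodexObj C _) : Γ.res (μ ◁ a.un₂ ▷ f.un) = Γ.res (α_ μ g.un f.un).hom ≫
        Γ.res ((μ ◁ a.un₂) ▷ f.un) ≫ Γ.res (α_ μ h.un f.un).inv := by
      simp only [← CodexObj.res_comp]
      congr 1
      simp
    exact (this Γ).trans (congrArg (_ ≫ ·) (congrArg (· ≫ _)
      (CodexObj.restrict_obj_res C f.un Γ (μ ◁ a.un₂)).symm))
  map₂_whisker_right {_ _ _ f g} a h := codex_hom₂_ext.{w, v, u} fun Γ _ μ => by
    have (Γ : CodexObj C _) : CodexObj.res Γ (μ ◁ h.un ◁ a.un₂) = CodexObj.res Γ (α_ μ h.un f.un).hom ≫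
        CodexObj.res Γ ((μ ≫ h.un) ◁ a.un₂) ≫ CodexObj.res Γ (α_ μ h.un g.un).inv := by
      simp only [← CodexObj.res_comp]
      congr 1
      simp
    exact this Γ
  map₂_associator f g h := codex_hom₂_ext.{w, v, u} fun Γ _ μ => by
    have (Γ : CodexObj C _) : Γ.res (μ ◁ (α_ h.un g.un f.un).hom) =
        Γ.res (α_ μ h.un (g.un ≫ f.un)).hom ≫ Γ.res (α_ (μ ≫ h.un) g.un f.un).hom ≫ 𝟙 _ ≫
          Γ.res ((α_ μ h.un g.un).inv ▷ f.un) ≫ Γ.res (α_ μ (h.un ≫ g.un) f.un).inv := by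
      rw [Category.id_comp]
      simp only [← CodexObj.res_comp]
      congr 1
      simp
    exact (this Γ).trans (congrArg (_ ≫ ·) (congrArg (_ ≫ ·) (congrArg (_ ≫ ·) (congrArg (· ≫ _)
      (CodexObj.restrict_obj_res C f.un Γ (α_ μ h.un g.un).inv).symm))))
  map₂_left_unitor {_ Y} f := codex_hom₂_ext.{w, v, u} fun Γ _ μ => by
    have (Γ : CodexObj C _) : CodexObj.res Γ (μ ◁ (ρ_ f.un).inv) = CodexObj.res Γ (α_ μ f.un (𝟙 _)).hom ≫
        CodexObj.res Γ (ρ_ (μ ≫ f.un)).inv ≫ 𝟙 _ := by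
      rw [Category.comp_id]
      simp only [← CodexObj.res_comp]
      congr 1
      simp
    exact this Γ
  map₂_right_unitor f := codex_hom₂_ext.{w, v, u} fun Γ _ μ => by
    have (Γ : CodexObj C _) : Γ.res (μ ◁ (λ_ f.un).inv) = Γ.res (α_ μ (𝟙 _) f.un).hom ≫
        Γ.res ((ρ_ μ).inv ▷ f.un) ≫ 𝟙 _ := by
      rw [Category.comp_id]
      simp only [← CodexObj.res_comp]
      congr 1
      simp
    exact (this Γ).trans (congrArg (_ ≫ ·) (congrArg (· ≫ _)
      (CodexObj.restrict_obj_res C f.un Γ (ρ_ μ).inv).symm))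

end

section

variable {K : Type u₂} [Bicategory.{w₂, v₂} K]

lemma homEquiv₁_comp {a b c : K} {l : b ⟶ c} {r : c ⟶ b} (adj : Adjunction l r) {g : b ⟶ a}
    {h h' : c ⟶ a} (β : g ⟶ l ≫ h) (m : h ⟶ h') :
    adj.homEquiv₁ (β ≫ l ◁ m) = adj.homEquiv₁ β ≫ m := by
  simp only [Bicategory.Adjunction.homEquiv₁_apply]
  calc
    _ = r ◁ β ⊗≫ ((r ≫ l) ◁ m ≫ adj.counit ▷ h') ⊗≫ 𝟙 _ := by bicategory
    _ = _ := by
      rw [whisker_exchange]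
      bicategory

lemma conjugateEquiv_homEquiv₁ {a b c : K} {l₁ l₂ : b ⟶ c} {r₁ r₂ : c ⟶ b}
    (adj₁ : Adjunction l₁ r₁) (adj₂ : Adjunction l₂ r₂) {g : b ⟶ a} {h : c ⟶ a}
    (m : l₂ ⟶ l₁) (β : g ⟶ l₂ ≫ h) :
    conjugateEquiv adj₁ adj₂ m ▷ g ≫ adj₂.homEquiv₁ β = adj₁.homEquiv₁ (β ≫ m ▷ h) := by
  simp only [Bicategory.Adjunction.homEquiv₁_apply]
  have h1 : conjugateEquiv adj₁ adj₂ m ▷ l₂ ≫ adj₂.counit = r₁ ◁ m ≫ adj₁.counit := by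
    rw [conjugateEquiv_apply']
    calc
      _ = 𝟙 _ ⊗≫ r₁ ◁ adj₂.unit ▷ l₂ ⊗≫ r₁ ◁ m ▷ r₂ ▷ l₂ ⊗≫
          (adj₁.counit ▷ (r₂ ≫ l₂) ≫ 𝟙 c ◁ adj₂.counit) ⊗≫ 𝟙 _ := by bicategory
      _ = 𝟙 _ ⊗≫ r₁ ◁ adj₂.unit ▷ l₂ ⊗≫ r₁ ◁ (m ▷ (r₂ ≫ l₂) ≫ l₁ ◁ adj₂.counit) ⊗≫
          adj₁.counit ⊗≫ 𝟙 _ := by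
        rw [← whisker_exchange]
        bicategory
      _ = 𝟙 _ ⊗≫ r₁ ◁ (leftZigzag adj₂.unit adj₂.counit) ⊗≫ r₁ ◁ m ⊗≫ adj₁.counit ⊗≫ 𝟙 _ := by
        rw [← whisker_exchange, leftZigzag]
        bicategory
      _ = _ := by
        rw [adj₂.left_triangle]
        bicategory
  calc
    _ = (conjugateEquiv adj₁ adj₂ m ▷ g ≫ r₂ ◁ β) ⊗≫ adj₂.counit ▷ h ⊗≫ 𝟙 _ := by bicategory
    _ = r₁ ◁ β ⊗≫ (conjugateEquiv adj₁ adj₂ m ▷ l₂ ≫ adj₂.counit) ▷ h ⊗≫ 𝟙 _ := by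
      rw [← whisker_exchange]
      bicategory
    _ = _ := by
      rw [h1]
      bicategory

lemma homEquiv₁_id {a b : K} {g h : b ⟶ a} (β : g ⟶ 𝟙 b ≫ h) :
    (Bicategory.Adjunction.id b).homEquiv₁ β = (λ_ g).hom ≫ β ≫ (λ_ h).hom := by
  simp only [Bicategory.Adjunction.homEquiv₁_apply]
  dsimp [Bicategory.Adjunction.id]
  calc
    _ = 𝟙 b ◁ β ⊗≫ 𝟙 _ := by bicategory
    _ = _ := by bicategory

lemma homEquiv₁_comp_adj {a b c d e : K} {l₁ : a ⟶ b} {r₁ : b ⟶ a} {l₂ : b ⟶ c} {r₂ : c ⟶ b}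
    (adj₁ : Adjunction l₁ r₁) (adj₂ : Adjunction l₂ r₂) {g : a ⟶ d} {h : b ⟶ e} {k : e ⟶ d}
    {h' : c ⟶ e} (β : g ⟶ l₁ ≫ h ≫ k) (γ : h ⟶ l₂ ≫ h') :
    (adj₁.comp adj₂).homEquiv₁ (β ≫ l₁ ◁ (γ ▷ k ≫ (α_ l₂ h' k).hom) ≫ (α_ l₁ l₂ (h' ≫ k)).inv) =
      (α_ r₂ r₁ g).hom ≫ r₂ ◁ adj₁.homEquiv₁ β ≫ (α_ r₂ h k).inv ≫ adj₂.homEquiv₁ γ ▷ k := by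
  simp only [Bicategory.Adjunction.homEquiv₁_apply]
  dsimp [Bicategory.Adjunction.comp]
  calc
    _ = 𝟙 _ ⊗≫ r₂ ◁ r₁ ◁ β ⊗≫ r₂ ◁ ((r₁ ≫ l₁) ◁ (γ ▷ k) ≫ adj₁.counit ▷ ((l₂ ≫ h') ≫ k)) ⊗≫
        adj₂.counit ▷ (h' ≫ k) ⊗≫ 𝟙 _ := by bicategory
    _ = _ := by
      rw [whisker_exchange]
      bicategory

variable {L : Type u₁} [Bicategory.{w₁, v₁} L]

/-- Given 1-cells `e_p : D_p ⟶ G_p` and 2-cells `σ_f : e_q ⟶ D^f ≫ e_p ≫ G_f` for `f : p ⟶ q`, the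
colax natural transformation whose 2-cells `D_f ≫ e_q ⟶ e_p ≫ G_f` are the transposes of the `σ_f`
under `D^f ⊣ D_f`. -/
noncomputable def colaxOfCells (D : AdjPseudofunctor L K) (G : L ⥤ᵖ K)
    (e : ∀ p : L, D.toPs.obj ⟨p⟩ ⟶ G.obj p)
    (σ : ∀ {p q : L} (f : p ⟶ q), e q ⟶ D.toPs.map (Coop.mk₁ f) ≫ e p ≫ G.map f)
    (σ_naturality : ∀ {p q : L} {f g : p ⟶ q} (a : f ⟶ g),
      σ f ≫ D.toPs.map (Coop.mk₁ f) ◁ e p ◁ G.map₂ a =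
        σ g ≫ D.toPs.map₂ (Coop.mk₂ a) ▷ (e p ≫ G.map g))
    (σ_id : ∀ p : L, σ (𝟙 p) ≫ D.toPs.map (𝟙 (⟨p⟩ : Coop L)) ◁ e p ◁ (G.mapId p).hom =
      ((λ_ (e p)).inv ≫ 𝟙 _ ◁ (ρ_ (e p)).inv) ≫ (D.toPs.mapId ⟨p⟩).inv ▷ (e p ≫ 𝟙 (G.obj p)))
    (σ_comp : ∀ {p q r : L} (f : p ⟶ q) (g : q ⟶ r),
      σ (f ≫ g) ≫ D.toPs.map (Coop.mk₁ g ≫ Coop.mk₁ f) ◁ e p ◁ (G.mapComp f g).hom =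
        ((σ g ≫ D.toPs.map (Coop.mk₁ g) ◁ (σ f ▷ G.map g ≫ (α_ _ (e p ≫ G.map f) _).hom) ≫
          (α_ _ _ ((e p ≫ G.map f) ≫ G.map g)).inv) ≫ _ ◁ (α_ (e p) (G.map f) (G.map g)).hom) ≫
            (D.toPs.mapComp (Coop.mk₁ g) (Coop.mk₁ f)).inv ▷ (e p ≫ G.map f ≫ G.map g)) :
    D.rightPs.toOplax ⟶ G.toOplax where
  app p := e p
  naturality f := (D.adj (Coop.mk₁ f)).homEquiv₁ (σ f)
  naturality_naturality {p q f g} a :=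
    (conjugateEquiv_homEquiv₁ _ _ _ _).trans (Eq.trans (congrArg _ (σ_naturality a).symm)
      (homEquiv₁_comp _ _ _))
  naturality_id p := by
    refine (homEquiv₁_comp (D.adj (𝟙 (⟨p⟩ : Coop L))) (σ (𝟙 p)) (e p ◁ (G.mapId p).hom)).symm.trans
      ?_
    refine (congrArg _ (σ_id p)).trans ?_
    refine (conjugateEquiv_homEquiv₁ _ (Adjunction.id _) _ _).symm.trans ?_
    refine congrArg (_ ≫ ·) ?_
    rw [homEquiv₁_id]
    bicategory
  naturality_comp f g := by
    refine (homEquiv₁_comp (D.adj (Coop.mk₁ g ≫ Coop.mk₁ f)) (σ (f ≫ g))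
      (e _ ◁ (G.mapComp f g).hom)).symm.trans ?_
    refine (congrArg _ (σ_comp f g)).trans ?_
    refine (conjugateEquiv_homEquiv₁ _ ((D.adj (Coop.mk₁ g)).comp (D.adj (Coop.mk₁ f))) _ _).symm.trans
      ?_
    refine congrArg (_ ≫ ·) ?_
    rw [homEquiv₁_comp, homEquiv₁_comp_adj]
    simp only [Category.assoc]
    rfl

end

section

variable {L : Type w} [Bicategory.{w, w} L] {κ : Cardinal.{w}}
  (C : L ⥤ᵖ LexCat.{w, max v w, max u v w} κ)

/-- The co-dextrification `Ĉ`, as an object of `Ps^adj(Lᶜᵒᵒᵖ, Lex_κ)`, when all the functors `Ĉ^ϖ`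
have right adjoints in `Lex_κ`. -/
def codexAdj (h : ∀ {X Y : Coop L} (f : X ⟶ Y), IsLeftAdjoint ((codex.{w, v, u} C).map f)) :
    AdjPseudofunctor L (LexCat.{w, max v w, max u v w} κ) where
  toPs := codex.{w, v, u} C
  isLeftAdjoint f := h f

/-- The 2-cell with components `Γ^{1_q} ⟶ C_f (Γ^{1_p ≫ f}) = C_f ((Ĉ^f Γ)^{1_p})`. -/
def reflectCell {p q : L} (f : p ⟶ q) : codexEval.{w, v, u} C (𝟙 q) ⟶
    (codex.{w, v, u} C).map (Coop.mk₁ f) ≫ codexEval.{w, v, u} C (𝟙 p) ≫ C.map f :=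
  LexCat.Hom₂.mk (CodexObj.evalMap (C := C) f ((λ_ f).hom ≫ (ρ_ f).inv))

/-- The reflection `U Ĉ ⟶ C` with components `Ĉ_r ⟶ C_r, Γ ↦ Γ^{1_r}`, where `U Ĉ` is formed by the
right adjoints `Ĉ_ϖ` of the functors `Ĉ^ϖ`. -/
noncomputable def reflect
    (h : ∀ {X Y : Coop L} (f : X ⟶ Y), IsLeftAdjoint ((codex.{w, v, u} C).map f)) :
    (codexAdj.{w, v, u} C h).rightPs.toOplax ⟶ C.toOplax :=
  colaxOfCells (codexAdj.{w, v, u} C h) C (fun p => codexEval.{w, v, u} C (𝟙 p))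
    (fun f => reflectCell.{w, v, u} C f)
    (fun {p q f g} a => LexCat.hom₂_ext fun Γ => by
      have (Γ : CodexObj C q) : Γ.map f ((λ_ f).hom ≫ (ρ_ f).inv) ≫
          LexCat.Hom₂.app (C.map₂ a) (Γ.obj (𝟙 p ≫ f)) =
            Γ.map g ((λ_ g).hom ≫ (ρ_ g).inv) ≫ (lexMap C g).map (Γ.res (𝟙 p ◁ a)) := by
        rw [← CodexObj.map_whisker, ← CodexObj.map_res]
        congr 1
        simp
      exact this Γ)
    (fun p => LexCat.hom₂_ext fun Γ => by
      have (Γ : CodexObj C p) : Γ.map (𝟙 p) ((λ_ (𝟙 p)).hom ≫ (ρ_ (𝟙 p)).inv) ≫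
          LexCat.Hom₂.app (C.mapId p).hom (Γ.obj (𝟙 p ≫ 𝟙 p)) =
            (𝟙 _ ≫ 𝟙 _) ≫ Γ.res (ρ_ (𝟙 p)).hom := by
        rw [Category.comp_id, Category.id_comp, CodexObj.res]
        congr 2
        rw [unitors_inv_equal]
        simp [unitors_equal]
      exact this Γ)
    (fun {p q r} f g => LexCat.hom₂_ext fun Γ => by
      have (Γ : CodexObj C r) : Γ.map (f ≫ g) ((λ_ (f ≫ g)).hom ≫ (ρ_ (f ≫ g)).inv) ≫
          LexCat.Hom₂.app (C.mapComp f g).hom (Γ.obj (𝟙 p ≫ f ≫ g)) =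
            ((Γ.map g ((λ_ g).hom ≫ (ρ_ g).inv) ≫
              ((lexMap C g).map (Γ.map f (((λ_ f).hom ≫ (ρ_ f).inv) ▷ g ≫ (α_ f (𝟙 q) g).hom)) ≫
                𝟙 _) ≫ 𝟙 _) ≫ 𝟙 _) ≫
                  (lexMap C g).map ((lexMap C f).map (Γ.res (α_ (𝟙 p) f g).inv)) := by
        have h1 := Γ.map_comp f g (((λ_ f).hom ≫ (ρ_ f).inv) ▷ g ≫ (α_ f (𝟙 q) g).hom)
          ((λ_ g).hom ≫ (ρ_ g).inv)
        have h2 := LexCat.inv_hom_app (C.mapComp f g) (Γ.obj ((𝟙 p ≫ f) ≫ g))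
        have h3 : (lexMap C (f ≫ g)).map (Γ.res (α_ (𝟙 p) f g).inv) ≫
            LexCat.Hom₂.app (C.mapComp f g).hom (Γ.obj (𝟙 p ≫ f ≫ g)) =
              LexCat.Hom₂.app (C.mapComp f g).hom (Γ.obj ((𝟙 p ≫ f) ≫ g)) ≫
                (lexMap C g).map ((lexMap C f).map (Γ.res (α_ (𝟙 p) f g).inv)) :=
          LexCat.app_naturality (C.mapComp f g).hom (Γ.res (α_ (𝟙 p) f g).inv)
        have h4 : (λ_ (f ≫ g)).hom ≫ (ρ_ (f ≫ g)).inv = (α_ (𝟙 p) f g).inv ≫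
            (((λ_ f).hom ≫ (ρ_ f).inv) ▷ g ≫ (α_ f (𝟙 q) g).hom) ≫
              f ◁ ((λ_ g).hom ≫ (ρ_ g).inv) ≫ (α_ f g (𝟙 r)).inv := by
          simp
        have h5 := congrArg (fun x => Γ.map g ((λ_ g).hom ≫ (ρ_ g).inv) ≫
              (lexMap C g).map (Γ.map f (((λ_ f).hom ≫ (ρ_ f).inv) ▷ g ≫ (α_ f (𝟙 q) g).hom)) ≫
                x ≫ (lexMap C g).map ((lexMap C f).map (Γ.res (α_ (𝟙 p) f g).inv))) h2
        simp only [Category.assoc] at h5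
        rw [h4, CodexObj.map_res, Category.assoc, h3, h1]
        simp only [Category.assoc, Category.id_comp]
        exact h5.trans (congrArg (_ ≫ ·) (congrArg (_ ≫ ·) (Category.id_comp _)))
      exact this Γ)

end

/-- A right biadjoint of a pseudofunctor `U : B ⥤ᵖ A`: a pseudofunctor `R` and a pseudonatural
transformation `U R ⟶ 1` such that `F ↦ U F ≫ counit` is an equivalence of categories
`B(b, R a) ≌ A(U b, a)` for all `b` and `a`. -/
structure RightBiadjoint {B : Type u₁} [Bicategory.{w₁, v₁} B] {A : Type u₂}
    [Bicategory.{w₂, v₂} A] (U : B ⥤ᵖ A) where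
  /-- The right biadjoint. -/
  R : A ⥤ᵖ B
  /-- The counit. -/
  counit : R.comp U ⟶ Pseudofunctor.id A
  isEquivalence (b : B) (a : A) :
    (U.mapFunctor b (R.obj a) ⋙ postcomp (U.obj b) (counit.app a)).IsEquivalence

section

variable {L : Type w} [Bicategory.{w, w} L] {κ : Cardinal.{w}}
  (h : ∀ (C : L ⥤ᵖ LexCat.{w, max v w, max u v w} κ) {X Y : Coop L} (f : X ⟶ Y),
    IsLeftAdjoint ((codex.{w, v, u} C).map f))

/-- The object part `C ↦ Ĉ` of the right biadjoint. -/
def codexObj (C : PsColax L (LexCat.{w, max v w, max u v w} κ)) :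
    PsAdj L (LexCat.{w, max v w, max u v w} κ) :=
  codexAdj.{w, v, u} C (h C)

/-- The reflection `U Ĉ ⟶ C` as a 1-cell of `Ps_colax(L, Lex_κ)`. -/
noncomputable def codexCounit (C : PsColax L (LexCat.{w, max v w, max u v w} κ)) :
    (forgetAdj L (LexCat.{w, max v w, max u v w} κ)).obj (codexObj.{w, v, u} h C) ⟶ C :=
  mkHom (reflect.{w, v, u} C (h C))

/-- The functor `Ps^adj(D, Ĉ) ⥤ Ps_colax(U D, C)`, `F ↦ U F ≫ reflect`. -/
noncomputable def transposeFunctor (D : PsAdj L (LexCat.{w, max v w, max u v w} κ))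
    (C : PsColax L (LexCat.{w, max v w, max u v w} κ)) :
    (D ⟶ codexObj.{w, v, u} h C) ⥤
      ((forgetAdj L (LexCat.{w, max v w, max u v w} κ)).obj D ⟶ C) :=
  (forgetAdj L (LexCat.{w, max v w, max u v w} κ)).mapFunctor D (codexObj.{w, v, u} h C) ⋙
    postcomp _ (codexCounit.{w, v, u} h C)

end

/-! The existence of right adjoints is an adjoint triangle argument. Evaluation `Γ ↦ Γ^μ` at `μ : p
⟶ r` has a right adjoint: its value on `X` in `C_p` is, at `ξ : q ⟶ r`, the limit of the objects
`C_f X` over all `f : p ⟶ q` and `α : μ ⟶ f ≫ ξ`. The limit is `κ`-small because `L` is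
(`cofreeSmall`), and the functors `C_g` preserve it, which supplies the structure morphisms. A
morphism `Θ ⟶ cofree h μ X` is forced to have the components `Θ^α ≫ C_f a` for a single `a : Θ^μ ⟶
X` (`cofreeEquiv`). There are fewer than `κ` evaluations on `Ĉ_r`, so the joint evaluation `V` into
the product of the `C_p` also has a right adjoint, built from products of cofree objects. `V` is
conservative and, limits being pointwise, preserves equalizers; hence it is comonadic. Now `Ĉ^ϖ`
followed by `V` is the joint evaluation at the 1-cells `μ ≫ ϖ`, again a left adjoint, so the adjoint
triangle theorem and the equalizers of `Ĉ_s` give `Ĉ^ϖ` a right adjoint (`isLeftAdjoint_restrict`).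
Being a right adjoint it preserves limits, hence lies in `Lex_κ`.

For the universal property, the right adjoints `D_f` are eliminated. Transposition under `D^f ⊣ D_f`
turns a colax transformation `G : U D ⟶ C` into 2-cells `G_q ⟶ D^f ≫ G_p ≫ C_f` (`cell`) whose laws
mention only the left adjoints. Such data define a pseudonatural `F : D ⟶ Ĉ` with `(F_r X)^μ = G_p
(D^μ X)`. Conversely, for any pseudonatural `F` the isomorphisms `F_p D^μ ≅ Ĉ^μ F_r`, evaluated at
`1_p`, give `(F_p (D^μ X))^{1_p} ≅ (F_r X)^μ` (`evalHom`), compatibly with structure morphisms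
(`evalHom_map`). So `F` and the modifications out of it are controlled by their values at
identities, which are exactly what `reflect` retains: this gives faithfulness and fullness.
Essential surjectivity holds because the transpose of the lift of `G` has components `D^{1_p} ≫ G_p
≅ G_p`.

The biadjunction is then formal: universal arrows `e_a : U (R₀ a) ⟶ a` that induce equivalences of
hom categories assemble into a right biadjoint with counit `e`. Full faithfulness defines 2-cells
into `R₀ a` and reduces every coherence law to an equation in the target bicategory
(`RightBiadjoint.ofObjwise`). -/

/-! ### Left adjoints into products, and adjunctions in `Lex_κ` -/

section

/-- A family of left adjoint functors out of a category with products indexed by the family is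
jointly a left adjoint. -/
lemma isLeftAdjoint_pi' {I : Type w} {A : Type u} [Category.{v} A] {B : I → Type u₁}
    [∀ i, Category.{v₁} (B i)] (F : ∀ i, A ⥤ B i) [∀ i, (F i).IsLeftAdjoint]
    [HasLimitsOfShape (Discrete I) A] : (Functor.pi' F).IsLeftAdjoint := by
  let e : ∀ (X : A) (Y : ∀ i, B i), ((Functor.pi' F).obj X ⟶ Y) ≃
      (X ⟶ ∏ᶜ fun i => (F i).rightAdjoint.obj (Y i)) := fun X Y =>
    { toFun := fun f => Pi.lift fun i =>
        (CategoryTheory.Adjunction.ofIsLeftAdjoint (F i)).homEquiv _ _ (f i)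
      invFun := fun g i =>
        ((CategoryTheory.Adjunction.ofIsLeftAdjoint (F i)).homEquiv _ _).symm (g ≫ Pi.π _ i)
      left_inv := fun f => by
        funext i
        simp only [Pi.lift_π]
        exact Equiv.symm_apply_apply _ _
      right_inv := fun g => by
        apply Pi.hom_ext
        intro i
        simp }
  refine (Adjunction.adjunctionOfEquivRight (F := Functor.pi' F) e fun X' X Y f g => ?_).isLeftAdjoint
  apply Pi.hom_ext
  intro i
  change Pi.lift _ ≫ Pi.π _ i = (f ≫ Pi.lift _) ≫ Pi.π _ i
  rw [Category.assoc, Pi.lift_π, Pi.lift_π]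
  exact CategoryTheory.Adjunction.homEquiv_naturality_left _ _ _

/-- A functor preserving `κ`-small limits with a right adjoint has a right adjoint in `Lex_κ`. -/
lemma LexCat.isLeftAdjoint_of_functor {κ : Cardinal.{w}} {A B : LexCat.{w, v, u} κ} (F : A ⟶ B)
    (h : F.toFunctor.IsLeftAdjoint) : IsLeftAdjoint F := by
  let adj := CategoryTheory.Adjunction.ofIsLeftAdjoint F.toFunctor
  -- A right adjoint preserves all limits, so it is automatically a 1-cell of `Lex_κ`.
  let G : B ⟶ A := LexCat.Hom.mk F.toFunctor.rightAdjoint fun J _ _ =>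
    have := adj.rightAdjoint_preservesLimits.{w, w}
    inferInstance
  refine IsLeftAdjoint.mk (g := G)
    { unit := LexCat.Hom₂.mk adj.unit
      counit := LexCat.Hom₂.mk adj.counit
      left_triangle := LexCat.hom₂_ext fun X => ?_
      right_triangle := LexCat.hom₂_ext fun X => ?_ }
  · simp [leftZigzag, bicategoricalComp]
    exact adj.left_triangle_components X
  · simp [rightZigzag, bicategoricalComp]
    exact adj.right_triangle_components X

end

/-- An arrow of a discrete category is determined by its source. This makes products of fewer than
`κ` factors count as `κ`-small limits. -/
lemma HasCardinalLT.arrow_discrete {I : Type w} {κ : Cardinal.{w}} (h : HasCardinalLT I κ) :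
    HasCardinalLT (Arrow (Discrete I)) κ :=
  h.of_injective (fun a => a.left.as) (by
    rintro ⟨⟨a⟩, ⟨b⟩, f⟩ ⟨⟨a'⟩, ⟨b'⟩, f'⟩ h
    obtain rfl : a = b := Discrete.eq_of_hom f
    obtain rfl : a' = b' := Discrete.eq_of_hom f'
    obtain rfl : a = a' := h
    congr 1
    exact Subsingleton.elim _ _)

/-! ### Componentwise calculus of pseudofunctors into `Lex_κ` -/

namespace LexPs

section

variable {B : Type u₁} [Bicategory.{w₁, v₁} B] {κ : Cardinal.{w}} (P : B ⥤ᵖ LexCat.{w, v, u} κ)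

/-- The components of the image of a 2-cell. -/
def m₂ {a b : B} {f g : a ⟶ b} (γ : f ⟶ g) (X : P.obj a) :
    (lexMap P f).obj X ⟶ (lexMap P g).obj X := LexCat.Hom₂.app (P.map₂ γ) X

/-- The components of the unit constraint. -/
def idHom (a : B) (X : P.obj a) : (lexMap P (𝟙 a)).obj X ⟶ X := LexCat.Hom₂.app (P.mapId a).hom X

/-- The components of the inverse of the unit constraint. -/
def idInv (a : B) (X : P.obj a) : X ⟶ (lexMap P (𝟙 a)).obj X := LexCat.Hom₂.app (P.mapId a).inv X

/-- The components of the composition constraint. -/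
def compHom {a b c : B} (f : a ⟶ b) (g : b ⟶ c) (X : P.obj a) :
    (lexMap P (f ≫ g)).obj X ⟶ (lexMap P g).obj ((lexMap P f).obj X) :=
  LexCat.Hom₂.app (P.mapComp f g).hom X

/-- The components of the inverse of the composition constraint. -/
def compInv {a b c : B} (f : a ⟶ b) (g : b ⟶ c) (X : P.obj a) :
    (lexMap P g).obj ((lexMap P f).obj X) ⟶ (lexMap P (f ≫ g)).obj X :=
  LexCat.Hom₂.app (P.mapComp f g).inv X

@[simp] lemma id_hom_inv (a : B) (X : P.obj a) : idHom P a X ≫ idInv P a X = 𝟙 _ :=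
  LexCat.hom_inv_app (P.mapId a) X

@[simp] lemma id_inv_hom (a : B) (X : P.obj a) : idInv P a X ≫ idHom P a X = 𝟙 _ :=
  LexCat.inv_hom_app (P.mapId a) X

@[simp] lemma comp_hom_inv {a b c : B} (f : a ⟶ b) (g : b ⟶ c) (X : P.obj a) :
    compHom P f g X ≫ compInv P f g X = 𝟙 _ :=
  LexCat.hom_inv_app (P.mapComp f g) X

@[simp] lemma comp_inv_hom {a b c : B} (f : a ⟶ b) (g : b ⟶ c) (X : P.obj a) :
    compInv P f g X ≫ compHom P f g X = 𝟙 _ :=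
  LexCat.inv_hom_app (P.mapComp f g) X

instance (a : B) (X : P.obj a) : IsIso (idHom P a X) := ⟨idInv P a X, by simp, by simp⟩

instance (a : B) (X : P.obj a) : IsIso (idInv P a X) := ⟨idHom P a X, by simp, by simp⟩

instance {a b c : B} (f : a ⟶ b) (g : b ⟶ c) (X : P.obj a) : IsIso (compHom P f g X) :=
  ⟨compInv P f g X, by simp, by simp⟩

instance {a b c : B} (f : a ⟶ b) (g : b ⟶ c) (X : P.obj a) : IsIso (compInv P f g X) :=
  ⟨compHom P f g X, by simp, by simp⟩

@[simp] lemma comp_inv_hom_assoc {a b c : B} (f : a ⟶ b) (g : b ⟶ c) (X : P.obj a) {Z : P.obj c}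
    (k : _ ⟶ Z) : compInv P f g X ≫ compHom P f g X ≫ k = k := by
  rw [← Category.assoc, comp_inv_hom, Category.id_comp]

@[simp] lemma m₂_id {a b : B} (f : a ⟶ b) (X : P.obj a) : m₂ P (𝟙 f) X = 𝟙 _ :=
  congrArg (fun x => LexCat.Hom₂.app x X) (P.map₂_id f)

lemma m₂_comp {a b : B} {f g h : a ⟶ b} (γ : f ⟶ g) (δ : g ⟶ h) (X : P.obj a) :
    m₂ P (γ ≫ δ) X = m₂ P γ X ≫ m₂ P δ X :=
  congrArg (fun x => LexCat.Hom₂.app x X) (P.map₂_comp γ δ)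

lemma m₂_naturality {a b : B} {f g : a ⟶ b} (γ : f ⟶ g) {X Y : P.obj a} (k : X ⟶ Y) :
    (lexMap P f).map k ≫ m₂ P γ Y = m₂ P γ X ≫ (lexMap P g).map k :=
  LexCat.app_naturality (P.map₂ γ) k

lemma idHom_naturality (a : B) {X Y : P.obj a} (k : X ⟶ Y) :
    (lexMap P (𝟙 a)).map k ≫ idHom P a Y = idHom P a X ≫ k :=
  LexCat.app_naturality (P.mapId a).hom k

lemma idInv_naturality (a : B) {X Y : P.obj a} (k : X ⟶ Y) :
    k ≫ idInv P a Y = idInv P a X ≫ (lexMap P (𝟙 a)).map k :=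
  LexCat.app_naturality (P.mapId a).inv k

lemma compHom_naturality {a b c : B} (f : a ⟶ b) (g : b ⟶ c) {X Y : P.obj a} (k : X ⟶ Y) :
    (lexMap P (f ≫ g)).map k ≫ compHom P f g Y =
      compHom P f g X ≫ (lexMap P g).map ((lexMap P f).map k) :=
  LexCat.app_naturality (P.mapComp f g).hom k

lemma compInv_naturality {a b c : B} (f : a ⟶ b) (g : b ⟶ c) {X Y : P.obj a} (k : X ⟶ Y) :
    (lexMap P g).map ((lexMap P f).map k) ≫ compInv P f g Y =
      compInv P f g X ≫ (lexMap P (f ≫ g)).map k :=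
  LexCat.app_naturality (P.mapComp f g).inv k

lemma compHom_whiskerRight {a b c : B} {f f' : a ⟶ b} (γ : f ⟶ f') (g : b ⟶ c) (X : P.obj a) :
    m₂ P (γ ▷ g) X ≫ compHom P f' g X = compHom P f g X ≫ (lexMap P g).map (m₂ P γ X) := by
  have h : m₂ P (γ ▷ g) X = compHom P f g X ≫ (lexMap P g).map (m₂ P γ X) ≫ compInv P f' g X :=
    congrArg (fun x => LexCat.Hom₂.app x X) (P.map₂_whisker_right γ g)
  simp [h]

lemma compHom_whiskerLeft {a b c : B} (f : a ⟶ b) {g g' : b ⟶ c} (γ : g ⟶ g') (X : P.obj a) :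
    m₂ P (f ◁ γ) X ≫ compHom P f g' X = compHom P f g X ≫ m₂ P γ ((lexMap P f).obj X) := by
  have h : m₂ P (f ◁ γ) X = compHom P f g X ≫ m₂ P γ ((lexMap P f).obj X) ≫ compInv P f g' X :=
    congrArg (fun x => LexCat.Hom₂.app x X) (P.map₂_whisker_left f γ)
  simp [h]

lemma compHom_associator {a b c d : B} (f : a ⟶ b) (g : b ⟶ c) (h : c ⟶ d) (X : P.obj a) :
    m₂ P (α_ f g h).hom X ≫ compHom P f (g ≫ h) X ≫ compHom P g h ((lexMap P f).obj X) =
      compHom P (f ≫ g) h X ≫ (lexMap P h).map (compHom P f g X) := by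
  have h1 : m₂ P (α_ f g h).hom X = compHom P (f ≫ g) h X ≫ (lexMap P h).map (compHom P f g X) ≫
      𝟙 _ ≫ compInv P g h ((lexMap P f).obj X) ≫ compInv P f (g ≫ h) X :=
    congrArg (fun x => LexCat.Hom₂.app x X) (P.map₂_associator f g h)
  simp [h1]

lemma m₂_leftUnitor {a b : B} (f : a ⟶ b) (X : P.obj a) :
    m₂ P (λ_ f).hom X = compHom P (𝟙 a) f X ≫ (lexMap P f).map (idHom P a X) := by
  have h1 : m₂ P (λ_ f).hom X = compHom P (𝟙 a) f X ≫ (lexMap P f).map (idHom P a X) ≫ 𝟙 _ :=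
    congrArg (fun x => LexCat.Hom₂.app x X) (P.map₂_left_unitor f)
  simp [h1]

lemma m₂_rightUnitor {a b : B} (f : a ⟶ b) (X : P.obj a) :
    m₂ P (ρ_ f).hom X = compHom P f (𝟙 b) X ≫ idHom P b ((lexMap P f).obj X) := by
  have h1 : m₂ P (ρ_ f).hom X = compHom P f (𝟙 b) X ≫ idHom P b ((lexMap P f).obj X) ≫ 𝟙 _ :=
    congrArg (fun x => LexCat.Hom₂.app x X) (P.map₂_right_unitor f)
  simp [h1]

end

end LexPs

open LexPs

/-! ### Cofree objects: right adjoints of the evaluations -/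

namespace CodexObj

section

variable {L : Type w} [Bicategory.{w, w} L] {κ : Cardinal.{w}} {C : L ⥤ᵖ LexCat.{w, v, u} κ}

/-- The diagram `(f, α : μ ⟶ f ≫ ξ) ↦ C_f X`. -/
@[simps]
def cofreeDiagram {p q r : L} (μ : p ⟶ r) (X : C.obj p) (ξ : q ⟶ r) :
    StructuredArrow μ (postcomp p ξ) ⥤ C.obj q where
  obj A := (lexMap C A.right).obj X
  map a := m₂ C a.right X
  map_id A := m₂_id C A.right X
  map_comp a b := m₂_comp C a.right b.right X

variable (L κ) in
/-- The categories indexing the cofree objects are `κ`-small. -/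
def CofreeSmall : Prop := ∀ ⦃p q r : L⦄ (μ : p ⟶ r) (ξ : q ⟶ r),
  HasCardinalLT (Arrow (StructuredArrow μ (postcomp p ξ))) κ

lemma map_id_eq {p r : L} (Γ : CodexObj C r) (μ : p ⟶ r) :
    Γ.map (𝟙 p) (λ_ μ).inv = idInv C p (Γ.obj μ) := Γ.map_id μ

lemma map_comp_eq {p q s r : L} (Γ : CodexObj C r) {μ : p ⟶ r} {ν : q ⟶ r} {ξ : s ⟶ r}
    (f : p ⟶ q) (g : q ⟶ s) (α : μ ⟶ f ≫ ν) (β : ν ⟶ g ≫ ξ) :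
    Γ.map (f ≫ g) (α ≫ f ◁ β ≫ (α_ f g ξ).inv) =
      Γ.map g β ≫ (lexMap C g).map (Γ.map f α) ≫ compInv C f g (Γ.obj μ) := Γ.map_comp f g α β

lemma map_whisker_eq {p q r : L} (Γ : CodexObj C r) {μ : p ⟶ r} {ν : q ⟶ r} {f f' : p ⟶ q}
    (α : μ ⟶ f ≫ ν) (γ : f ⟶ f') :
    Γ.map f' (α ≫ γ ▷ ν) = Γ.map f α ≫ m₂ C γ (Γ.obj μ) := Γ.map_whisker α γ

lemma cofreeSmall (hκ : κ.IsRegular) (hL : HasCardinalLT (Σ (p q : L) (f g : p ⟶ q), f ⟶ g) κ) :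
    CofreeSmall L κ := fun p q r μ ξ => by
  have h : HasCardinalLT (Σ (f g : p ⟶ q), (f ⟶ g) × (μ ⟶ f ≫ ξ)) κ := by
    -- The pair `(γ, α)` is recorded as two 2-cells of `L`, one between 1-cells `p ⟶ q` and one
    -- between 1-cells `p ⟶ r`. As `κ` is infinite, there are still fewer than `κ` such pairs.
    refine (hasCardinalLT_prod hκ.aleph0_le hL hL).of_injective
      (fun a => (⟨p, q, _, _, a.2.2.1⟩, ⟨p, r, _, _, a.2.2.2⟩)) ?_
    rintro ⟨f, g, γ, α⟩ ⟨f', g', γ', α'⟩ h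
    obtain ⟨h1, h2⟩ := Prod.ext_iff.1 h
    cases h1
    cases h2
    rfl
  -- An arrow of the index category is determined by its source `(f, α)` and a 2-cell `γ : f ⟶ g`:
  -- the 2-cell of its target must be `α ≫ γ ▷ ξ`.
  refine h.of_surjective (fun a => Arrow.mk (StructuredArrow.homMk a.2.2.1 :
    StructuredArrow.mk (S := μ) (T := postcomp p ξ) a.2.2.2 ⟶
      StructuredArrow.mk (a.2.2.2 ≫ (postcomp p ξ).map a.2.2.1))) fun a => ?_
  obtain ⟨A, B, γ⟩ := a
  refine ⟨⟨A.right, B.right, γ.right, A.hom⟩, ?_⟩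
  have hB : B = StructuredArrow.mk (A.hom ≫ (postcomp p ξ).map γ.right) :=
    congrArg (StructuredArrow.mk (T := postcomp p ξ)) (StructuredArrow.w (show A ⟶ B from γ)).symm
  obtain ⟨⟨⟨⟩⟩, f, α⟩ := A
  -- The target agrees with the canonical one only propositionally, so it is generalized before the
  -- equality is eliminated.
  have key : ∀ (B' : StructuredArrow μ (postcomp p ξ)) (e : B = B') (γ' : _ ⟶ B')
      (hγ : γ'.right = γ.right ≫ eqToHom (congrArg Comma.right e)), Arrow.mk γ' = Arrow.mk γ := by
    rintro _ rfl γ' hγ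
    congr 1
    ext
    simpa using hγ
  refine key _ hB _ ?_
  simp

lemma CofreeSmall.hasLimitsOfShape (h : CofreeSmall L κ) {p q r s : L} (μ : p ⟶ r) (ξ : q ⟶ r) :
    HasLimitsOfShape (StructuredArrow μ (postcomp p ξ)) (C.obj s) :=
    (C.obj s).hasLimits _ (h μ ξ)

variable (h : CofreeSmall L κ)

section

variable {p q r s : L} (μ : p ⟶ r) (X : C.obj p)

/-- The limit of the objects `C_f X` over all `f` and `α : μ ⟶ f ≫ ξ`. -/
noncomputable def cofreeAt (ξ : q ⟶ r) : C.obj q :=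
  have := h.hasLimitsOfShape (C := C) (s := q) μ ξ
  limit (cofreeDiagram μ X ξ)

/-- The projections of the limit `cofreeAt`. -/
noncomputable def cofreeπ {ξ : q ⟶ r} (f : p ⟶ q) (α : μ ⟶ f ≫ ξ) :
    cofreeAt h μ X ξ ⟶ (lexMap C f).obj X :=
  have := h.hasLimitsOfShape (C := C) (s := q) μ ξ
  limit.π (cofreeDiagram μ X ξ) (StructuredArrow.mk (S := μ) (T := postcomp p ξ) (Y := f) α)

/-- The cone condition at the arrow `(f, α) ⟶ (f', α ≫ γ ▷ ξ)` of the index category given by `γ`.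
All coherence 2-cells of `L` are absorbed into the projections through it. -/
lemma cofreeπ_whisker {ξ : q ⟶ r} {f f' : p ⟶ q} (α : μ ⟶ f ≫ ξ) (γ : f ⟶ f') :
    cofreeπ h μ X f' (α ≫ γ ▷ ξ) = cofreeπ h μ X f α ≫ m₂ C γ X := by
  have := h.hasLimitsOfShape (C := C) (s := q) μ ξ
  exact (limit.w (cofreeDiagram μ X ξ) (StructuredArrow.homMk γ :
    StructuredArrow.mk (S := μ) (T := postcomp p ξ) (Y := f) α ⟶ StructuredArrow.mk _)).symm

/-- The universal property of the limit `cofreeAt`, preserved by the functors `C_g`. -/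
noncomputable def cofreeLift {ξ : q ⟶ r} (g : q ⟶ s) {Y : C.obj s}
    (φ : ∀ (f : p ⟶ q) (_ : μ ⟶ f ≫ ξ), Y ⟶ (lexMap C g).obj ((lexMap C f).obj X))
    (hφ : ∀ {f f' : p ⟶ q} (α : μ ⟶ f ≫ ξ) (γ : f ⟶ f'),
      φ f' (α ≫ γ ▷ ξ) = φ f α ≫ (lexMap C g).map (m₂ C γ X)) :
    Y ⟶ (lexMap C g).obj (cofreeAt h μ X ξ) :=
  have := h.hasLimitsOfShape (C := C) (s := q) μ ξ
  have := (C.map g).preservesLimits _ (h μ ξ)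
  (isLimitOfPreserves (lexMap C g) (limit.isLimit (cofreeDiagram μ X ξ))).lift
    { pt := Y
      π :=
        { app := fun A => φ A.right A.hom
          naturality := fun A B γ => by
            have h2 : A.hom ≫ γ.right ▷ ξ = B.hom := StructuredArrow.w γ
            exact (Category.id_comp _).trans ((congrArg (φ B.right) h2.symm).trans (hφ _ _)) } }

lemma cofreeLift_π {ξ : q ⟶ r} (g : q ⟶ s) {Y : C.obj s}
    (φ : ∀ (f : p ⟶ q) (_ : μ ⟶ f ≫ ξ), Y ⟶ (lexMap C g).obj ((lexMap C f).obj X))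
    (hφ : ∀ {f f' : p ⟶ q} (α : μ ⟶ f ≫ ξ) (γ : f ⟶ f'),
      φ f' (α ≫ γ ▷ ξ) = φ f α ≫ (lexMap C g).map (m₂ C γ X))
    (f : p ⟶ q) (α : μ ⟶ f ≫ ξ) :
    cofreeLift h μ X g φ hφ ≫ (lexMap C g).map (cofreeπ h μ X f α) = φ f α :=
  have := h.hasLimitsOfShape (C := C) (s := q) μ ξ
  have := (C.map g).preservesLimits _ (h μ ξ)
  (isLimitOfPreserves (lexMap C g) (limit.isLimit (cofreeDiagram μ X ξ))).fac _
    (StructuredArrow.mk (S := μ) (T := postcomp p ξ) (Y := f) α)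

/-- The universal property of the limit `cofreeAt`. -/
noncomputable def cofreeLift' (ξ : q ⟶ r) {Y : C.obj q}
    (φ : ∀ (f : p ⟶ q) (_ : μ ⟶ f ≫ ξ), Y ⟶ (lexMap C f).obj X)
    (hφ : ∀ {f f' : p ⟶ q} (α : μ ⟶ f ≫ ξ) (γ : f ⟶ f'), φ f' (α ≫ γ ▷ ξ) = φ f α ≫ m₂ C γ X) :
    Y ⟶ cofreeAt h μ X ξ :=
  have := h.hasLimitsOfShape (C := C) (s := q) μ ξ
  limit.lift (cofreeDiagram μ X ξ)
    { pt := Y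
      π :=
        { app := fun A => φ A.right A.hom
          naturality := fun A B γ => by
            have h2 : A.hom ≫ γ.right ▷ ξ = B.hom := StructuredArrow.w γ
            exact (Category.id_comp _).trans ((congrArg (φ B.right) h2.symm).trans (hφ _ _)) } }

lemma cofreeLift'_π (ξ : q ⟶ r) {Y : C.obj q}
    (φ : ∀ (f : p ⟶ q) (_ : μ ⟶ f ≫ ξ), Y ⟶ (lexMap C f).obj X)
    (hφ : ∀ {f f' : p ⟶ q} (α : μ ⟶ f ≫ ξ) (γ : f ⟶ f'), φ f' (α ≫ γ ▷ ξ) = φ f α ≫ m₂ C γ X)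
    (f : p ⟶ q) (α : μ ⟶ f ≫ ξ) :
    cofreeLift' h μ X ξ φ hφ ≫ cofreeπ h μ X f α = φ f α :=
  have := h.hasLimitsOfShape (C := C) (s := q) μ ξ
  limit.lift_π _ (StructuredArrow.mk (S := μ) (T := postcomp p ξ) (Y := f) α)

lemma cofree_hom_ext {ξ : q ⟶ r} (g : q ⟶ s) {Y : C.obj s}
    {a b : Y ⟶ (lexMap C g).obj (cofreeAt h μ X ξ)}
    (hab : ∀ (f : p ⟶ q) (α : μ ⟶ f ≫ ξ), a ≫ (lexMap C g).map (cofreeπ h μ X f α) =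
      b ≫ (lexMap C g).map (cofreeπ h μ X f α)) : a = b :=
  have := h.hasLimitsOfShape (C := C) (s := q) μ ξ
  have := (C.map g).preservesLimits _ (h μ ξ)
  (isLimitOfPreserves (lexMap C g) (limit.isLimit (cofreeDiagram μ X ξ))).hom_ext fun A =>
    hab A.right A.hom

lemma cofree_hom_ext' {ξ : q ⟶ r} {Y : C.obj q} {a b : Y ⟶ cofreeAt h μ X ξ}
    (hab : ∀ (f : p ⟶ q) (α : μ ⟶ f ≫ ξ), a ≫ cofreeπ h μ X f α = b ≫ cofreeπ h μ X f α) :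
    a = b :=
  have := h.hasLimitsOfShape (C := C) (s := q) μ ξ
  limit.hom_ext fun A => hab A.right A.hom

/-- Composition with `(g, β)` carries the index category at `ξ` to the one at `ζ`; interchange shows
that the reindexed projections form a cone over `C_g` of the diagram at `ξ`. -/
lemma cofreeMap_aux {q s : L} {ξ : q ⟶ r} {ζ : s ⟶ r} (g : q ⟶ s) (β : ξ ⟶ g ≫ ζ)
    {f f' : p ⟶ q} (α : μ ⟶ f ≫ ξ) (γ : f ⟶ f') :
    cofreeπ h μ X (f' ≫ g) ((α ≫ γ ▷ ξ) ≫ f' ◁ β ≫ (α_ f' g ζ).inv) ≫ compHom C f' g X =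
      (cofreeπ h μ X (f ≫ g) (α ≫ f ◁ β ≫ (α_ f g ζ).inv) ≫ compHom C f g X) ≫
        (lexMap C g).map (m₂ C γ X) := by
  have h2 : (α ≫ γ ▷ ξ) ≫ f' ◁ β ≫ (α_ f' g ζ).inv =
      (α ≫ f ◁ β ≫ (α_ f g ζ).inv) ≫ (γ ▷ g) ▷ ζ := by
    simp [← whisker_exchange_assoc]
  rw [h2, cofreeπ_whisker, Category.assoc, Category.assoc, compHom_whiskerRight]

/-- The structure morphisms of the cofree objects. -/
noncomputable def cofreeMap {q s : L} {ξ : q ⟶ r} {ζ : s ⟶ r} (g : q ⟶ s) (β : ξ ⟶ g ≫ ζ) :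
    cofreeAt h μ X ζ ⟶ (lexMap C g).obj (cofreeAt h μ X ξ) :=
  cofreeLift h μ X g (fun f α => cofreeπ h μ X (f ≫ g) (α ≫ f ◁ β ≫ (α_ f g ζ).inv) ≫
    compHom C f g X) (cofreeMap_aux h μ X g β)

lemma cofreeMap_π {q s : L} {ξ : q ⟶ r} {ζ : s ⟶ r} (g : q ⟶ s) (β : ξ ⟶ g ≫ ζ) (f : p ⟶ q)
    (α : μ ⟶ f ≫ ξ) : cofreeMap h μ X g β ≫ (lexMap C g).map (cofreeπ h μ X f α) =
      cofreeπ h μ X (f ≫ g) (α ≫ f ◁ β ≫ (α_ f g ζ).inv) ≫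
        compHom C f g X :=
  cofreeLift_π h μ X g _ (cofreeMap_aux h μ X g β) f α

/-- The cofree object of `Ĉ_r` on an object `X` of `C_p` at `μ : p ⟶ r`. -/
noncomputable def cofree : CodexObj C r where
  obj ξ := cofreeAt h μ X ξ
  map g β := cofreeMap h μ X g β
  map_id {q} ξ := cofree_hom_ext h μ X _ fun f α => by
    change _ = idInv C q _ ≫ _
    rw [cofreeMap_π, ← idInv_naturality, ← cancel_mono (idHom C q _)]
    simp only [Category.assoc, id_inv_hom, Category.comp_id]
    -- The projection at `f ≫ 𝟙 q` followed by the unit constraints of `C` is the action of `ρ_ f`,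
    -- which the cone condition turns into the projection at `f`.
    rw [← m₂_rightUnitor, ← cofreeπ_whisker]
    congr 1
    simp
  map_comp {q s t ξ ζ ω} f g α β := cofree_hom_ext h μ X _ fun e η => by
    change _ = (_ ≫ _ ≫ compInv C f g _) ≫ _
    rw [cofreeMap_π, Category.assoc, Category.assoc, ← compInv_naturality]
    rw [← cancel_mono (compHom C f g _)]
    simp only [Category.assoc, comp_inv_hom, Category.comp_id]
    rw [← Functor.map_comp, cofreeMap_π, Functor.map_comp,
      ← Category.assoc (cofreeMap h μ X g β), cofreeMap_π]
    simp only [Category.assoc]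
    -- The two iterated projections are indexed by the two bracketings of `e`, `f`, `g`; the
    -- associator is an arrow of the index category between them.
    rw [← compHom_associator, ← reassoc_of% cofreeπ_whisker]
    congr 2
    simp
  map_whisker {q s ξ ζ f f'} α γ := cofree_hom_ext h μ X _ fun e η => by
    change _ = (_ ≫ m₂ C γ _) ≫ _
    rw [cofreeMap_π, Category.assoc, ← m₂_naturality,
      ← Category.assoc (cofreeMap h μ X f α), cofreeMap_π,
      Category.assoc, ← compHom_whiskerLeft, ← reassoc_of% cofreeπ_whisker]
    congr 2
    simp

/-- The projections of the components of the cofree objects. -/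
noncomputable def cofreeProj {ξ : q ⟶ r} (f : p ⟶ q) (α : μ ⟶ f ≫ ξ) :
    (cofree h μ X).obj ξ ⟶ (lexMap C f).obj X := cofreeπ h μ X f α

lemma cofreeProj_whisker {ξ : q ⟶ r} {f f' : p ⟶ q} (α : μ ⟶ f ≫ ξ) (γ : f ⟶ f') :
    cofreeProj h μ X f' (α ≫ γ ▷ ξ) = cofreeProj h μ X f α ≫ m₂ C γ X :=
  cofreeπ_whisker h μ X α γ

lemma cofree_map_proj {q s : L} {ξ : q ⟶ r} {ζ : s ⟶ r} (g : q ⟶ s) (β : ξ ⟶ g ≫ ζ) (f : p ⟶ q)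
    (α : μ ⟶ f ≫ ξ) : (cofree h μ X).map g β ≫ (lexMap C g).map (cofreeProj h μ X f α) =
      cofreeProj h μ X (f ≫ g) (α ≫ f ◁ β ≫ (α_ f g ζ).inv) ≫ compHom C f g X :=
  cofreeMap_π h μ X g β f α

lemma cofreeProj_hom_ext {ξ : q ⟶ r} (g : q ⟶ s) {Y : C.obj s}
    {a b : Y ⟶ (lexMap C g).obj ((cofree h μ X).obj ξ)}
    (hab : ∀ (f : p ⟶ q) (α : μ ⟶ f ≫ ξ), a ≫ (lexMap C g).map (cofreeProj h μ X f α) =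
      b ≫ (lexMap C g).map (cofreeProj h μ X f α)) : a = b :=
  cofree_hom_ext h μ X g hab

lemma cofreeProj_hom_ext' {ξ : q ⟶ r} {Y : C.obj q} {a b : Y ⟶ (cofree h μ X).obj ξ}
    (hab : ∀ (f : p ⟶ q) (α : μ ⟶ f ≫ ξ), a ≫ cofreeProj h μ X f α = b ≫ cofreeProj h μ X f α) :
    a = b :=
  cofree_hom_ext' h μ X hab

lemma cofreeTransposeApp_aux {Θ : CodexObj C r} (a : Θ.obj μ ⟶ X) {ξ : q ⟶ r} {f f' : p ⟶ q}
    (α : μ ⟶ f ≫ ξ) (γ : f ⟶ f') :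
    Θ.map f' (α ≫ γ ▷ ξ) ≫ (lexMap C f').map a =
      (Θ.map f α ≫ (lexMap C f).map a) ≫ m₂ C γ X := by
  rw [map_whisker_eq, Category.assoc, Category.assoc, m₂_naturality C γ a]

/-- The components of the morphism into a cofree object given by a morphism out of the
evaluation. -/
noncomputable def cofreeTransposeApp {Θ : CodexObj C r} (a : Θ.obj μ ⟶ X) (ξ : q ⟶ r) :
    Θ.obj ξ ⟶ (cofree h μ X).obj ξ :=
  cofreeLift' h μ X ξ (fun f α => Θ.map f α ≫ (lexMap C f).map a)
    (cofreeTransposeApp_aux μ X a)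

lemma cofreeTransposeApp_π {Θ : CodexObj C r} (a : Θ.obj μ ⟶ X) {ξ : q ⟶ r} (f : p ⟶ q)
    (α : μ ⟶ f ≫ ξ) :
    cofreeTransposeApp h μ X a ξ ≫ cofreeProj h μ X f α = Θ.map f α ≫ (lexMap C f).map a :=
  cofreeLift'_π h μ X ξ (fun f α => Θ.map f α ≫ (lexMap C f).map a)
    (cofreeTransposeApp_aux μ X a) f α

/-- The morphism into a cofree object given by a morphism out of the evaluation. -/
noncomputable def cofreeTranspose {Θ : CodexObj C r} (a : Θ.obj μ ⟶ X) : Θ ⟶ cofree h μ X where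
  app ξ := cofreeTransposeApp h μ X a ξ
  naturality {q s ξ ζ} g β := cofreeProj_hom_ext h μ X _ fun f α => by
    rw [Category.assoc, ← Functor.map_comp, cofreeTransposeApp_π, Category.assoc, cofree_map_proj,
      reassoc_of% (cofreeTransposeApp_π h μ X (ξ := ζ)), Functor.map_comp, map_comp_eq]
    simp only [Category.assoc]
    rw [compHom_naturality, comp_inv_hom_assoc]

lemma cofreeTranspose_π {Θ : CodexObj C r} (a : Θ.obj μ ⟶ X) {ξ : q ⟶ r} (f : p ⟶ q)
    (α : μ ⟶ f ≫ ξ) :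
    homApp (cofreeTranspose h μ X a) ξ ≫ cofreeProj h μ X f α = Θ.map f α ≫ (lexMap C f).map a :=
  cofreeTransposeApp_π h μ X a f α

/-- The counit of the cofree objects. -/
noncomputable def cofreeCounit : (cofree h μ X).obj μ ⟶ X :=
  cofreeProj h μ X (𝟙 p) (λ_ μ).inv ≫ idHom C p X

/-- At the index `(𝟙 p, (λ_ μ).inv)` the transpose is `Θ.map (𝟙 p) (λ_ μ).inv` followed by `C_{𝟙 p}
a`, and the former is a unit constraint by axiom (i). -/
lemma cofreeTranspose_counit {Θ : CodexObj C r} (a : Θ.obj μ ⟶ X) :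
    homApp (cofreeTranspose h μ X a) μ ≫ cofreeCounit h μ X = a := by
  rw [cofreeCounit, reassoc_of% (cofreeTranspose_π h μ X a), map_id_eq, idHom_naturality,
    reassoc_of% (id_inv_hom C p)]

/-- Naturality of `b` at `α` trades its component at `ξ` for its component at `μ`. The projection
that then appears is indexed by `𝟙 p ≫ f`, and the left unitor identifies it with the one at `f`. -/
lemma cofreeTranspose_comp_counit {Θ : CodexObj C r} (b : Θ ⟶ cofree h μ X) :
    cofreeTranspose h μ X (homApp b μ ≫ cofreeCounit h μ X) = b := by
  refine hom_ext fun {q} ξ => cofreeProj_hom_ext' h μ X fun f α => ?_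
  rw [cofreeTranspose_π, Functor.map_comp, reassoc_of% (hom_naturality b f α), cofreeCounit,
    Functor.map_comp, reassoc_of% (cofree_map_proj h μ X f α), ← m₂_leftUnitor,
    ← cofreeProj_whisker]
  congr 2
  simp

/-- The cofree objects are values of a right adjoint of the evaluation. -/
noncomputable def cofreeEquiv (Θ : CodexObj C r) :
    ((eval μ).obj Θ ⟶ X) ≃ (Θ ⟶ cofree h μ X) where
  toFun a := cofreeTranspose h μ X a
  invFun b := homApp b μ ≫ cofreeCounit h μ X
  left_inv a := cofreeTranspose_counit h μ X a
  right_inv b := cofreeTranspose_comp_counit h μ X b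

end

end

section

variable {L : Type w} [Bicategory.{w, w} L] {κ : Cardinal.{w}} {C : L ⥤ᵖ LexCat.{w, v, u} κ}

/-- With the bijections `cofreeEquiv` given objectwise, only naturality in `Θ` is needed;
functoriality of `cofree` in `X` is then automatic. -/
lemma isLeftAdjoint_eval (h : CofreeSmall L κ) {p r : L} (μ : p ⟶ r) :
    (eval μ : CodexObj C r ⥤ C.obj p).IsLeftAdjoint := by
  refine (CategoryTheory.Adjunction.adjunctionOfEquivRight (F := eval μ)
    (fun Θ X => cofreeEquiv h μ X Θ) fun Θ' Θ X f g => ?_).isLeftAdjoint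
  have key (a : Θ.obj μ ⟶ X) :
      cofreeTranspose h μ X (homApp f μ ≫ a) = f ≫ cofreeTranspose h μ X a := by
    refine hom_ext fun {q} ξ => cofreeProj_hom_ext' h μ X fun e α => ?_
    rw [cofreeTranspose_π, comp_homApp, Category.assoc, cofreeTranspose_π, Functor.map_comp,
      reassoc_of% (hom_naturality f e α)]
  exact key g

variable (C) in
/-- The evaluations of the objects of `Ĉ_s` at a family of 1-cells. -/
def evalPi {I : Type w} {s : L} {p : I → L} (ξ : ∀ i, p i ⟶ s) :
    CodexObj C s ⥤ ∀ i, C.obj (p i) :=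
  Functor.pi' fun i => eval (ξ i)

/-- The right adjoint sends a family `(X_i)` to the product of the cofree objects on the `X_i`,
which exists because the family has fewer than `κ` members. -/
lemma isLeftAdjoint_evalPi (h : CofreeSmall L κ) {I : Type w} (hI : HasCardinalLT I κ) {s : L}
    {p : I → L} (ξ : ∀ i, p i ⟶ s) : (evalPi C ξ).IsLeftAdjoint := by
  have := fun i => isLeftAdjoint_eval (C := C) h (ξ i)
  have := hasCardinalLimits C s (Discrete I) hI.arrow_discrete
  exact isLeftAdjoint_pi' _

/-- A morphism of `Ĉ_r` is invertible if its components are. -/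
lemma isIso_of_homApp {r : L} {Γ Θ : CodexObj C r} (a : Γ ⟶ Θ)
    (h : ∀ {p : L} (μ : p ⟶ r), IsIso (homApp a μ)) : IsIso a := by
  let b : Θ ⟶ Γ :=
    { app := fun μ => inv (homApp a μ)
      naturality := fun {p q μ ν} f α => by
        rw [IsIso.eq_inv_comp, ← Category.assoc, ← hom_naturality, Category.assoc,
          ← Functor.map_comp, IsIso.hom_inv_id, CategoryTheory.Functor.map_id, Category.comp_id] }
  exact ⟨b, hom_ext fun μ => IsIso.hom_inv_id (homApp a μ),
    hom_ext fun μ => IsIso.inv_hom_id (homApp a μ)⟩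

end
end CodexObj

/-! ### Comonadicity of joint evaluation and the right adjoints of `Ĉ^ϖ` -/

section

variable {L : Type w} [Bicategory.{w, w} L] {κ : Cardinal.{w}}

/-- A 1-cell is encoded by its identity 2-cell. -/
lemma HasCardinalLT.sigma_hom (hL : HasCardinalLT (Σ (p q : L) (f g : p ⟶ q), f ⟶ g) κ) (r : L) :
    HasCardinalLT (Σ p : L, p ⟶ r) κ :=
  hL.of_injective (fun a => ⟨a.1, r, a.2, a.2, 𝟙 a.2⟩) (by
    rintro ⟨p, μ⟩ ⟨p', μ'⟩ h
    cases h
    rfl)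

open CodexObj

variable {C : L ⥤ᵖ LexCat.{w, v, u} κ}

lemma hasCardinalLT_arrow_of_finCategory {J : Type w} [SmallCategory J] [FinCategory J]
    (hκ : κ.IsRegular) : HasCardinalLT (Arrow J) κ :=
  have := (Arrow.finite_iff J).2 ⟨inferInstance⟩
  hasCardinalLT_of_finite _ _ hκ.aleph0_le

/-- The parallel pair is finite, hence `κ`-small; it is lifted to the universe `w` in which the
shapes of `κ`-small limits live. -/
lemma HasCardinalLimits.hasEqualizers {A : Type u} [Category.{v} A] (hκ : κ.IsRegular)
    (h : HasCardinalLimits κ A) : HasEqualizers A := by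
  have := h (ULiftHom.{w} (ULift.{w} WalkingParallelPair))
    (hasCardinalLT_arrow_of_finCategory hκ)
  exact hasLimitsOfShape_of_equivalence (ULiftHomULiftCategory.equiv WalkingParallelPair).symm

lemma PreservesCardinalLimits.preservesEqualizers {A : Type u} [Category.{v} A] {B : Type u₁}
    [Category.{v₁} B] {F : A ⥤ B} (hκ : κ.IsRegular) (h : PreservesCardinalLimits κ F) :
    PreservesLimitsOfShape WalkingParallelPair F := by
  have := h (ULiftHom.{w} (ULift.{w} WalkingParallelPair))
    (hasCardinalLT_arrow_of_finCategory hκ)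
  exact preservesLimitsOfShape_of_equiv (ULiftHomULiftCategory.equiv WalkingParallelPair).symm _

/-- A functor to a product category preserves the limits preserved by its components. -/
lemma preservesLimitsOfShape_pi' {J : Type*} [Category* J] {I : Type*} {A : Type u} [Category.{v} A]
    {B : I → Type u₁} [∀ i, Category.{v₁} (B i)] (F : ∀ i, A ⥤ B i)
    [∀ i, PreservesLimitsOfShape J (F i)] : PreservesLimitsOfShape J (Functor.pi' F) where
  preservesLimit := ⟨fun hc => ⟨
    { lift := fun s i => (isLimitOfPreserves (F i) hc).lift ((Pi.eval B i).mapCone s)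
      fac := fun s j => funext fun i =>
        (isLimitOfPreserves (F i) hc).fac ((Pi.eval B i).mapCone s) j
      uniq := fun s m hm => funext fun i =>
        (isLimitOfPreserves (F i) hc).uniq ((Pi.eval B i).mapCone s) (m i)
          fun j => congrFun (hm j) i }⟩⟩

/-- The restriction functors between co-dextrifications are left adjoints. -/
lemma isLeftAdjoint_restrict (hκ : κ.IsRegular)
    (hL : HasCardinalLT (Σ (p q : L) (f g : p ⟶ q), f ⟶ g) κ) {C : L ⥤ᵖ LexCat.{w, max v w, u} κ}
    {r s : L} (ϖ : r ⟶ s) : (restrict C ϖ).IsLeftAdjoint := by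
  have h := cofreeSmall hκ hL
  let V := evalPi C (fun a : Σ p : L, p ⟶ r => a.2)
  have : V.IsLeftAdjoint := isLeftAdjoint_evalPi h (hL.sigma_hom r) _
  -- By definition, precomposition with `ϖ` followed by joint evaluation is joint evaluation at the
  -- 1-cells `μ ≫ ϖ`.
  have : (restrict C ϖ ⋙ V).IsLeftAdjoint :=
    isLeftAdjoint_evalPi h (hL.sigma_hom r) (fun a : Σ p : L, p ⟶ r => a.2 ≫ ϖ)
  have : V.ReflectsIsomorphisms := ⟨fun {Γ Θ} a ha => isIso_of_homApp a fun {p} μ =>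
    inferInstanceAs (IsIso ((Pi.eval _ (⟨p, μ⟩ : Σ p : L, p ⟶ r)).map (V.map a)))⟩
  have : ∀ r, HasEqualizers (CodexObj C r) := fun r =>
    (hasCardinalLimits C r).hasEqualizers hκ
  have := fun a : Σ p : L, p ⟶ r => (eval_preserves C a.2).preservesEqualizers hκ
  have : PreservesLimitsOfShape WalkingParallelPair V := preservesLimitsOfShape_pi' _
  have : Comonad.PreservesLimitOfIsCoreflexivePair V := ⟨fun _ _ _ _ _ => inferInstance⟩
  -- Crude comonadicity: `V` is a conservative left adjoint that preserves equalizers.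
  let : ComonadicLeftAdjoint V :=
    Comonad.comonadicOfHasPreservesCoreflexiveEqualizersOfReflectsIsomorphisms
      (CategoryTheory.Adjunction.ofIsLeftAdjoint V)
  -- The adjoint triangle theorem: the right adjoint of `Ĉ^ϖ` is an equalizer in `Ĉ_s` of values of
  -- the right adjoint of `restrict C ϖ ⋙ V`.
  exact isLeftAdjoint_triangle_lift_comonadic V

/-- The functors `Ĉ^ϖ` have right adjoints in `Lex_κ`. -/
theorem isLeftAdjoint_codex_map (hκ : κ.IsRegular)
    (hL : HasCardinalLT (Σ (p q : L) (f g : p ⟶ q), f ⟶ g) κ)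
    (C : L ⥤ᵖ LexCat.{w, max v w, max u v w} κ) {X Y : Coop L} (f : X ⟶ Y) :
    IsLeftAdjoint ((codex.{w, v, u} C).map f) :=
  LexCat.isLeftAdjoint_of_functor _ (isLeftAdjoint_restrict.{w, v} hκ hL f.un)

end

/-! ### A right biadjoint from universal arrows -/

namespace BiadjointOfObjwise

section

variable {B : Type u₁} [Bicategory.{w₁, v₁} B] {A : Type u₂} [Bicategory.{w₂, v₂} A] {U : B ⥤ᵖ A}
  {R₀ : A → B} {e : ∀ a, U.obj (R₀ a) ⟶ a}
  (hE : ∀ (b : B) (a : A),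
    (U.mapFunctor b (R₀ a) ⋙ postcomp (U.obj b) (e a)).IsEquivalence)

/-- The 2-cell `h ⟶ h'` corresponding to a 2-cell `U h ≫ e ⟶ U h' ≫ e`. -/
noncomputable def lift {b : B} {a : A} {h h' : b ⟶ R₀ a}
    (t : U.map h ≫ e a ⟶ U.map h' ≫ e a) : h ⟶ h' :=
  have := hE b a
  (U.mapFunctor b (R₀ a) ⋙ postcomp (U.obj b) (e a)).preimage t

lemma lift_spec {b : B} {a : A} {h h' : b ⟶ R₀ a} (t : U.map h ≫ e a ⟶ U.map h' ≫ e a) :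
    U.map₂ (lift hE t) ▷ e a = t :=
  have := hE b a
  (U.mapFunctor b (R₀ a) ⋙ postcomp (U.obj b) (e a)).map_preimage t

/-- Faithfulness of the transposition. Every coherence law of the right biadjoint is tested in this
way, after applying `U` and whiskering with `e`. -/
lemma ext_of_map₂ (hE : ∀ (b : B) (a : A),
    (U.mapFunctor b (R₀ a) ⋙ postcomp (U.obj b) (e a)).IsEquivalence)
    {b : B} {a : A} {h h' : b ⟶ R₀ a} {x y : h ⟶ h'} (hxy : U.map₂ x ▷ e a = U.map₂ y ▷ e a) :
    x = y :=
  have := hE b a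
  (U.mapFunctor b (R₀ a) ⋙ postcomp (U.obj b) (e a)).map_injective hxy

/-- The isomorphism `h ≅ h'` corresponding to an isomorphism `U h ≫ e ≅ U h' ≫ e`. -/
noncomputable def liftIso {b : B} {a : A} {h h' : b ⟶ R₀ a}
    (t : U.map h ≫ e a ≅ U.map h' ≫ e a) : h ≅ h' where
  hom := lift hE t.hom
  inv := lift hE t.inv
  hom_inv_id := ext_of_map₂ hE (by simp [lift_spec])
  inv_hom_id := ext_of_map₂ hE (by simp [lift_spec])

/-- The action of the right biadjoint on 1-cells. -/
noncomputable def map₁ {a a' : A} (f : a ⟶ a') : R₀ a ⟶ R₀ a' :=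
  have := hE (R₀ a) a'
  (U.mapFunctor (R₀ a) (R₀ a') ⋙ postcomp (U.obj (R₀ a)) (e a')).objPreimage (e a ≫ f)

/-- The pseudonaturality isomorphisms of the counit. -/
noncomputable def θ {a a' : A} (f : a ⟶ a') : U.map (map₁ hE f) ≫ e a' ≅ e a ≫ f :=
  have := hE (R₀ a) a'
  (U.mapFunctor (R₀ a) (R₀ a') ⋙ postcomp (U.obj (R₀ a)) (e a')).objObjPreimageIso (e a ≫ f)

/-- The action of the right biadjoint on 2-cells. -/
noncomputable def map₂ {a a' : A} {f g : a ⟶ a'} (η : f ⟶ g) : map₁ hE f ⟶ map₁ hE g :=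
  lift hE ((θ hE f).hom ≫ e a ◁ η ≫ (θ hE g).inv)

/-- Together with `ext_of_map₂` this characterizes `map₂ hE η`; it is also naturality of the counit
in 2-cells. -/
lemma map₂_θ {a a' : A} {f g : a ⟶ a'} (η : f ⟶ g) :
    U.map₂ (map₂ hE η) ▷ e a' ≫ (θ hE g).hom = (θ hE f).hom ≫ e a ◁ η := by
  simp [map₂, lift_spec]

/-- The unit constraint of the right biadjoint. -/
noncomputable def mapId (a : A) : map₁ hE (𝟙 a) ≅ 𝟙 (R₀ a) :=
  liftIso hE (θ hE (𝟙 a) ≪≫ ρ_ (e a) ≪≫ (λ_ (e a)).symm ≪≫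
    whiskerRightIso (U.mapId (R₀ a)).symm (e a))

lemma mapId_spec (a : A) : U.map₂ (mapId hE a).hom ▷ e a ≫ (U.mapId (R₀ a)).hom ▷ e a ≫
    (λ_ (e a)).hom = (θ hE (𝟙 a)).hom ≫ (ρ_ (e a)).hom := by
  simp [mapId, liftIso, lift_spec]

lemma whiskerRight_exchange' {a b c c' d : A} {h h' : a ⟶ b} (x : h ⟶ h') {k : b ⟶ c} {l : c ⟶ d}
    {k' : b ⟶ c'} {l' : c' ⟶ d} (t : k ≫ l ⟶ k' ≫ l') :
    x ▷ k ▷ l ≫ (α_ h' k l).hom ≫ h' ◁ t ≫ (α_ h' k' l').inv =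
      (α_ h k l).hom ≫ h ◁ t ≫ (α_ h k' l').inv ≫ x ▷ k' ▷ l' := by
  rw [associator_naturality_left_assoc, ← whisker_exchange_assoc, associator_inv_naturality_left]

/-- The comparison `U (h ≫ R g) ≫ e ≅ (U h ≫ e) ≫ g`. -/
noncomputable def ψ {b : B} {a a' : A} (h : b ⟶ R₀ a) (g : a ⟶ a') :
    U.map (h ≫ map₁ hE g) ≫ e a' ≅ (U.map h ≫ e a) ≫ g :=
  whiskerRightIso (U.mapComp h (map₁ hE g)) (e a') ≪≫ α_ _ _ _ ≪≫
    whiskerLeftIso (U.map h) (θ hE g) ≪≫ (α_ _ _ _).symm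

/-- The constraint of `U` is natural in `h`, and `θ` acts on the other factor, so interchange moves
`x` past it. This and `ψ_whiskerLeft` serve the two whiskering laws. -/
lemma ψ_naturality {b : B} {a a' : A} {h h' : b ⟶ R₀ a} (x : h ⟶ h') (g : a ⟶ a') :
    U.map₂ (x ▷ map₁ hE g) ▷ e a' ≫ (ψ hE h' g).hom =
      (ψ hE h g).hom ≫ (U.map₂ x ▷ e a) ▷ g := by
  simp only [ψ, Pseudofunctor.map₂_whisker_right, Iso.trans_hom, whiskerRightIso_hom,
    whiskerLeftIso_hom, Iso.symm_hom, comp_whiskerRight, Category.assoc]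
  simp only [← comp_whiskerRight_assoc, Iso.inv_hom_id]
  simp [whiskerRight_exchange']

lemma ψ_whiskerLeft {b : B} {a a' : A} (h : b ⟶ R₀ a) {g g' : a ⟶ a'} (η : g ⟶ g') :
    U.map₂ (h ◁ map₂ hE η) ▷ e a' ≫ (ψ hE h g').hom =
      (ψ hE h g).hom ≫ (U.map h ≫ e a) ◁ η := by
  have := congrArg (U.map h ◁ ·) (map₂_θ hE η)
  simp only [whiskerLeft_comp] at this
  simp [ψ, reassoc_of% this]

/-- The composition constraint of the right biadjoint. -/
noncomputable def mapComp {a b c : A} (f : a ⟶ b) (g : b ⟶ c) :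
    map₁ hE (f ≫ g) ≅ map₁ hE f ≫ map₁ hE g :=
  liftIso hE (θ hE (f ≫ g) ≪≫ (α_ _ _ _).symm ≪≫ whiskerRightIso (θ hE f).symm g ≪≫
    (ψ hE (map₁ hE f) g).symm)

/-- The equation that characterizes the constraint; rearranged, it is the compatibility of the
counit with composition. -/
lemma mapComp_spec {a b c : A} (f : a ⟶ b) (g : b ⟶ c) :
    U.map₂ (mapComp hE f g).hom ▷ e c ≫ (ψ hE (map₁ hE f) g).hom ≫ (θ hE f).hom ▷ g =
      (θ hE (f ≫ g)).hom ≫ (α_ _ _ _).inv := by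
  simp [mapComp, liftIso, lift_spec]

/-- Essentially `mapComp_spec` whiskered by `U h`, up to the constraints of `U`: comparing along `f
≫ g` agrees with comparing along `g` and then `f`. It carries the associativity law. -/
lemma ψ_comp {b : B} {a a' a'' : A} (h : b ⟶ R₀ a) (f : a ⟶ a') (g : a' ⟶ a'') :
    U.map₂ (h ◁ (mapComp hE f g).hom) ▷ e a'' ≫ U.map₂ (α_ h (map₁ hE f) (map₁ hE g)).inv ▷ e a'' ≫
      (ψ hE (h ≫ map₁ hE f) g).hom ≫ (ψ hE h f).hom ▷ g =
        (ψ hE h (f ≫ g)).hom ≫ (α_ _ _ _).inv := by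
  have h1 := congrArg (U.map h ◁ ·) (mapComp_spec hE f g)
  have h2 : U.map₂ (α_ h (map₁ hE f) (map₁ hE g)).inv = (U.mapComp h _).hom ≫
      U.map h ◁ (U.mapComp _ _).hom ≫ (α_ _ _ _).inv ≫ (U.mapComp h _).inv ▷ _ ≫
        (U.mapComp _ _).inv := by
    rw [← cancel_epi (U.map₂ (α_ h (map₁ hE f) (map₁ hE g)).hom), ← U.map₂_comp]
    simp
  -- The constraint of `U` and its inverse sit on either side of `θ hE g`, which acts on a different
  -- factor; interchange brings them together so that they cancel.
  have h3 : (U.mapComp h (map₁ hE f)).inv ▷ _ ▷ _ ≫ (α_ _ _ _).hom ≫ _ ◁ (θ hE g).hom ≫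
      (α_ _ _ _).inv ≫ (U.mapComp h (map₁ hE f)).hom ▷ _ ▷ _ = (α_ _ _ _).hom ≫
        _ ◁ (θ hE g).hom ≫ (α_ _ _ _).inv := by
    rw [← whiskerRight_exchange', ← comp_whiskerRight_assoc, ← comp_whiskerRight]
    simp
  simp only [ψ, Iso.trans_hom, whiskerRightIso_hom, whiskerLeftIso_hom, Iso.symm_hom,
    whiskerLeft_comp, Category.assoc] at h1
  rw [h2]
  simp only [ψ, Iso.trans_hom, whiskerRightIso_hom, whiskerLeftIso_hom, Iso.symm_hom,
    Pseudofunctor.map₂_whisker_left, comp_whiskerRight, Category.assoc,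
    inv_hom_whiskerRight_assoc]
  rw [reassoc_of% h3]
  calc
    _ = (U.mapComp h (map₁ hE (f ≫ g))).hom ▷ e a'' ≫ (α_ _ _ _).hom ≫
        (U.map h ◁ U.map₂ (mapComp hE f g).hom ▷ e a'' ≫
      U.map h ◁ (U.mapComp (map₁ hE f) (map₁ hE g)).hom ▷ e a'' ≫
        U.map h ◁ (α_ (U.map (map₁ hE f)) (U.map (map₁ hE g)) (e a'')).hom ≫
          U.map h ◁ U.map (map₁ hE f) ◁ (θ hE g).hom ≫
            U.map h ◁ (α_ (U.map (map₁ hE f)) (e a') g).inv ≫ U.map h ◁ (θ hE f).hom ▷ g) ⊗≫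
        𝟙 _ := by bicategory
    _ = _ := by
      rw [h1]
      bicategory

lemma ψ_leftUnitor {a a' : A} (g : a ⟶ a') :
    U.map₂ (λ_ (map₁ hE g)).hom ▷ e a' ≫ (θ hE g).hom =
      (ψ hE (𝟙 (R₀ a)) g).hom ≫ ((U.mapId (R₀ a)).hom ▷ e a) ▷ g ≫ (λ_ (e a)).hom ▷ g := by
  simp only [ψ, Iso.trans_hom, whiskerRightIso_hom, whiskerLeftIso_hom, Iso.symm_hom,
    Pseudofunctor.map₂_left_unitor, comp_whiskerRight, Category.assoc]
  rw [← reassoc_of% (whiskerRight_exchange' (U.mapId (R₀ a)).hom (θ hE g).hom)]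
  congr 2
  bicategory

lemma ψ_rightUnitor {b : B} {a : A} (h : b ⟶ R₀ a) :
    U.map₂ (h ◁ (mapId hE a).hom) ▷ e a ≫ U.map₂ (ρ_ h).hom ▷ e a =
      (ψ hE h (𝟙 a)).hom ≫ (ρ_ _).hom := by
  have h1 := congrArg (U.map h ◁ ·) (mapId_spec hE a)
  simp only [whiskerLeft_comp] at h1
  simp only [ψ, Iso.trans_hom, whiskerRightIso_hom, whiskerLeftIso_hom, Iso.symm_hom,
    Pseudofunctor.map₂_whisker_left, Pseudofunctor.map₂_right_unitor, comp_whiskerRight,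
    Category.assoc, inv_hom_whiskerRight_assoc]
  calc
    _ = (U.mapComp h (map₁ hE (𝟙 a))).hom ▷ e a ≫ (α_ _ _ _).hom ≫
        (U.map h ◁ U.map₂ (mapId hE a).hom ▷ e a ≫ U.map h ◁ (U.mapId (R₀ a)).hom ▷ e a ≫
          U.map h ◁ (λ_ (e a)).hom) := by bicategory
    _ = _ := by
      rw [h1]
      bicategory

/-- The right biadjoint. -/
noncomputable def rightBiadjointFunctor : A ⥤ᵖ B where
  obj := R₀
  map f := map₁ hE f
  map₂ η := map₂ hE η
  map₂_id f := ext_of_map₂ hE (by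
    rw [← cancel_mono (θ hE f).hom, map₂_θ]
    simp)
  map₂_comp {_ _ f g h} η η' := ext_of_map₂ hE (by
    rw [← cancel_mono (θ hE h).hom, map₂_θ, U.map₂_comp, comp_whiskerRight, Category.assoc,
      map₂_θ, reassoc_of% (map₂_θ hE η), whiskerLeft_comp])
  mapId a := mapId hE a
  mapComp f g := mapComp hE f g
  map₂_whisker_left {a b c} f g h η := by
    -- Postcomposition with invertible constraints first clears the inverses. After passing to `A`,
    -- cancelling `ψ` and `θ` lets the characterizing equations apply.
    rw [← cancel_mono (mapComp hE f h).hom]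
    simp only [Category.assoc, Iso.inv_hom_id, Category.comp_id]
    apply ext_of_map₂ hE
    rw [← cancel_mono (ψ hE (map₁ hE f) h).hom, ← cancel_mono ((θ hE f).hom ▷ h)]
    simp only [U.map₂_comp, comp_whiskerRight, Category.assoc]
    rw [mapComp_spec, reassoc_of% (map₂_θ hE (f ◁ η)), reassoc_of% (ψ_whiskerLeft hE),
      whisker_exchange, reassoc_of% (mapComp_spec hE f g)]
    simp
  map₂_whisker_right {a b c f g} η h := by
    rw [← cancel_mono (mapComp hE g h).hom]
    simp only [Category.assoc, Iso.inv_hom_id, Category.comp_id]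
    apply ext_of_map₂ hE
    rw [← cancel_mono (ψ hE (map₁ hE g) h).hom, ← cancel_mono ((θ hE g).hom ▷ h)]
    simp only [U.map₂_comp, comp_whiskerRight, Category.assoc]
    rw [mapComp_spec, reassoc_of% (map₂_θ hE (η ▷ h)), reassoc_of% (ψ_naturality hE),
      ← comp_whiskerRight, map₂_θ, comp_whiskerRight, reassoc_of% (mapComp_spec hE f h)]
    simp
  map₂_associator {a b c d} f g h := by
    rw [← cancel_mono (mapComp hE f (g ≫ h)).hom, ← cancel_mono (map₁ hE f ◁ (mapComp hE g h).hom),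
      ← cancel_mono (α_ (map₁ hE f) (map₁ hE g) (map₁ hE h)).inv]
    simp only [Category.assoc, Iso.inv_hom_id_assoc, whiskerLeft_inv_hom_assoc, Iso.hom_inv_id,
      Category.comp_id]
    apply ext_of_map₂ hE
    -- These three isomorphisms remove `h`, `g` and `f` in turn from under the right biadjoint,
    -- leaving a coherence identity in `A`.
    rw [← cancel_mono (ψ hE (map₁ hE f ≫ map₁ hE g) h).hom,
      ← cancel_mono ((ψ hE (map₁ hE f) g).hom ▷ h), ← cancel_mono ((θ hE f).hom ▷ g ▷ h)]
    simp only [U.map₂_comp, comp_whiskerRight, Category.assoc]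
    have h1 := reassoc_of% (ψ_comp hE (map₁ hE f) g h)
    have h2 := congrArg (· ▷ h) (mapComp_spec hE f g)
    simp only [comp_whiskerRight] at h2
    rw [h1, ← associator_inv_naturality_left, reassoc_of% (mapComp_spec hE f (g ≫ h)),
      reassoc_of% (map₂_θ hE (α_ f g h).hom), reassoc_of% (ψ_naturality hE), h2,
      reassoc_of% (mapComp_spec hE (f ≫ g) h)]
    bicategory
  map₂_left_unitor {a b} f := by
    apply ext_of_map₂ hE
    have h1 := congrArg (· ▷ f) (mapId_spec hE a)
    simp only [comp_whiskerRight] at h1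
    rw [← cancel_mono (θ hE f).hom, map₂_θ]
    simp only [U.map₂_comp, comp_whiskerRight, Category.assoc]
    rw [ψ_leftUnitor, reassoc_of% (ψ_naturality hE), h1, reassoc_of% (mapComp_spec hE (𝟙 a) f)]
    bicategory
  map₂_right_unitor {a b} f := by
    apply ext_of_map₂ hE
    rw [← cancel_mono (θ hE f).hom, map₂_θ]
    simp only [U.map₂_comp, comp_whiskerRight, Category.assoc]
    rw [reassoc_of% (ψ_rightUnitor hE), ← rightUnitor_naturality,
      reassoc_of% (mapComp_spec hE f (𝟙 b))]
    bicategory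

/-- The counit of the right biadjoint. -/
noncomputable def counit : (rightBiadjointFunctor hE).comp U ⟶ Pseudofunctor.id A where
  app a := e a
  naturality f := θ hE f
  naturality_naturality η := map₂_θ hE η
  naturality_id a := by
    have h1 : (θ hE (𝟙 a)).hom ≫ e a ◁ 𝟙 _ = (U.map₂ (mapId hE a).hom ≫ (U.mapId (R₀ a)).hom) ▷ e a ≫
        (λ_ (e a)).hom ≫ (ρ_ (e a)).inv := by
      rw [comp_whiskerRight, Category.assoc, reassoc_of% (mapId_spec hE a)]
      simp
    exact h1
  naturality_comp {a b c} f g := by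
    have h1 : (θ hE (f ≫ g)).hom ≫ e a ◁ 𝟙 _ =
        (U.map₂ (mapComp hE f g).hom ≫ (U.mapComp (map₁ hE f) (map₁ hE g)).hom) ▷ e c ≫
          (α_ _ _ _).hom ≫ U.map (map₁ hE f) ◁ (θ hE g).hom ≫ (α_ _ _ _).inv ≫
            (θ hE f).hom ▷ g ≫ (α_ _ _ _).hom := by
      have h2 := (mapComp_spec hE f g) =≫ (α_ _ _ _).hom
      simp only [ψ, Iso.trans_hom, whiskerRightIso_hom, whiskerLeftIso_hom, Iso.symm_hom,
        Category.assoc, Iso.inv_hom_id, Category.comp_id] at h2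
      simp [h2]
    exact h1

end

end BiadjointOfObjwise

/-- A right biadjoint from objectwise equivalences. -/
noncomputable def RightBiadjoint.ofObjwise {B : Type u₁} [Bicategory.{w₁, v₁} B] {A : Type u₂}
    [Bicategory.{w₂, v₂} A] {U : B ⥤ᵖ A} {R₀ : A → B} {e : ∀ a, U.obj (R₀ a) ⟶ a}
    (hE : ∀ (b : B) (a : A),
      (U.mapFunctor b (R₀ a) ⋙ postcomp (U.obj b) (e a)).IsEquivalence) :
    RightBiadjoint U where
  R := BiadjointOfObjwise.rightBiadjointFunctor hE
  counit := BiadjointOfObjwise.counit hE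
  isEquivalence b a := hE b a

/-! ### Colax transformations out of `U D` in terms of the left adjoints -/

section

variable {K : Type u₂} [Bicategory.{w₂, v₂} K]

lemma homEquiv₁_precomp {a b c : K} {l : b ⟶ c} {r : c ⟶ b} (adj : Adjunction l r) {g g' : b ⟶ a}
    {h : c ⟶ a} (m : g ⟶ g') (β : g' ⟶ l ≫ h) :
    adj.homEquiv₁ (m ≫ β) = r ◁ m ≫ adj.homEquiv₁ β := by
  simp [Bicategory.Adjunction.homEquiv₁_apply]

/-- Pasting a mate with a transpose introduces the unit and the counit of `adj₂`; interchange brings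
them next to each other, and a triangle identity removes them. This yields the transposed cells of
`rightTrans F ≫ G`. -/
lemma homEquiv₁_mateEquiv {a b c d e : K} {l₁ : a ⟶ b} {r₁ : b ⟶ a} {l₂ : c ⟶ d} {r₂ : d ⟶ c}
    (adj₁ : Adjunction l₁ r₁) (adj₂ : Adjunction l₂ r₂) {g : a ⟶ c} {h : b ⟶ d}
    (β : g ≫ l₂ ⟶ l₁ ≫ h) {k : c ⟶ e} {m : d ⟶ e} (τ : k ⟶ l₂ ≫ m) :
    adj₁.homEquiv₁ (g ◁ τ ≫ (α_ _ _ _).inv ≫ β ▷ m ≫ (α_ _ _ _).hom) =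
      (α_ _ _ _).inv ≫ Bicategory.mateEquiv adj₁ adj₂ β ▷ k ≫ (α_ _ _ _).hom ≫
        h ◁ adj₂.homEquiv₁ τ := by
  rw [Bicategory.Adjunction.homEquiv₁_apply, Bicategory.Adjunction.homEquiv₁_apply, mateEquiv_apply']
  symm
  calc
    _ = 𝟙 _ ⊗≫ r₁ ◁ g ◁ adj₂.unit ▷ k ⊗≫ r₁ ◁ β ▷ r₂ ▷ k ⊗≫ adj₁.counit ▷ h ▷ r₂ ▷ k ⊗≫
        h ◁ r₂ ◁ τ ⊗≫ h ◁ adj₂.counit ▷ m ⊗≫ 𝟙 _ := by bicategory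
    _ = 𝟙 _ ⊗≫ r₁ ◁ g ◁ adj₂.unit ▷ k ⊗≫ r₁ ◁ β ▷ r₂ ▷ k ⊗≫
        (adj₁.counit ▷ (h ≫ r₂ ≫ k) ≫ 𝟙 b ◁ (h ◁ r₂ ◁ τ ≫ h ◁ (α_ r₂ l₂ m).inv ≫
          h ◁ adj₂.counit ▷ m)) ⊗≫ 𝟙 _ := by bicategory
    _ = 𝟙 _ ⊗≫ r₁ ◁ g ◁ adj₂.unit ▷ k ⊗≫ r₁ ◁ (β ▷ (r₂ ≫ k) ≫
          (l₁ ≫ h) ◁ (r₂ ◁ τ ≫ (α_ r₂ l₂ m).inv ≫ adj₂.counit ▷ m)) ⊗≫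
          adj₁.counit ▷ h ▷ m ⊗≫ 𝟙 _ := by
      rw [← whisker_exchange]
      bicategory
    _ = 𝟙 _ ⊗≫ r₁ ◁ g ◁ (adj₂.unit ▷ k ≫ (l₂ ≫ r₂) ◁ τ) ⊗≫ r₁ ◁ g ◁ l₂ ◁ adj₂.counit ▷ m ⊗≫
          r₁ ◁ β ▷ m ⊗≫ adj₁.counit ▷ h ▷ m ⊗≫ 𝟙 _ := by
      rw [← whisker_exchange]
      bicategory
    _ = 𝟙 _ ⊗≫ r₁ ◁ g ◁ τ ⊗≫ r₁ ◁ g ◁ (leftZigzag adj₂.unit adj₂.counit ▷ m) ⊗≫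
          r₁ ◁ β ▷ m ⊗≫ adj₁.counit ▷ h ▷ m ⊗≫ 𝟙 _ := by
      rw [← whisker_exchange, leftZigzag]
      bicategory
    _ = _ := by
      rw [adj₂.left_triangle]
      bicategory

variable {L : Type u₁} [Bicategory.{w₁, v₁} L] {D : AdjPseudofunctor L K} {C : L ⥤ᵖ K}

/-- The components of a colax natural transformation out of a pseudofunctor of right adjoints. -/
def colaxApp (G : D.rightPs.toOplax ⟶ C.toOplax) (p : L) : D.toPs.obj ⟨p⟩ ⟶ C.obj p := G.app p

/-- The 2-cells of a colax natural transformation out of a pseudofunctor of right adjoints. -/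
def colaxCell (G : D.rightPs.toOplax ⟶ C.toOplax) {p q : L} (f : p ⟶ q) :
    D.radj (Coop.mk₁ f) ≫ colaxApp G q ⟶ colaxApp G p ≫ C.map f := G.naturality f

/-- The transposes `G_q ⟶ D^f ≫ G_p ≫ C_f` of the 2-cells of a colax natural transformation. -/
noncomputable def cell (G : D.rightPs.toOplax ⟶ C.toOplax) {p q : L} (f : p ⟶ q) :
    colaxApp G q ⟶ D.toPs.map (Coop.mk₁ f) ≫ colaxApp G p ≫ C.map f :=
  (D.adj (Coop.mk₁ f)).homEquiv₁.symm (colaxCell G f)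

lemma homEquiv₁_cell (G : D.rightPs.toOplax ⟶ C.toOplax) {p q : L} (f : p ⟶ q) :
    (D.adj (Coop.mk₁ f)).homEquiv₁ (cell G f) = colaxCell G f :=
  Equiv.apply_symm_apply _ _

/-- Transposition is injective and takes the conjugate of `D^a` to whiskering with `D^a` itself.
This law, `cell_id` and `cell_comp` are the hypotheses of `colaxOfCells`, so transposed cells carry
the same information as colax cells. -/
lemma cell_naturality (G : D.rightPs.toOplax ⟶ C.toOplax) {p q : L} {f g : p ⟶ q} (a : f ⟶ g) :
    cell G f ≫ D.toPs.map (Coop.mk₁ f) ◁ colaxApp G p ◁ C.map₂ a =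
      cell G g ≫ D.toPs.map₂ (Coop.mk₂ a) ▷ (colaxApp G p ≫ C.map g) := by
  apply (D.adj (Coop.mk₁ f)).homEquiv₁.injective
  rw [homEquiv₁_comp, ← conjugateEquiv_homEquiv₁ _ (D.adj (Coop.mk₁ g)), homEquiv₁_cell,
    homEquiv₁_cell]
  exact (G.naturality_naturality a).symm

lemma cell_id (G : D.rightPs.toOplax ⟶ C.toOplax) (p : L) :
    cell G (𝟙 p) ≫ D.toPs.map (𝟙 (⟨p⟩ : Coop L)) ◁ colaxApp G p ◁ (C.mapId p).hom =
      ((λ_ (colaxApp G p)).inv ≫ 𝟙 _ ◁ (ρ_ (colaxApp G p)).inv) ≫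
        (D.toPs.mapId ⟨p⟩).inv ▷ (colaxApp G p ≫ 𝟙 (C.obj p)) := by
  apply (D.adj (𝟙 (⟨p⟩ : Coop L))).homEquiv₁.injective
  rw [← conjugateEquiv_homEquiv₁ _ (Adjunction.id _), homEquiv₁_id]
  refine (homEquiv₁_comp (D.adj (𝟙 (⟨p⟩ : Coop L))) (cell G (𝟙 p))
    (colaxApp G p ◁ (C.mapId p).hom)).trans ?_
  refine (congrArg (· ≫ _) (homEquiv₁_cell G (𝟙 p))).trans ((G.naturality_id p).trans ?_)
  refine congrArg (conjugateEquiv (D.adj (𝟙 (⟨p⟩ : Coop L))) (Adjunction.id _)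
    (D.toPs.mapId ⟨p⟩).inv ▷ colaxApp G p ≫ ·) ?_
  change (λ_ (colaxApp G p)).hom ≫ (ρ_ (colaxApp G p)).inv = _
  bicategory

lemma cell_comp (G : D.rightPs.toOplax ⟶ C.toOplax) {p q r : L} (f : p ⟶ q) (g : q ⟶ r) :
    cell G (f ≫ g) ≫ D.toPs.map (Coop.mk₁ g ≫ Coop.mk₁ f) ◁ colaxApp G p ◁ (C.mapComp f g).hom =
      ((cell G g ≫ D.toPs.map (Coop.mk₁ g) ◁ (cell G f ▷ C.map g ≫
        (α_ _ (colaxApp G p ≫ C.map f) _).hom) ≫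
          (α_ _ _ ((colaxApp G p ≫ C.map f) ≫ C.map g)).inv) ≫
            _ ◁ (α_ (colaxApp G p) (C.map f) (C.map g)).hom) ≫
              (D.toPs.mapComp (Coop.mk₁ g) (Coop.mk₁ f)).inv ▷
                (colaxApp G p ≫ C.map f ≫ C.map g) := by
  apply (D.adj (Coop.mk₁ g ≫ Coop.mk₁ f)).homEquiv₁.injective
  rw [← conjugateEquiv_homEquiv₁ _ ((D.adj (Coop.mk₁ g)).comp (D.adj (Coop.mk₁ f)))]
  refine (homEquiv₁_comp (D.adj (Coop.mk₁ g ≫ Coop.mk₁ f)) (cell G (f ≫ g))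
    (colaxApp G p ◁ (C.mapComp f g).hom)).trans ?_
  refine (congrArg (· ≫ _) (homEquiv₁_cell G (f ≫ g))).trans ((G.naturality_comp f g).trans ?_)
  refine congrArg (conjugateEquiv (D.adj (Coop.mk₁ g ≫ Coop.mk₁ f))
    ((D.adj (Coop.mk₁ g)).comp (D.adj (Coop.mk₁ f)))
      (D.toPs.mapComp (Coop.mk₁ g) (Coop.mk₁ f)).inv ▷ colaxApp G r ≫ ·) ?_
  rw [homEquiv₁_comp, homEquiv₁_comp_adj, homEquiv₁_cell, homEquiv₁_cell]
  simp only [Category.assoc]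
  rfl

/-- Modifications in terms of the transposed 2-cells. -/
lemma modification_iff_cell {G G' : D.rightPs.toOplax ⟶ C.toOplax} {p q : L} (f : p ⟶ q)
    (n : colaxApp G p ⟶ colaxApp G' p) (n' : colaxApp G q ⟶ colaxApp G' q) :
    D.radj (Coop.mk₁ f) ◁ n' ≫ colaxCell G' f = colaxCell G f ≫ n ▷ C.map f ↔
      n' ≫ cell G' f = cell G f ≫ D.toPs.map (Coop.mk₁ f) ◁ (n ▷ C.map f) := by
  rw [← (D.adj (Coop.mk₁ f)).homEquiv₁.apply_eq_iff_eq, homEquiv₁_precomp, homEquiv₁_comp,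
    homEquiv₁_cell, homEquiv₁_cell]

/-- The transposed 2-cells of a composite `rightTrans F ≫ G`. -/
lemma cell_rightTrans_comp {E : AdjPseudofunctor L K} (F : D.toPs ⟶ E.toPs)
    (G : E.rightPs.toOplax ⟶ C.toOplax) {p q : L} (f : p ⟶ q) :
    cell (rightTrans F ≫ G) f = (F.app ⟨q⟩ ◁ cell G f ≫ (α_ _ _ _).inv ≫
      (F.naturality (Coop.mk₁ f)).inv ▷ (colaxApp G p ≫ C.map f) ≫ (α_ _ _ _).hom) ≫
        D.toPs.map (Coop.mk₁ f) ◁ (α_ (F.app ⟨p⟩) (colaxApp G p) (C.map f)).inv := by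
  apply (D.adj (Coop.mk₁ f)).homEquiv₁.injective
  refine (homEquiv₁_cell _ _).trans (Eq.trans ?_ (homEquiv₁_comp (D.adj (Coop.mk₁ f))
    (F.app ⟨q⟩ ◁ cell G f ≫ (α_ _ _ _).inv ≫ (F.naturality (Coop.mk₁ f)).inv ▷
      (colaxApp G p ≫ C.map f) ≫ (α_ _ _ _).hom)
    (α_ (F.app ⟨p⟩) (colaxApp G p) (C.map f)).inv).symm)
  rw [homEquiv₁_mateEquiv (D.adj (Coop.mk₁ f)) (E.adj (Coop.mk₁ f)), homEquiv₁_cell]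
  simp only [Category.assoc]
  rfl

end

/-! ### Componentwise calculus of pseudofunctors on `Lᶜᵒᵒᵖ` -/

namespace CoopPs

section

variable {L : Type u₁} [Bicategory.{w₁, v₁} L] {κ : Cardinal.{w}}
  (P : Coop L ⥤ᵖ LexCat.{w, v, u} κ)

/-- The functor `P^f` underlying the image of a 1-cell of `L`. -/
abbrev up {p q : L} (f : p ⟶ q) : P.obj ⟨q⟩ ⥤ P.obj ⟨p⟩ := lexMap P (Coop.mk₁ f)

/-- The components of the contravariant action of a 2-cell of `L`. -/
def up₂ {p q : L} {f g : p ⟶ q} (γ : f ⟶ g) (X : P.obj ⟨q⟩) : (up P g).obj X ⟶ (up P f).obj X :=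
  m₂ P (Coop.mk₂ γ) X

/-- The components of the unit constraint. -/
def upId (p : L) (X : P.obj ⟨p⟩) : (up P (𝟙 p)).obj X ⟶ X := idHom P ⟨p⟩ X

/-- The components of the inverse of the unit constraint. -/
def upIdInv (p : L) (X : P.obj ⟨p⟩) : X ⟶ (up P (𝟙 p)).obj X := idInv P ⟨p⟩ X

/-- The components of the composition constraint. -/
def upComp {p q r : L} (f : p ⟶ q) (g : q ⟶ r) (X : P.obj ⟨r⟩) :
    (up P (f ≫ g)).obj X ⟶ (up P f).obj ((up P g).obj X) :=
  compHom P (Coop.mk₁ g) (Coop.mk₁ f) X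

/-- The components of the inverse of the composition constraint. -/
def upCompInv {p q r : L} (f : p ⟶ q) (g : q ⟶ r) (X : P.obj ⟨r⟩) :
    (up P f).obj ((up P g).obj X) ⟶ (up P (f ≫ g)).obj X :=
  compInv P (Coop.mk₁ g) (Coop.mk₁ f) X

@[simp] lemma upIdInv_id (p : L) (X : P.obj ⟨p⟩) : upIdInv P p X ≫ upId P p X = 𝟙 _ :=
  id_inv_hom P _ X

@[simp] lemma upComp_inv {p q r : L} (f : p ⟶ q) (g : q ⟶ r) (X : P.obj ⟨r⟩) :
    upComp P f g X ≫ upCompInv P f g X = 𝟙 _ := comp_hom_inv P _ _ X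

@[simp] lemma upCompInv_comp {p q r : L} (f : p ⟶ q) (g : q ⟶ r) (X : P.obj ⟨r⟩) :
    upCompInv P f g X ≫ upComp P f g X = 𝟙 _ := comp_inv_hom P _ _ X

@[simp] lemma upCompInv_comp_assoc {p q r : L} (f : p ⟶ q) (g : q ⟶ r) (X : P.obj ⟨r⟩)
    {Z : P.obj ⟨p⟩} (k : _ ⟶ Z) : upCompInv P f g X ≫ upComp P f g X ≫ k = k := by
  rw [← Category.assoc, upCompInv_comp, Category.id_comp]

@[simp] lemma upComp_inv_assoc {p q r : L} (f : p ⟶ q) (g : q ⟶ r) (X : P.obj ⟨r⟩)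
    {Z : P.obj ⟨p⟩} (k : _ ⟶ Z) : upComp P f g X ≫ upCompInv P f g X ≫ k = k := by
  rw [← Category.assoc, upComp_inv, Category.id_comp]

lemma up₂_comp {p q : L} {f g h : p ⟶ q} (γ : f ⟶ g) (δ : g ⟶ h) (X : P.obj ⟨q⟩) :
    up₂ P (γ ≫ δ) X = up₂ P δ X ≫ up₂ P γ X :=
  m₂_comp P (Coop.mk₂ δ) (Coop.mk₂ γ) X

lemma up₂_naturality {p q : L} {f g : p ⟶ q} (γ : f ⟶ g) {X Y : P.obj ⟨q⟩} (k : X ⟶ Y) :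
    (up P g).map k ≫ up₂ P γ Y = up₂ P γ X ≫ (up P f).map k :=
  m₂_naturality P (Coop.mk₂ γ) k

lemma upCompInv_naturality {p q r : L} (f : p ⟶ q) (g : q ⟶ r) {X Y : P.obj ⟨r⟩} (k : X ⟶ Y) :
    (up P f).map ((up P g).map k) ≫ upCompInv P f g Y = upCompInv P f g X ≫ (up P (f ≫ g)).map k :=
  compInv_naturality P _ _ k

/-- Reversing 1-cells exchanges the two whiskerings, and likewise the two unitors. -/
lemma upComp_whiskerRight {p q r : L} {f f' : p ⟶ q} (γ : f ⟶ f') (g : q ⟶ r) (X : P.obj ⟨r⟩) :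
    up₂ P (γ ▷ g) X ≫ upComp P f g X = upComp P f' g X ≫ up₂ P γ ((up P g).obj X) :=
  compHom_whiskerLeft P (Coop.mk₁ g) (Coop.mk₂ γ) X

lemma upComp_whiskerLeft {p q r : L} (f : p ⟶ q) {g g' : q ⟶ r} (γ : g ⟶ g') (X : P.obj ⟨r⟩) :
    up₂ P (f ◁ γ) X ≫ upComp P f g X = upComp P f g' X ≫ (up P f).map (up₂ P γ X) :=
  compHom_whiskerRight P (Coop.mk₂ γ) (Coop.mk₁ f) X

lemma upCompInv_whiskerRight {p q r : L} {f f' : p ⟶ q} (γ : f ⟶ f') (g : q ⟶ r) (X : P.obj ⟨r⟩) :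
    upCompInv P f' g X ≫ up₂ P (γ ▷ g) X = up₂ P γ ((up P g).obj X) ≫ upCompInv P f g X := by
  have h := congrArg (fun k => upCompInv P f' g X ≫ k ≫ upCompInv P f g X)
    (upComp_whiskerRight P γ g X)
  simpa using h

lemma upCompInv_whiskerLeft {p q r : L} (f : p ⟶ q) {g g' : q ⟶ r} (γ : g ⟶ g') (X : P.obj ⟨r⟩) :
    upCompInv P f g' X ≫ up₂ P (f ◁ γ) X = (up P f).map (up₂ P γ X) ≫ upCompInv P f g X := by
  have h := congrArg (fun k => upCompInv P f g' X ≫ k ≫ upCompInv P f g X)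
    (upComp_whiskerLeft P f γ X)
  simpa using h

lemma upComp_associator {p q r s : L} (f : p ⟶ q) (g : q ⟶ r) (h : r ⟶ s) (X : P.obj ⟨s⟩) :
    up₂ P (α_ f g h).hom X ≫ upComp P (f ≫ g) h X ≫ upComp P f g ((up P h).obj X) =
      upComp P f (g ≫ h) X ≫ (up P f).map (upComp P g h X) :=
  compHom_associator P (Coop.mk₁ h) (Coop.mk₁ g) (Coop.mk₁ f) X

lemma map_upComp_inv {p q r s : L} (f : p ⟶ q) (g : q ⟶ r) (h : r ⟶ s) (X : P.obj ⟨s⟩) :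
    (up P f).map (upCompInv P g h X) ≫ (up P f).map (upComp P g h X) = 𝟙 _ := by
  rw [← Functor.map_comp, upCompInv_comp, CategoryTheory.Functor.map_id]

lemma upCompInv_associator {p q r s : L} (f : p ⟶ q) (g : q ⟶ r) (h : r ⟶ s) (X : P.obj ⟨s⟩) :
    (up P f).map (upCompInv P g h X) ≫ upCompInv P f (g ≫ h) X ≫ up₂ P (α_ f g h).hom X =
      upCompInv P f g ((up P h).obj X) ≫ upCompInv P (f ≫ g) h X := by
  have h1 := congrArg (fun k => (up P f).map (upCompInv P g h X) ≫ upCompInv P f (g ≫ h) X ≫ k ≫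
    upCompInv P f g ((up P h).obj X) ≫ upCompInv P (f ≫ g) h X) (upComp_associator P f g h X)
  simp only [Category.assoc, upComp_inv_assoc, upComp_inv, Category.comp_id,
    upCompInv_comp_assoc] at h1
  rw [h1, reassoc_of% (map_upComp_inv P f g h X)]

lemma up₂_rightUnitor_inv {p q : L} (f : p ⟶ q) (X : P.obj ⟨q⟩) :
    up₂ P (ρ_ f).inv X = upComp P f (𝟙 q) X ≫ (up P f).map (upId P q X) :=
  m₂_leftUnitor P (Coop.mk₁ f) X

lemma up₂_leftUnitor_inv {p q : L} (f : p ⟶ q) (X : P.obj ⟨q⟩) :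
    up₂ P (λ_ f).inv X = upComp P (𝟙 p) f X ≫ upId P p ((up P f).obj X) :=
  m₂_rightUnitor P (Coop.mk₁ f) X

/-- The morphism `P^f (P^ν X) ⟶ P^μ X` induced by a 2-cell `μ ⟶ f ≫ ν`. -/
def upTri {p q r : L} {μ : p ⟶ r} {ν : q ⟶ r} (f : p ⟶ q) (α : μ ⟶ f ≫ ν) (X : P.obj ⟨r⟩) :
    (up P f).obj ((up P ν).obj X) ⟶ (up P μ).obj X :=
  upCompInv P f ν X ≫ up₂ P α X

lemma upTri_naturality {p q r : L} {μ : p ⟶ r} {ν : q ⟶ r} (f : p ⟶ q) (α : μ ⟶ f ≫ ν)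
    {X Y : P.obj ⟨r⟩} (k : X ⟶ Y) :
    (up P f).map ((up P ν).map k) ≫ upTri P f α Y = upTri P f α X ≫ (up P μ).map k := by
  rw [upTri, upTri, reassoc_of% (upCompInv_naturality P f ν k), up₂_naturality, Category.assoc]

lemma upTri_precomp {p q r : L} {μ μ' : p ⟶ r} {ν : q ⟶ r} (f : p ⟶ q) (γ : μ' ⟶ μ)
    (α : μ ⟶ f ≫ ν) (X : P.obj ⟨r⟩) : upTri P f (γ ≫ α) X = upTri P f α X ≫ up₂ P γ X := by
  rw [upTri, upTri, up₂_comp, Category.assoc]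

lemma upTri_id {p r : L} (μ : p ⟶ r) (X : P.obj ⟨r⟩) :
    upTri P (𝟙 p) (λ_ μ).inv X = upId P p ((up P μ).obj X) := by
  rw [upTri, up₂_leftUnitor_inv, upCompInv_comp_assoc]

/-- Triangles `μ ⟶ f ≫ ν` paste functorially. With `upTri_id` and `upTri_whisker`, this is the part
of the axioms of a co-dextrification object that the lift takes from `D`. -/
lemma upTri_comp {p q s r : L} {μ : p ⟶ r} {ν : q ⟶ r} {ξ : s ⟶ r} (f : p ⟶ q) (g : q ⟶ s)
    (α : μ ⟶ f ≫ ν) (β : ν ⟶ g ≫ ξ) (X : P.obj ⟨r⟩) :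
    upTri P (f ≫ g) (α ≫ f ◁ β ≫ (α_ f g ξ).inv) X =
      upComp P f g ((up P ξ).obj X) ≫ (up P f).map (upTri P g β X) ≫ upTri P f α X := by
  have h1 : (up P f).map (upCompInv P g ξ X) ≫ upCompInv P f (g ≫ ξ) X =
      upCompInv P f g ((up P ξ).obj X) ≫ upCompInv P (f ≫ g) ξ X ≫ up₂ P (α_ f g ξ).inv X := by
    have := congrArg (· ≫ up₂ P (α_ f g ξ).inv X) (upCompInv_associator P f g ξ X)
    simp only [Category.assoc, ← up₂_comp, Iso.inv_hom_id] at this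
    have h2 : up₂ P (𝟙 (f ≫ g ≫ ξ)) X = 𝟙 _ := m₂_id P _ X
    rwa [h2, Category.comp_id] at this
  rw [upTri, upTri, upTri, up₂_comp, up₂_comp, Functor.map_comp]
  simp only [Category.assoc]
  rw [← reassoc_of% (upCompInv_whiskerLeft P f β X), reassoc_of% h1, upComp_inv_assoc]

lemma upTri_whisker {p q r : L} {μ : p ⟶ r} {ν : q ⟶ r} {f f' : p ⟶ q} (α : μ ⟶ f ≫ ν)
    (γ : f ⟶ f') (X : P.obj ⟨r⟩) :
    upTri P f' (α ≫ γ ▷ ν) X = up₂ P γ ((up P ν).obj X) ≫ upTri P f α X := by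
  rw [upTri, up₂_comp, reassoc_of% (upCompInv_whiskerRight P γ ν X), upTri]

/-- Whiskering a triangle with `f` amounts to applying it to `P^f X`; hence the lift commutes with
precomposition. -/
lemma upTri_restrict {p q r s : L} {μ : p ⟶ r} {ν : q ⟶ r} (g : p ⟶ q) (α : μ ⟶ g ≫ ν) (f : r ⟶ s)
    (X : P.obj ⟨s⟩) :
    (up P g).map (upCompInv P ν f X) ≫ upTri P g (α ▷ f ≫ (α_ g ν f).hom) X =
      upTri P g α ((up P f).obj X) ≫ upCompInv P μ f X := by
  rw [upTri, upTri, up₂_comp, reassoc_of% (upCompInv_associator P g ν f X), Category.assoc,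
    upCompInv_whiskerRight]

/-- The triangle used by `reflect` reduces to unit constraints, which is why transposing a lift
recovers the original cells. -/
lemma upTri_unitors {p q : L} (f : p ⟶ q) (X : P.obj ⟨q⟩) :
    upTri P f ((λ_ f).hom ≫ (ρ_ f).inv) X ≫ upComp P (𝟙 p) f X ≫ upId P p ((up P f).obj X) =
      (up P f).map (upId P q X) := by
  rw [← up₂_leftUnitor_inv, ← upTri_precomp, Iso.inv_hom_id_assoc, upTri, up₂_rightUnitor_inv,
    upCompInv_comp_assoc]

end

end CoopPs

open CoopPs

/-! ### Lifting a colax transformation to the co-dextrification: objects and functors -/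

namespace CodexLift

section

variable {L : Type w} [Bicategory.{w, w} L] {κ : Cardinal.{w}}
  {D : AdjPseudofunctor L (LexCat.{w, v, u} κ)}
  {C : L ⥤ᵖ LexCat.{w, v, u} κ} (G : D.rightPs.toOplax ⟶ C.toOplax)

/-- The functor underlying a component of a colax natural transformation. -/
abbrev fn (p : L) : D.toPs.obj ⟨p⟩ ⥤ C.obj p := (colaxApp G p).toFunctor

/-- The components of the transposed 2-cells of a colax natural transformation. -/
noncomputable def fnCell {p q : L} (f : p ⟶ q) (X : D.toPs.obj ⟨q⟩) :
    (fn G q).obj X ⟶ (lexMap C f).obj ((fn G p).obj ((up D.toPs f).obj X)) :=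
  LexCat.Hom₂.app (cell G f) X

lemma fnCell_naturality {p q : L} (f : p ⟶ q) {X Y : D.toPs.obj ⟨q⟩} (k : X ⟶ Y) :
    (fn G q).map k ≫ fnCell G f Y =
      fnCell G f X ≫ (lexMap C f).map ((fn G p).map ((up D.toPs f).map k)) :=
  LexCat.app_naturality (cell G f) k

lemma fnCell_m₂ {p q : L} {f g : p ⟶ q} (a : f ⟶ g) (X : D.toPs.obj ⟨q⟩) :
    fnCell G f X ≫ m₂ C a ((fn G p).obj ((up D.toPs f).obj X)) =
      fnCell G g X ≫ (lexMap C g).map ((fn G p).map (up₂ D.toPs a X)) :=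
  congrArg (fun x => LexCat.Hom₂.app x X) (cell_naturality G a)

lemma fnCell_id (p : L) (X : D.toPs.obj ⟨p⟩) :
    fnCell G (𝟙 p) X ≫ idHom C p ((fn G p).obj ((up D.toPs (𝟙 p)).obj X)) =
      (fn G p).map (upIdInv D.toPs p X) :=
  (congrArg (fun x => LexCat.Hom₂.app x X) (cell_id G p)).trans
    ((congrArg (· ≫ _) (Category.id_comp _)).trans (Category.id_comp _))

lemma fnCell_comp {p q r : L} (f : p ⟶ q) (g : q ⟶ r) (X : D.toPs.obj ⟨r⟩) :
    fnCell G (f ≫ g) X ≫ compHom C f g ((fn G p).obj ((up D.toPs (f ≫ g)).obj X)) =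
      fnCell G g X ≫ (lexMap C g).map (fnCell G f ((up D.toPs g).obj X)) ≫
        (lexMap C g).map ((lexMap C f).map ((fn G p).map (upCompInv D.toPs f g X))) := by
  -- The identities are the components of the associators of `Lex_κ`; with them in place the
  -- equation is `cell_comp` evaluated at `X`.
  have h : fnCell G (f ≫ g) X ≫ compHom C f g ((fn G p).obj ((up D.toPs (f ≫ g)).obj X)) =
      ((fnCell G g X ≫ ((lexMap C g).map (fnCell G f ((up D.toPs g).obj X)) ≫ 𝟙 _) ≫ 𝟙 _) ≫ 𝟙 _) ≫
        (lexMap C g).map ((lexMap C f).map ((fn G p).map (upCompInv D.toPs f g X))) :=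
    congrArg (fun x => LexCat.Hom₂.app x X) (cell_comp G f g)
  simpa only [Category.assoc, Category.comp_id, Category.id_comp] using h

/-- The structure morphisms of the lift of `X`. -/
noncomputable def liftMap {p q r : L} (X : D.toPs.obj ⟨r⟩) {μ : p ⟶ r} {ν : q ⟶ r} (f : p ⟶ q)
    (α : μ ⟶ f ≫ ν) : (fn G q).obj ((up D.toPs ν).obj X) ⟶
      (lexMap C f).obj ((fn G p).obj ((up D.toPs μ).obj X)) :=
  fnCell G f ((up D.toPs ν).obj X) ≫ (lexMap C f).map ((fn G p).map (upTri D.toPs f α X))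

lemma fnCell_id' (p : L) (X : D.toPs.obj ⟨p⟩) :
    fnCell G (𝟙 p) X = (fn G p).map (upIdInv D.toPs p X) ≫
      idInv C p ((fn G p).obj ((up D.toPs (𝟙 p)).obj X)) := by
  rw [← fnCell_id, Category.assoc, id_hom_inv, Category.comp_id]

lemma fnCell_comp' {p q r : L} (f : p ⟶ q) (g : q ⟶ r) (X : D.toPs.obj ⟨r⟩) :
    fnCell G (f ≫ g) X =
      fnCell G g X ≫ (lexMap C g).map (fnCell G f ((up D.toPs g).obj X)) ≫
        (lexMap C g).map ((lexMap C f).map ((fn G p).map (upCompInv D.toPs f g X))) ≫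
          compInv C f g ((fn G p).obj ((up D.toPs (f ≫ g)).obj X)) := by
  have h := congrArg (· ≫ compInv C f g ((fn G p).obj ((up D.toPs (f ≫ g)).obj X)))
    (fnCell_comp G f g X)
  simpa only [Category.assoc, comp_hom_inv, Category.comp_id] using h

lemma liftMap_id {p r : L} (X : D.toPs.obj ⟨r⟩) (μ : p ⟶ r) :
    liftMap G X (𝟙 p) (λ_ μ).inv = idInv C p ((fn G p).obj ((up D.toPs μ).obj X)) := by
  rw [liftMap, upTri_id, fnCell_id', Category.assoc, ← idInv_naturality, ← Category.assoc,
    ← Functor.map_comp, upIdInv_id, CategoryTheory.Functor.map_id, Category.id_comp]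

/-- The composition law of the cells of `G` combines with the pasting law in `D`: naturality of the
cell at `f` moves it past the triangle at `β`, and the composition constraints of `D` cancel. -/
lemma liftMap_comp {p q s r : L} (X : D.toPs.obj ⟨r⟩) {μ : p ⟶ r} {ν : q ⟶ r} {ξ : s ⟶ r}
    (f : p ⟶ q) (g : q ⟶ s) (α : μ ⟶ f ≫ ν) (β : ν ⟶ g ≫ ξ) :
    liftMap G X (f ≫ g) (α ≫ f ◁ β ≫ (α_ f g ξ).inv) = liftMap G X g β ≫
      (lexMap C g).map (liftMap G X f α) ≫
        compInv C f g ((fn G p).obj ((up D.toPs μ).obj X)) := by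
  rw [liftMap, liftMap, liftMap, upTri_comp, fnCell_comp']
  simp only [Category.assoc]
  rw [← compInv_naturality]
  simp only [← Functor.map_comp_assoc]
  rw [reassoc_of% (fnCell_naturality G f (upTri D.toPs g β X))]
  simp only [← Functor.map_comp, upCompInv_comp_assoc]

lemma liftMap_whisker {p q r : L} (X : D.toPs.obj ⟨r⟩) {μ : p ⟶ r} {ν : q ⟶ r} {f f' : p ⟶ q}
    (α : μ ⟶ f ≫ ν) (γ : f ⟶ f') :
    liftMap G X f' (α ≫ γ ▷ ν) =
      liftMap G X f α ≫ m₂ C γ ((fn G p).obj ((up D.toPs μ).obj X)) := by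
  rw [liftMap, liftMap, upTri_whisker, Category.assoc, m₂_naturality,
    reassoc_of% (fnCell_m₂ G γ ((up D.toPs ν).obj X)), Functor.map_comp, Functor.map_comp]

/-- The lift of `X` to the co-dextrification, with components `G_p (D^μ X)`. -/
noncomputable def liftObj {r : L} (X : D.toPs.obj ⟨r⟩) : CodexObj C r where
  obj {p} μ := (fn G p).obj ((up D.toPs μ).obj X)
  map f α := liftMap G X f α
  map_id μ := liftMap_id G X μ
  map_comp f g α β := liftMap_comp G X f g α β
  map_whisker α γ := liftMap_whisker G X α γ

lemma liftMap_naturality {p q r : L} {X Y : D.toPs.obj ⟨r⟩} (k : X ⟶ Y) {μ : p ⟶ r} {ν : q ⟶ r}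
    (f : p ⟶ q) (α : μ ⟶ f ≫ ν) :
    liftMap G X f α ≫ (lexMap C f).map ((fn G p).map ((up D.toPs μ).map k)) =
      (fn G q).map ((up D.toPs ν).map k) ≫ liftMap G Y f α := by
  rw [liftMap, liftMap, reassoc_of% (fnCell_naturality G f ((up D.toPs ν).map k)), Category.assoc,
    ← Functor.map_comp, ← Functor.map_comp, ← Functor.map_comp, ← Functor.map_comp,
    upTri_naturality]

/-- The lift, as a functor. -/
noncomputable def liftFunctor (r : L) : D.toPs.obj ⟨r⟩ ⥤ CodexObj C r where
  obj X := liftObj G X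
  map k :=
    { app := fun {p} μ => (fn G p).map ((up D.toPs μ).map k)
      naturality := fun f α => liftMap_naturality G k f α }
  map_id X := CodexObj.hom_ext fun {p} μ => by
    have : (fn G p).map ((up D.toPs μ).map (𝟙 X)) = 𝟙 _ := by simp
    exact this
  map_comp k l := CodexObj.hom_ext fun {p} μ => by
    have : (fn G p).map ((up D.toPs μ).map (k ≫ l)) =
      (fn G p).map ((up D.toPs μ).map k) ≫ (fn G p).map ((up D.toPs μ).map l) := by simp
    exact this

lemma liftFunctor_preserves (r : L) : PreservesCardinalLimits κ (liftFunctor G r) :=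
  fun J _ hJ => by
    have : ∀ {p q : L} (f : p ⟶ q), PreservesLimitsOfShape J (lexMap C f) :=
      fun f => (C.map f).preservesLimits J hJ
    have h (p : L) : PreservesLimitsOfShape J (fn G p) := (colaxApp G p).preservesLimits J hJ
    have h' {p : L} (μ : p ⟶ r) : PreservesLimitsOfShape J (up D.toPs μ) :=
      (D.toPs.map (Coop.mk₁ μ)).preservesLimits J hJ
    exact ⟨fun {F} => ⟨fun {c} hc => ⟨CodexObj.isLimitOfEval _ fun {p} μ =>
      have := h p
      have := h' μ
      isLimitOfPreserves (up D.toPs μ ⋙ fn G p) hc⟩⟩⟩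

/-- The cell of `G` at `𝟙 p` consists of unit constraints: the one of `C` cancels against the
definition of `res`, the one of `D` against `upTri_id`. -/
lemma liftObj_res {p r : L} (X : D.toPs.obj ⟨r⟩) {μ ν : p ⟶ r} (γ : μ ⟶ ν) :
    (liftObj G X).res γ = (fn G p).map (up₂ D.toPs γ X) := by
  change liftMap G X (𝟙 p) (γ ≫ (λ_ ν).inv) ≫
    idHom C p ((fn G p).obj ((up D.toPs μ).obj X)) = _
  rw [liftMap, Category.assoc, idHom_naturality, reassoc_of% (fnCell_id G p), upTri_precomp,
    upTri_id, ← Functor.map_comp, reassoc_of% (upIdInv_id D.toPs p)]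

/-- The comparison `F_p (D^f X) ⟶ Ĉ^f (F_q X)`. -/
noncomputable def liftRestrict {p q : L} (f : p ⟶ q) (X : D.toPs.obj ⟨q⟩) :
    (liftFunctor G p).obj ((up D.toPs f).obj X) ⟶
      (CodexObj.restrict C f).obj ((liftFunctor G q).obj X) where
  app {x} μ := (fn G x).map (upCompInv D.toPs μ f X)
  naturality {x y μ ν} g α := by
    change liftMap G ((up D.toPs f).obj X) g α ≫ (lexMap C g).map ((fn G x).map _) =
      (fn G y).map (upCompInv D.toPs ν f X) ≫ liftMap G X g (α ▷ f ≫ (α_ g ν f).hom)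
    rw [liftMap, liftMap, reassoc_of% (fnCell_naturality G g (upCompInv D.toPs ν f X)),
      Category.assoc, ← Functor.map_comp, ← Functor.map_comp, ← Functor.map_comp,
      ← Functor.map_comp, upTri_restrict]

instance {p q : L} (f : p ⟶ q) (X : D.toPs.obj ⟨q⟩) : IsIso (liftRestrict G f X) := by
  apply CodexObj.isIso_of_homApp
  intro x μ
  have : IsIso (upCompInv D.toPs μ f X) := ⟨upComp D.toPs μ f X, by simp, by simp⟩
  change IsIso ((fn G x).map (upCompInv D.toPs μ f X))
  infer_instance

/-- The comparison `F_p (D^f X) ≅ Ĉ^f (F_q X)`, as a natural isomorphism. -/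
noncomputable def liftRestrictIso {p q : L} (f : p ⟶ q) :
    up D.toPs f ⋙ liftFunctor G p ≅ liftFunctor G q ⋙ CodexObj.restrict C f :=
  NatIso.ofComponents (fun X => @asIso _ _ _ _ (liftRestrict G f X) inferInstance) fun {X Y} k =>
    CodexObj.hom_ext fun {x} μ => by
      have : (fn G x).map ((up D.toPs μ).map ((up D.toPs f).map k)) ≫
          (fn G x).map (upCompInv D.toPs μ f Y) =
        (fn G x).map (upCompInv D.toPs μ f X) ≫ (fn G x).map ((up D.toPs (μ ≫ f)).map k) := by
        rw [← Functor.map_comp, ← Functor.map_comp, upCompInv_naturality]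
      exact this

end

end CodexLift

/-! ### Pseudonatural transformations into `Ĉ` are determined at identities -/

namespace CodexTrans

section

variable {L : Type w} [Bicategory.{w, w} L] {κ : Cardinal.{w}}
  {P : Coop L ⥤ᵖ LexCat.{w, max v w, max u v w} κ}
  {C : L ⥤ᵖ LexCat.{w, max v w, max u v w} κ} (F : P ⟶ codex.{w, v, u} C)

/-- The functor underlying a component of a pseudonatural transformation into `Ĉ`. -/
def fn (p : L) : P.obj ⟨p⟩ ⥤ CodexObj C p := (F.app ⟨p⟩).toFunctor

/-- The components of the pseudonaturality isomorphisms of a transformation into `Ĉ`. -/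
def natApp {p q x : L} (f : p ⟶ q) (X : P.obj ⟨q⟩) (μ : x ⟶ p) :
    ((fn.{w, v, u} F p).obj ((up P f).obj X)).obj μ ⟶ ((fn.{w, v, u} F q).obj X).obj (μ ≫ f) :=
  CodexObj.homApp (C := C) (LexCat.Hom₂.app (F.naturality (Coop.mk₁ f)).hom X) μ

/-- The inverses of the components of the pseudonaturality isomorphisms. -/
def natInv {p q x : L} (f : p ⟶ q) (X : P.obj ⟨q⟩) (μ : x ⟶ p) :
    ((fn.{w, v, u} F q).obj X).obj (μ ≫ f) ⟶ ((fn.{w, v, u} F p).obj ((up P f).obj X)).obj μ :=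
  CodexObj.homApp (C := C) (LexCat.Hom₂.app (F.naturality (Coop.mk₁ f)).inv X) μ

/-- The components of the functors underlying `F`. -/
def fnMap {p x : L} {X Y : P.obj ⟨p⟩} (k : X ⟶ Y) (μ : x ⟶ p) :
    ((fn.{w, v, u} F p).obj X).obj μ ⟶ ((fn.{w, v, u} F p).obj Y).obj μ :=
  CodexObj.homApp ((fn.{w, v, u} F p).map k) μ

lemma nat_inv {p q x : L} (f : p ⟶ q) (X : P.obj ⟨q⟩) (μ : x ⟶ p) :
    natApp.{w, v, u} F f X μ ≫ natInv.{w, v, u} F f X μ = 𝟙 _ :=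
  congrArg (fun a => CodexObj.homApp (C := C) a μ) (LexCat.hom_inv_app (F.naturality (Coop.mk₁ f)) X)

lemma natInv_nat {p q x : L} (f : p ⟶ q) (X : P.obj ⟨q⟩) (μ : x ⟶ p) :
    natInv.{w, v, u} F f X μ ≫ natApp.{w, v, u} F f X μ = 𝟙 _ :=
  congrArg (fun a => CodexObj.homApp (C := C) a μ) (LexCat.inv_hom_app (F.naturality (Coop.mk₁ f)) X)

instance {p q x : L} (f : p ⟶ q) (X : P.obj ⟨q⟩) (μ : x ⟶ p) : IsIso (natApp.{w, v, u} F f X μ) :=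
  ⟨natInv.{w, v, u} F f X μ, nat_inv.{w, v, u} F f X μ, natInv_nat.{w, v, u} F f X μ⟩

@[simp] lemma fnMap_id {p x : L} (X : P.obj ⟨p⟩) (μ : x ⟶ p) :
    fnMap.{w, v, u} F (𝟙 X) μ = 𝟙 _ :=
  congrArg (fun a => CodexObj.homApp (C := C) a μ) ((fn.{w, v, u} F p).map_id X)

lemma fnMap_comp {p x : L} {X Y Z : P.obj ⟨p⟩} (k : X ⟶ Y) (l : Y ⟶ Z) (μ : x ⟶ p) :
    fnMap.{w, v, u} F (k ≫ l) μ = fnMap.{w, v, u} F k μ ≫ fnMap.{w, v, u} F l μ :=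
  congrArg (fun a => CodexObj.homApp (C := C) a μ) ((fn.{w, v, u} F p).map_comp k l)

lemma nat_naturality {p q x : L} (f : p ⟶ q) {X Y : P.obj ⟨q⟩} (k : X ⟶ Y) (μ : x ⟶ p) :
    fnMap.{w, v, u} F ((up P f).map k) μ ≫ natApp.{w, v, u} F f Y μ =
      natApp.{w, v, u} F f X μ ≫ fnMap.{w, v, u} F k (μ ≫ f) :=
  congrArg (fun a => CodexObj.homApp (C := C) a μ)
    (LexCat.app_naturality (F.naturality (Coop.mk₁ f)).hom k)

lemma res_fnMap {p x : L} {X Y : P.obj ⟨p⟩} (k : X ⟶ Y) {μ ν : x ⟶ p} (γ : μ ⟶ ν) :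
    ((fn.{w, v, u} F p).obj X).res γ ≫ fnMap.{w, v, u} F k μ =
      fnMap.{w, v, u} F k ν ≫ ((fn.{w, v, u} F p).obj Y).res γ :=
  CodexObj.res_naturality ((fn.{w, v, u} F p).map k) γ

lemma map_nat {p q x y : L} (f : p ⟶ q) (X : P.obj ⟨q⟩) {μ : x ⟶ p} {ν : y ⟶ p} (g : x ⟶ y)
    (α : μ ⟶ g ≫ ν) :
    ((fn.{w, v, u} F p).obj ((up P f).obj X)).map g α ≫
        (lexMap C g).map (natApp.{w, v, u} F f X μ) =
      natApp.{w, v, u} F f X ν ≫ ((fn.{w, v, u} F q).obj X).map g (α ▷ f ≫ (α_ g ν f).hom) :=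
  CodexObj.hom_naturality (C := C) (LexCat.Hom₂.app (F.naturality (Coop.mk₁ f)).hom X) g α

lemma res_nat {p q x : L} (f : p ⟶ q) (X : P.obj ⟨q⟩) {μ ν : x ⟶ p} (γ : μ ⟶ ν) :
    ((fn.{w, v, u} F p).obj ((up P f).obj X)).res γ ≫ natApp.{w, v, u} F f X μ =
      natApp.{w, v, u} F f X ν ≫ ((fn.{w, v, u} F q).obj X).res (γ ▷ f) :=
  (CodexObj.res_naturality (C := C) (LexCat.Hom₂.app (F.naturality (Coop.mk₁ f)).hom X) γ).trans
    (congrArg (natApp.{w, v, u} F f X ν ≫ ·)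
      (CodexObj.restrict_obj_res C f ((fn.{w, v, u} F q).obj X) γ))

lemma nat_up₂ {p q x : L} {f g : p ⟶ q} (a : f ⟶ g) (X : P.obj ⟨q⟩) (μ : x ⟶ p) :
    fnMap.{w, v, u} F (up₂ P a X) μ ≫ natApp.{w, v, u} F f X μ =
      natApp.{w, v, u} F g X μ ≫ ((fn.{w, v, u} F q).obj X).res (μ ◁ a) :=
  congrArg (fun a => CodexObj.homApp (C := C) (LexCat.Hom₂.app a X) μ)
    (F.naturality_naturality (Coop.mk₂ a))

lemma nat_id {p x : L} (X : P.obj ⟨p⟩) (μ : x ⟶ p) :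
    natApp.{w, v, u} F (𝟙 p) X μ ≫ ((fn.{w, v, u} F p).obj X).res (ρ_ μ).inv =
      fnMap.{w, v, u} F (upId P p X) μ :=
  (congrArg (fun a => CodexObj.homApp (C := C) (LexCat.Hom₂.app a X) μ)
    (F.naturality_id ⟨p⟩)).trans ((congrArg (_ ≫ ·) (Category.id_comp _)).trans
      (Category.comp_id _))

lemma nat_comp {p q r x : L} (f : p ⟶ q) (g : q ⟶ r) (X : P.obj ⟨r⟩) (μ : x ⟶ p) :
    natApp.{w, v, u} F (f ≫ g) X μ ≫ ((fn.{w, v, u} F r).obj X).res (α_ μ f g).hom =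
      fnMap.{w, v, u} F (upComp P f g X) μ ≫ natApp.{w, v, u} F f ((up P g).obj X) μ ≫
        natApp.{w, v, u} F g X (μ ≫ f) := by
  have h : natApp.{w, v, u} F (f ≫ g) X μ ≫ ((fn.{w, v, u} F r).obj X).res (α_ μ f g).hom =
      fnMap.{w, v, u} F (upComp P f g X) μ ≫ 𝟙 _ ≫ natApp.{w, v, u} F f ((up P g).obj X) μ ≫
        𝟙 _ ≫ natApp.{w, v, u} F g X (μ ≫ f) ≫ 𝟙 _ :=
    congrArg (fun a => CodexObj.homApp (C := C) (LexCat.Hom₂.app a X) μ)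
      (F.naturality_comp (Coop.mk₁ g) (Coop.mk₁ f))
  simpa only [Category.id_comp, Category.comp_id] using h

end

end CodexTrans

instance CodexObj.isIso_res {L : Type u₁} [Bicategory.{w₁, v₁} L] {κ : Cardinal.{w}}
    {C : L ⥤ᵖ LexCat.{w, v, u} κ} {r p : L} (Γ : CodexObj C r) {μ ν : p ⟶ r} (γ : μ ⟶ ν)
    [IsIso γ] : IsIso (Γ.res γ) :=
  ⟨Γ.res (inv γ), by rw [← res_comp, IsIso.inv_hom_id, res_id],
    by rw [← res_comp, IsIso.hom_inv_id, res_id]⟩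

namespace CodexTrans

section

variable {L : Type w} [Bicategory.{w, w} L] {κ : Cardinal.{w}}
  {P : Coop L ⥤ᵖ LexCat.{w, max v w, max u v w} κ}
  {C : L ⥤ᵖ LexCat.{w, max v w, max u v w} κ} (F F' : P ⟶ codex.{w, v, u} C)

/-- The isomorphism `(F_p (P^μ X))^{1_p} ≅ (F_r X)^μ`. -/
def evalHom {p r : L} (μ : p ⟶ r) (X : P.obj ⟨r⟩) :
    ((fn.{w, v, u} F p).obj ((up P μ).obj X)).obj (𝟙 p) ⟶ ((fn.{w, v, u} F r).obj X).obj μ :=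
  natApp.{w, v, u} F μ X (𝟙 p) ≫ ((fn.{w, v, u} F r).obj X).res (λ_ μ).inv

instance {p r : L} (μ : p ⟶ r) (X : P.obj ⟨r⟩) : IsIso (evalHom.{w, v, u} F μ X) :=
  inferInstanceAs (IsIso (_ ≫ _))

/-- The components of the transposed 2-cells of the transpose of `F`. -/
def transposeCell {p q : L} (f : p ⟶ q) (X : P.obj ⟨q⟩) :
    ((fn.{w, v, u} F q).obj X).obj (𝟙 q) ⟶
      (lexMap C f).obj (((fn.{w, v, u} F p).obj ((up P f).obj X)).obj (𝟙 p)) :=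
  ((fn.{w, v, u} F q).obj X).map f ((λ_ f).hom ≫ (ρ_ f).inv) ≫
    (lexMap C f).map (natInv.{w, v, u} F f X (𝟙 p))

lemma evalHom_naturality {p r : L} (μ : p ⟶ r) {X Y : P.obj ⟨r⟩} (k : X ⟶ Y) :
    fnMap.{w, v, u} F ((up P μ).map k) (𝟙 p) ≫ evalHom.{w, v, u} F μ Y =
      evalHom.{w, v, u} F μ X ≫ fnMap.{w, v, u} F k μ := by
  rw [evalHom, evalHom, reassoc_of% (nat_naturality.{w, v, u} F μ k (𝟙 p)), Category.assoc,
    res_fnMap]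

lemma evalHom_id {p : L} (X : P.obj ⟨p⟩) :
    evalHom.{w, v, u} F (𝟙 p) X = fnMap.{w, v, u} F (upId P p X) (𝟙 p) := by
  rw [evalHom, unitors_inv_equal, nat_id]

/-- Functoriality of `evalHom` in the 1-cell, from compatibility of `F` with composition. It makes
extended 2-cells modifications. -/
lemma evalHom_nat {p q r : L} (μ : p ⟶ q) (f : q ⟶ r) (X : P.obj ⟨r⟩) :
    evalHom.{w, v, u} F μ ((up P f).obj X) ≫ natApp.{w, v, u} F f X μ =
      fnMap.{w, v, u} F (upCompInv P μ f X) (𝟙 p) ≫ evalHom.{w, v, u} F (μ ≫ f) X := by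
  have h : (λ_ (μ ≫ f)).inv = (λ_ μ).inv ▷ f ≫ (α_ (𝟙 p) μ f).hom := by simp
  rw [evalHom, evalHom, Category.assoc, res_nat, h, CodexObj.res_comp,
    reassoc_of% (nat_comp.{w, v, u} F μ f X (𝟙 p)), ← Category.assoc (fnMap.{w, v, u} F _ _),
    ← fnMap_comp, upCompInv_comp, fnMap_id, Category.id_comp]

lemma evalHom_up₂ {p r : L} {μ ν : p ⟶ r} (γ : μ ⟶ ν) (X : P.obj ⟨r⟩) :
    fnMap.{w, v, u} F (up₂ P γ X) (𝟙 p) ≫ evalHom.{w, v, u} F μ X =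
      evalHom.{w, v, u} F ν X ≫ ((fn.{w, v, u} F r).obj X).res γ := by
  rw [evalHom, evalHom, reassoc_of% (nat_up₂.{w, v, u} F γ X (𝟙 p)), Category.assoc,
    ← CodexObj.res_comp, ← CodexObj.res_comp, leftUnitor_inv_naturality]

lemma transposeCell_evalHom {p q : L} (f : p ⟶ q) (X : P.obj ⟨q⟩) :
    transposeCell.{w, v, u} F f X ≫ (lexMap C f).map (evalHom.{w, v, u} F f X) =
      ((fn.{w, v, u} F q).obj X).map f (ρ_ f).inv := by
  rw [transposeCell, evalHom, Category.assoc, ← Functor.map_comp,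
    reassoc_of% (natInv_nat.{w, v, u} F f X (𝟙 p)), ← CodexObj.map_res, Iso.inv_hom_id_assoc]

/-- Under `evalHom` the structure morphisms of `F_r X` take the form of those of a lift: a
transposed cell followed by a triangle of `P`. Both sides reduce to one structure morphism of `F_r
X` over `f`, precomposed with `natApp`; the equality `h` of 2-cells then identifies them. -/
lemma evalHom_map {p q r : L} {μ : p ⟶ r} {ν : q ⟶ r} (f : p ⟶ q) (α : μ ⟶ f ≫ ν)
    (X : P.obj ⟨r⟩) :
    evalHom.{w, v, u} F ν X ≫ ((fn.{w, v, u} F r).obj X).map f α =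
      transposeCell.{w, v, u} F f ((up P ν).obj X) ≫
        (lexMap C f).map (fnMap.{w, v, u} F (upTri P f α X) (𝟙 p) ≫
          evalHom.{w, v, u} F μ X) := by
  have h : α ≫ f ◁ (λ_ ν).inv = α ≫ (ρ_ f).inv ▷ ν ≫ (α_ f (𝟙 q) ν).hom := by simp
  rw [upTri, fnMap_comp, Category.assoc, evalHom_up₂, ← Category.assoc (fnMap.{w, v, u} F _ _),
    ← evalHom_nat, Functor.map_comp, Functor.map_comp, Category.assoc,
    reassoc_of% (transposeCell_evalHom.{w, v, u} F f ((up P ν).obj X)),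
    reassoc_of% (map_nat.{w, v, u} F ν X f (ρ_ f).inv), ← CodexObj.map_res, evalHom,
    Category.assoc, ← CodexObj.map_whiskerLeft, h]

variable {F F'}

/-- The components of a 2-cell between transformations into `Ĉ`. -/
def homApp (m : F ⟶ F') {p x : L} (X : P.obj ⟨p⟩) (μ : x ⟶ p) :
    ((fn.{w, v, u} F p).obj X).obj μ ⟶ ((fn.{w, v, u} F' p).obj X).obj μ :=
  CodexObj.homApp (C := C) (LexCat.Hom₂.app (m.as.app ⟨p⟩) X) μ

lemma homApp_ext {m m' : F ⟶ F'} (h : ∀ {p x : L} (X : P.obj ⟨p⟩) (μ : x ⟶ p),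
    homApp.{w, v, u} m X μ = homApp.{w, v, u} m' X μ) : m = m' :=
  Pseudofunctor.StrongTrans.homCategory.ext fun _ =>
    codex_hom₂_ext.{w, v, u} fun X _ μ => h X μ

lemma homApp_nat (m : F ⟶ F') {p q x : L} (f : p ⟶ q) (X : P.obj ⟨q⟩) (μ : x ⟶ p) :
    homApp.{w, v, u} m ((up P f).obj X) μ ≫ natApp.{w, v, u} F' f X μ =
      natApp.{w, v, u} F f X μ ≫ homApp.{w, v, u} m X (μ ≫ f) :=
  congrArg (fun a => CodexObj.homApp (C := C) (LexCat.Hom₂.app a X) μ)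
    (m.as.naturality (Coop.mk₁ f))

lemma homApp_res (m : F ⟶ F') {p x : L} (X : P.obj ⟨p⟩) {μ ν : x ⟶ p} (γ : μ ⟶ ν) :
    ((fn.{w, v, u} F p).obj X).res γ ≫ homApp.{w, v, u} m X μ =
      homApp.{w, v, u} m X ν ≫ ((fn.{w, v, u} F' p).obj X).res γ :=
  CodexObj.res_naturality (C := C) (LexCat.Hom₂.app (m.as.app ⟨p⟩) X) γ

lemma homApp_evalHom (m : F ⟶ F') {p r : L} (X : P.obj ⟨r⟩) (μ : p ⟶ r) :
    homApp.{w, v, u} m ((up P μ).obj X) (𝟙 p) ≫ evalHom.{w, v, u} F' μ X =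
      evalHom.{w, v, u} F μ X ≫ homApp.{w, v, u} m X μ := by
  rw [evalHom, evalHom, reassoc_of% (homApp_nat.{w, v, u} m μ X (𝟙 p)), Category.assoc,
    homApp_res]

/-- A 2-cell between transformations into `Ĉ` is determined by its components at identities. -/
lemma ext_of_homApp_id {m m' : F ⟶ F'}
    (h : ∀ {p : L} (X : P.obj ⟨p⟩), homApp.{w, v, u} m X (𝟙 p) = homApp.{w, v, u} m' X (𝟙 p)) :
    m = m' :=
  homApp_ext.{w, v, u} fun X μ => by
    rw [← cancel_epi (evalHom.{w, v, u} F μ X), ← homApp_evalHom, ← homApp_evalHom, h]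

section

variable (n : ∀ {p : L} (X : P.obj ⟨p⟩),
    ((fn.{w, v, u} F p).obj X).obj (𝟙 p) ⟶ ((fn.{w, v, u} F' p).obj X).obj (𝟙 p))

/-- The components of the 2-cell with given components at identities. -/
noncomputable def extendApp {p r : L} (X : P.obj ⟨r⟩) (μ : p ⟶ r) :
    ((fn.{w, v, u} F r).obj X).obj μ ⟶ ((fn.{w, v, u} F' r).obj X).obj μ :=
  inv (evalHom.{w, v, u} F μ X) ≫ n ((up P μ).obj X) ≫ evalHom.{w, v, u} F' μ X

lemma evalHom_extendApp {p r : L} (X : P.obj ⟨r⟩) (μ : p ⟶ r) :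
    evalHom.{w, v, u} F μ X ≫ extendApp.{w, v, u} n X μ =
      n ((up P μ).obj X) ≫ evalHom.{w, v, u} F' μ X := by
  rw [extendApp, IsIso.hom_inv_id_assoc]

lemma extendApp_fnMap (hn : ∀ {p : L} {X Y : P.obj ⟨p⟩} (k : X ⟶ Y),
      fnMap.{w, v, u} F k (𝟙 p) ≫ n Y = n X ≫ fnMap.{w, v, u} F' k (𝟙 p))
    {p r : L} {X Y : P.obj ⟨r⟩} (k : X ⟶ Y) (μ : p ⟶ r) :
    fnMap.{w, v, u} F k μ ≫ extendApp.{w, v, u} n Y μ =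
      extendApp.{w, v, u} n X μ ≫ fnMap.{w, v, u} F' k μ := by
  rw [← cancel_epi (evalHom.{w, v, u} F μ X), ← Category.assoc, ← evalHom_naturality,
    Category.assoc, evalHom_extendApp, reassoc_of% hn,
    reassoc_of% (evalHom_extendApp.{w, v, u} n X μ), evalHom_naturality]

lemma extendApp_map (hn : ∀ {p : L} {X Y : P.obj ⟨p⟩} (k : X ⟶ Y),
      fnMap.{w, v, u} F k (𝟙 p) ≫ n Y = n X ≫ fnMap.{w, v, u} F' k (𝟙 p))
    (hn' : ∀ {p q : L} (f : p ⟶ q) (X : P.obj ⟨q⟩), n X ≫ transposeCell.{w, v, u} F' f X =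
      transposeCell.{w, v, u} F f X ≫ (lexMap C f).map (n ((up P f).obj X)))
    -- By `evalHom_map` the structure morphisms are built from transposed cells, with which `n`
    -- commutes by `hn'`, and from images of morphisms of `P`, with which it commutes by `hn`.
    {p q r : L} (X : P.obj ⟨r⟩) {μ : p ⟶ r} {ν : q ⟶ r} (f : p ⟶ q) (α : μ ⟶ f ≫ ν) :
    ((fn.{w, v, u} F r).obj X).map f α ≫ (lexMap C f).map (extendApp.{w, v, u} n X μ) =
      extendApp.{w, v, u} n X ν ≫ ((fn.{w, v, u} F' r).obj X).map f α := by
  rw [← cancel_epi (evalHom.{w, v, u} F ν X), reassoc_of% (evalHom_map.{w, v, u} F f α X),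
    ← Functor.map_comp, Category.assoc, evalHom_extendApp, reassoc_of% hn, Functor.map_comp,
    reassoc_of% (evalHom_extendApp.{w, v, u} n X ν), evalHom_map, reassoc_of% hn']

lemma extendApp_nat (hn : ∀ {p : L} {X Y : P.obj ⟨p⟩} (k : X ⟶ Y),
      fnMap.{w, v, u} F k (𝟙 p) ≫ n Y = n X ≫ fnMap.{w, v, u} F' k (𝟙 p))
    {p q x : L} (f : p ⟶ q) (X : P.obj ⟨q⟩) (μ : x ⟶ p) :
    extendApp.{w, v, u} n ((up P f).obj X) μ ≫ natApp.{w, v, u} F' f X μ =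
      natApp.{w, v, u} F f X μ ≫ extendApp.{w, v, u} n X (μ ≫ f) := by
  rw [← cancel_epi (evalHom.{w, v, u} F μ ((up P f).obj X)),
    reassoc_of% (evalHom_extendApp.{w, v, u} n ((up P f).obj X) μ), evalHom_nat,
    reassoc_of% (evalHom_nat.{w, v, u} F μ f X), evalHom_extendApp, reassoc_of% hn]

/-- At an identity, `evalHom` is the image of the unit constraint of `P`, so conjugation by it does
nothing to the natural family `n`. -/
lemma extendApp_id (hn : ∀ {p : L} {X Y : P.obj ⟨p⟩} (k : X ⟶ Y),
      fnMap.{w, v, u} F k (𝟙 p) ≫ n Y = n X ≫ fnMap.{w, v, u} F' k (𝟙 p))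
    {p : L} (X : P.obj ⟨p⟩) : extendApp.{w, v, u} n X (𝟙 p) = n X := by
  rw [← cancel_epi (evalHom.{w, v, u} F (𝟙 p) X), evalHom_extendApp, evalHom_id, evalHom_id, hn]

/-- The 2-cell between transformations into `Ĉ` with given components at identities. -/
noncomputable def extend (hn : ∀ {p : L} {X Y : P.obj ⟨p⟩} (k : X ⟶ Y),
      fnMap.{w, v, u} F k (𝟙 p) ≫ n Y = n X ≫ fnMap.{w, v, u} F' k (𝟙 p))
    (hn' : ∀ {p q : L} (f : p ⟶ q) (X : P.obj ⟨q⟩), n X ≫ transposeCell.{w, v, u} F' f X =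
      transposeCell.{w, v, u} F f X ≫ (lexMap C f).map (n ((up P f).obj X))) : F ⟶ F' where
  as :=
    { app := fun Y => LexCat.Hom₂.mk
        { app := fun X =>
            ({ app := fun μ => extendApp.{w, v, u} n X μ
               naturality := fun f α => extendApp_map.{w, v, u} n hn hn' X f α } :
              (fn.{w, v, u} F Y.of).obj X ⟶ (fn.{w, v, u} F' Y.of).obj X)
          naturality := fun _ _ k => CodexObj.hom_ext fun μ => extendApp_fnMap.{w, v, u} n hn k μ }
      naturality := fun f => codex_hom₂_ext.{w, v, u} fun X _ μ =>
        extendApp_nat.{w, v, u} n hn f.un X μ }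

end

end

end CodexTrans

/-! ### The lift as a pseudonatural transformation -/

namespace CodexLift

section

variable {L : Type w} [Bicategory.{w, w} L] {κ : Cardinal.{w}}
  {D : AdjPseudofunctor L (LexCat.{w, max v w, max u v w} κ)}
  {C : L ⥤ᵖ LexCat.{w, max v w, max u v w} κ} (G : D.rightPs.toOplax ⟶ C.toOplax)

/-- The lift of `X` to the co-dextrification, as a 1-cell of `Lex_κ`. -/
noncomputable def liftHom (r : L) : D.toPs.obj ⟨r⟩ ⟶ codexCat.{w, v, u} C r :=
  LexCat.Hom.mk (liftFunctor G r) (liftFunctor_preserves G r)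

/-- The comparison isomorphism `F_p (D^f X) ≅ Ĉ^f (F_q X)` for the lift. -/
noncomputable def liftNat {p q : L} (f : p ⟶ q) :
    D.toPs.map (Coop.mk₁ f) ≫ liftHom.{w, v, u} G p ≅
      liftHom.{w, v, u} G q ≫ codexRestrict.{w, v, u} C f :=
  LexCat.isoMk (liftRestrictIso G f)

/-- The pseudonatural transformation into the co-dextrification whose transpose is `G`. -/
noncomputable def lift : D.toPs ⟶ codex.{w, v, u} C where
  app Y := liftHom.{w, v, u} G Y.of
  naturality f := liftNat.{w, v, u} G f.un
  naturality_naturality {Y Z f g} η := codex_hom₂_ext.{w, v, u} fun X x μ => by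
    -- By `liftObj_res` both sides are images under `G_x`, so the pseudonaturality laws of the lift
    -- reduce to coherence of `D` alone.
    have : (fn G x).map ((up D.toPs μ).map (up₂ D.toPs η.un₂ X)) ≫
        (fn G x).map (upCompInv D.toPs μ g.un X) =
      (fn G x).map (upCompInv D.toPs μ f.un X) ≫ (liftObj G X).res (μ ◁ η.un₂) := by
      rw [liftObj_res]
      refine ((fn G x).map_comp _ _).symm.trans (Eq.trans ?_ ((fn G x).map_comp _ _))
      rw [upCompInv_whiskerLeft]
    exact this
  naturality_id Y := codex_hom₂_ext.{w, v, u} fun X x μ => by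
    have : (fn G x).map (upCompInv D.toPs μ (𝟙 Y.of) X) ≫ (liftObj G X).res (ρ_ μ).inv =
        (fn G x).map ((up D.toPs μ).map (upId D.toPs Y.of X)) ≫ 𝟙 _ ≫ 𝟙 _ := by
      rw [liftObj_res, Category.comp_id, Category.comp_id]
      refine ((fn G x).map_comp _ _).symm.trans ?_
      rw [up₂_rightUnitor_inv, upCompInv_comp_assoc]
    exact this
  naturality_comp {Y Z W} f g := codex_hom₂_ext.{w, v, u} fun X x μ => by
    have : (fn G x).map (upCompInv D.toPs μ (g.un ≫ f.un) X) ≫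
        (liftObj G X).res (α_ μ g.un f.un).hom =
      (fn G x).map ((up D.toPs μ).map (upComp D.toPs g.un f.un X)) ≫ 𝟙 _ ≫
        (fn G x).map (upCompInv D.toPs μ g.un ((up D.toPs f.un).obj X)) ≫ 𝟙 _ ≫
          (fn G x).map (upCompInv D.toPs (μ ≫ g.un) f.un X) ≫ 𝟙 _ := by
      rw [liftObj_res, Category.comp_id, Category.id_comp, Category.id_comp]
      refine ((fn G x).map_comp _ _).symm.trans ?_
      rw [← Functor.map_comp, ← upCompInv_associator, ← Functor.map_comp,
        ← Functor.map_comp_assoc, upComp_inv, CategoryTheory.Functor.map_id, Category.id_comp]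
    exact this

end

end CodexLift

/-! ### Transposition is an equivalence -/

section

variable {L : Type w} [Bicategory.{w, w} L] {κ : Cardinal.{w}}

lemma cell_reflect (C : L ⥤ᵖ LexCat.{w, max v w, max u v w} κ)
    (h : ∀ {X Y : Coop L} (f : X ⟶ Y), IsLeftAdjoint ((codex.{w, v, u} C).map f)) {p q : L}
    (f : p ⟶ q) : cell (reflect.{w, v, u} C h) f = reflectCell.{w, v, u} C f :=
  Equiv.symm_apply_apply _ _

/-- The transpose `rightTrans F ≫ reflect` of a pseudonatural transformation into `Ĉ`. -/
noncomputable def codexTranspose {D : AdjPseudofunctor L (LexCat.{w, max v w, max u v w} κ)}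
    {C : L ⥤ᵖ LexCat.{w, max v w, max u v w} κ}
    (h : ∀ {X Y : Coop L} (f : X ⟶ Y), IsLeftAdjoint ((codex.{w, v, u} C).map f))
    (F : D.toPs ⟶ codex.{w, v, u} C) : D.rightPs.toOplax ⟶ C.toOplax :=
  rightTrans (E := codexAdj.{w, v, u} C h) F ≫ reflect.{w, v, u} C h

/-- The chosen right adjoints disappear here: `cell_rightTrans_comp` leaves the canonical cell of
`reflect` and the inverse pseudonaturality of `F`, with identity associators. -/
lemma cell_codexTranspose_app {D : AdjPseudofunctor L (LexCat.{w, max v w, max u v w} κ)}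
    {C : L ⥤ᵖ LexCat.{w, max v w, max u v w} κ}
    (h : ∀ {X Y : Coop L} (f : X ⟶ Y), IsLeftAdjoint ((codex.{w, v, u} C).map f))
    (F : D.toPs ⟶ codex.{w, v, u} C) {p q : L} (f : p ⟶ q) (X : D.toPs.obj ⟨q⟩) :
    LexCat.Hom₂.app (cell (codexTranspose.{w, v, u} h F) f) X =
      CodexTrans.transposeCell.{w, v, u} F f X := by
  have h1 := cell_rightTrans_comp (E := codexAdj.{w, v, u} C h) F (reflect.{w, v, u} C h) f
  rw [cell_reflect.{w, v, u}] at h1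
  refine (congrArg (fun a => LexCat.Hom₂.app a X) h1).trans ?_
  have h2 : CodexTrans.transposeCell.{w, v, u} F f X =
    (((CodexTrans.fn.{w, v, u} F q).obj X).map f ((λ_ f).hom ≫ (ρ_ f).inv) ≫ 𝟙 _ ≫
      (lexMap C f).map (CodexTrans.natInv.{w, v, u} F f X (𝟙 p)) ≫ 𝟙 _) ≫ 𝟙 _ := by
    simp [CodexTrans.transposeCell]
  exact h2.symm

lemma exists_of_codexTranspose {D : AdjPseudofunctor L (LexCat.{w, max v w, max u v w} κ)}
    {C : L ⥤ᵖ LexCat.{w, max v w, max u v w} κ}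
    (h : ∀ {X Y : Coop L} (f : X ⟶ Y), IsLeftAdjoint ((codex.{w, v, u} C).map f))
    {F F' : D.toPs ⟶ codex.{w, v, u} C}
    (n : codexTranspose.{w, v, u} h F ⟶ codexTranspose.{w, v, u} h F') :
    ∃ m : F ⟶ F', ∀ {p : L} (X : D.toPs.obj ⟨p⟩),
      CodexTrans.homApp.{w, v, u} m X (𝟙 p) = LexCat.Hom₂.app (n.as.app p) X := by
  let n₀ : ∀ {p : L} (X : D.toPs.obj ⟨p⟩), ((CodexTrans.fn.{w, v, u} F p).obj X).obj (𝟙 p) ⟶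
      ((CodexTrans.fn.{w, v, u} F' p).obj X).obj (𝟙 p) :=
    fun {p} X => LexCat.Hom₂.app (n.as.app p) X
  have hn : ∀ {p : L} {X Y : D.toPs.obj ⟨p⟩} (k : X ⟶ Y),
      CodexTrans.fnMap.{w, v, u} F k (𝟙 p) ≫ n₀ Y =
        n₀ X ≫ CodexTrans.fnMap.{w, v, u} F' k (𝟙 p) :=
    fun {p} X Y k => LexCat.app_naturality (n.as.app p) k
  have hn' : ∀ {p q : L} (f : p ⟶ q) (X : D.toPs.obj ⟨q⟩),
      n₀ X ≫ CodexTrans.transposeCell.{w, v, u} F' f X =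
        CodexTrans.transposeCell.{w, v, u} F f X ≫
          (lexMap C f).map (n₀ ((up D.toPs f).obj X)) := by
    intro p q f X
    -- The modification law of `n`, transposed, is the compatibility with transposed cells that
    -- `CodexTrans.extend` requires.
    have e := (modification_iff_cell (G := codexTranspose.{w, v, u} h F)
      (G' := codexTranspose.{w, v, u} h F') f (n.as.app p) (n.as.app q)).1 (n.as.naturality f)
    rw [← cell_codexTranspose_app.{w, v, u} h, ← cell_codexTranspose_app.{w, v, u} h]
    exact congrArg (fun a => LexCat.Hom₂.app a X) e
  exact ⟨CodexTrans.extend.{w, v, u} n₀ hn hn', fun X =>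
    CodexTrans.extendApp_id.{w, v, u} n₀ hn X⟩

/-- The comparison of `G` with the transpose of its lift, at an object. -/
noncomputable def liftTransposeIso {D : AdjPseudofunctor L (LexCat.{w, max v w, max u v w} κ)}
    {C : L ⥤ᵖ LexCat.{w, max v w, max u v w} κ} (G : D.rightPs.toOplax ⟶ C.toOplax) (p : L) :
    CodexLift.liftHom.{w, v, u} G p ≫ codexEval.{w, v, u} C (𝟙 p) ≅ colaxApp G p :=
  (Bicategory.whiskerRightIso (D.toPs.mapId ⟨p⟩) (colaxApp G p)).trans (λ_ _)

lemma eq_of_comp_eq_id {A : Type u} [Category.{v} A] {x y : A} {a b : x ⟶ y} {c : y ⟶ x}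
    (h : a ≫ c = 𝟙 x) (h' : c ≫ b = 𝟙 y) : b = a := by
  rw [← Category.id_comp b, ← h, Category.assoc, h', Category.comp_id]

lemma natInv_lift {D : AdjPseudofunctor L (LexCat.{w, max v w, max u v w} κ)}
    {C : L ⥤ᵖ LexCat.{w, max v w, max u v w} κ} (G : D.rightPs.toOplax ⟶ C.toOplax) {p q x : L}
    (f : p ⟶ q) (X : D.toPs.obj ⟨q⟩) (μ : x ⟶ p) :
    CodexTrans.natInv.{w, v, u} (CodexLift.lift.{w, v, u} G) f X μ =
      (CodexLift.fn G x).map (upComp D.toPs μ f X) := by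
  have h : (CodexLift.fn G x).map (upComp D.toPs μ f X) ≫
      (CodexLift.fn G x).map (upCompInv D.toPs μ f X) = 𝟙 _ := by
    rw [← Functor.map_comp, upComp_inv, CategoryTheory.Functor.map_id]
  -- By construction the pseudonaturality component of the lift is the image of `upCompInv`;
  -- uniqueness of inverses then identifies `natInv`.
  have h' : (CodexLift.fn G x).map (upComp D.toPs μ f X) ≫
      CodexTrans.natApp.{w, v, u} (CodexLift.lift.{w, v, u} G) f X μ = 𝟙 _ := h
  exact eq_of_comp_eq_id h' (CodexTrans.nat_inv.{w, v, u} _ f X μ)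

lemma nonempty_codexTranspose_lift_iso {D : AdjPseudofunctor L (LexCat.{w, max v w, max u v w} κ)}
    {C : L ⥤ᵖ LexCat.{w, max v w, max u v w} κ}
    (h : ∀ {X Y : Coop L} (f : X ⟶ Y), IsLeftAdjoint ((codex.{w, v, u} C).map f))
    (G : D.rightPs.toOplax ⟶ C.toOplax) :
    Nonempty (codexTranspose.{w, v, u} h (CodexLift.lift.{w, v, u} G) ≅ G) := by
  refine ⟨Oplax.OplaxTrans.isoMk (fun p => liftTransposeIso.{w, v, u} G p) fun {p q} f => ?_⟩
  refine (modification_iff_cell (G := codexTranspose.{w, v, u} h (CodexLift.lift.{w, v, u} G))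
    (G' := G) f (liftTransposeIso.{w, v, u} G p).hom (liftTransposeIso.{w, v, u} G q).hom).2 ?_
  refine LexCat.hom₂_ext fun X => ?_
  have h1 := cell_codexTranspose_app.{w, v, u} h (CodexLift.lift.{w, v, u} G) f X
  -- This is the modification law for the unit constraints of `D`: naturality of the cell of `G`
  -- reduces it to `upTri_unitors`.
  have h2 : ((CodexLift.fn G q).map (upId D.toPs q X) ≫ 𝟙 _) ≫ CodexLift.fnCell G f X =
      (CodexLift.liftMap G X f ((λ_ f).hom ≫ (ρ_ f).inv) ≫
        (lexMap C f).map ((CodexLift.fn G p).map (upComp D.toPs (𝟙 p) f X))) ≫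
          (lexMap C f).map ((CodexLift.fn G p).map (upId D.toPs p ((up D.toPs f).obj X)) ≫ 𝟙 _) := by
    rw [Category.comp_id, Category.comp_id, CodexLift.liftMap, CodexLift.fnCell_naturality]
    simp only [Category.assoc, ← Functor.map_comp]
    rw [upTri_unitors]
  have h3 : CodexTrans.transposeCell.{w, v, u} (CodexLift.lift.{w, v, u} G) f X =
      CodexLift.liftMap G X f ((λ_ f).hom ≫ (ρ_ f).inv) ≫
        (lexMap C f).map ((CodexLift.fn G p).map (upComp D.toPs (𝟙 p) f X)) := by
    rw [CodexTrans.transposeCell, natInv_lift]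
    rfl
  rw [← h3, ← h1] at h2
  exact h2

variable (h : ∀ (C : L ⥤ᵖ LexCat.{w, max v w, max u v w} κ) {X Y : Coop L} (f : X ⟶ Y),
    IsLeftAdjoint ((codex.{w, v, u} C).map f))
  (D : PsAdj L (LexCat.{w, max v w, max u v w} κ)) (C : PsColax L (LexCat.{w, max v w, max u v w} κ))

instance transposeFunctor_faithful : (transposeFunctor.{w, v, u} h D C).Faithful where
  map_injective {_ _} _ _ e := hom₂_ext (CodexTrans.ext_of_homApp_id.{w, v, u} fun {p} X =>
    congrArg (fun a => LexCat.Hom₂.app (a.hom.as.app p) X) e)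

instance transposeFunctor_full : (transposeFunctor.{w, v, u} h D C).Full where
  map_surjective {F F'} n := by
    obtain ⟨m, hm⟩ := exists_of_codexTranspose.{w, v, u} (D := D) (h C) (F := F.hom) (F' := F'.hom)
      n.hom
    exact ⟨Hom₂.mk m, hom₂_ext (Oplax.OplaxTrans.homCategory.ext fun p =>
      LexCat.hom₂_ext fun X => hm X)⟩

instance transposeFunctor_essSurj : (transposeFunctor.{w, v, u} h D C).EssSurj where
  mem_essImage G :=
    ⟨mkHom (CodexLift.lift.{w, v, u} (D := D) G.hom),
      (nonempty_codexTranspose_lift_iso.{w, v, u} (D := D) (h C) G.hom).map isoMk⟩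

/-- Transposition `F ↦ U F ≫ reflect` is an equivalence of categories. -/
theorem isEquivalence_transposeFunctor : (transposeFunctor.{w, v, u} h D C).IsEquivalence where

end

theorem mainTheorem9 {L : Type w} [Bicategory.{w, w} L] (κ : Cardinal.{w}) (hκ : κ.IsRegular)
    (hL : HasCardinalLT (Σ (p q : L) (f g : p ⟶ q), f ⟶ g) κ) :
    ∃ h : ∀ (C : L ⥤ᵖ LexCat.{w, max v w, max u v w} κ) {X Y : Coop L} (f : X ⟶ Y),
        IsLeftAdjoint ((codex.{w, v, u} C).map f),
      (∀ (D : PsAdj L (LexCat.{w, max v w, max u v w} κ))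
        (C : PsColax L (LexCat.{w, max v w, max u v w} κ)),
          (transposeFunctor.{w, v, u} h D C).IsEquivalence) ∧
      ∃ A : RightBiadjoint (forgetAdj L (LexCat.{w, max v w, max u v w} κ)),
        ∀ C : PsColax L (LexCat.{w, max v w, max u v w} κ),
          A.R.obj C = codexObj.{w, v, u} h C ∧
          HEq (A.counit.app C) (codexCounit.{w, v, u} h C) :=
  ⟨fun C _ _ f => isLeftAdjoint_codex_map.{w, v, u} hκ hL C f, fun D C =>
    isEquivalence_transposeFunctor.{w, v, u} _ D C,
    RightBiadjoint.ofObjwise (fun D C => isEquivalence_transposeFunctor.{w, v, u}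
      (fun C _ _ f => isLeftAdjoint_codex_map.{w, v, u} hκ hL C f) D C),
    -- The biadjoint is built on the given objects and universal arrows, so both agree
    -- definitionally; `HEq` appears in the statement because the type of the counit component
    -- involves `A.R.obj C`.
    fun _ => ⟨rfl, HEq.rfl⟩⟩
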